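/- Conventions. All complex powers are principal, with argument in $(-\pi,\pi]$. For real $x\neq0$, $\Gamma(s,x)=\int_x^\infty e^{-t}t^{s-1}\,dt$ denotes the incomplete gamma function, continued to an entire function of $s$ (for $x<0$ one takes $t^{s-1}=|t|^{s-1}e^{\pi i(s-1)}$ for $t<0$). For $\gamma=\begin{pmatrix}a&b\\c&d\end{pmatrix}$ we write $\gamma(i\infty)=a/c$. Let $N\ge1$, $k\in\frac12\mathbb Z$, and let $\chi_\theta(\gamma)=\theta(\gamma z)/((cz+d)^{1/2}\theta(z))$ be the multiplier of $\theta(z)=\sum_{n\in\mathbb Z}e^{2\pi i n^2z}$. Let $g\in M_k^!(\Gamma_0(4N))$, i.e. $g$ is holomorphic on the upper half-plane $\mathbb H$, $g(\gamma z)=\chi_\theta(\gamma)^{2k}(cz+d)^kg(z)$ for $\gamma\in\Gamma_0(4N)$, and for every $\gamma\in SL_2(\mathbb Z)$ there is an expansion $(cz+d)^{-k}g(\gamma z)=\sum_{n\gg-\infty}b_\gamma(n)e^{2\pi i(n+\kappa_\gamma)z/\lambda_\gamma}$ with $\kappa_\gamma\in[0,1)$ and $\lambda_\gamma\in\mathbb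 Z_{>0}$. Write $g(z)=\sum_{n\gg-\infty} b(n)e^{2\pi inz}$. Let $S_k^!(\Gamma_0(4N))$ be the subspace of those $g$ whose constant terms vanish at all cusps (that is, $b_\gamma(0)=0$ for every $\gamma$ with $\kappa_\gamma=0$). For $r\in\mathbb Q$ choose $\gamma=\begin{pmatrix}a&b\\c&d\end{pmatrix}\in SL_2(\mathbb Z)$ with $\gamma(i\infty)=r$ and put $$L^{\rm reg}_r(g,s)=\frac1{\Gamma(s)}\sum_{n\ne0}\frac{b(n)e^{2\pi inr}}{n^s}\Gamma(s,2\pi n)+\frac{i^k(2\pi)^{2s-k}(c^2)^{k-s}}{c^k\,\Gamma(s)}\sum_{n+\kappa_\gamma\neq0}\frac{b_\gamma(n)e^{2\pi i(n+\kappa_\gamma)(-d/c)/\lambda_\gamma}}{\left(\frac{n+\kappa_\gamma}{\lambda_\gamma}\right)^{k-s}}\Gamma\!\left(k-s,\tfrac{2\pi(n+\kappa_\gamma)}{c^2\lambda_\gamma}\right)-\frac{(2\pi)^sb(0)}{s\Gamma(s)}-\delta_{\kappa_\gamma,0}\frac{i^k(2\pi)^sb_\gamma(0)}{c^k(k-s)\Gamma(s)}.$$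 Regularized integrals. For $z_1\in\mathbb H$ and $s\in\mathbb C$ set $$\int^{\rm reg}_{[z_1,i\infty]}g(\tau)(\tau-r)^{s}d\tau=\left[\left[\int_{z_1}^{i\infty}g(\tau)(\tau-r)^{s+\alpha}e^{2\pi i\beta\tau}d\tau\right]_{\beta=0}\right]_{\alpha=0},$$ $$\int^{\rm reg}_{[z_1,r]}g(\tau)(\tau-r)^sd\tau=\left[\left[\int_{\gamma^{-1}z_1}^{i\infty}(c\tau+d)^{-2+\alpha}g(\gamma\tau)(\gamma\tau-r)^{s+\alpha}e^{2\pi i\beta\tau}d\tau\right]_{\beta=0}\right]_{\alpha=0},$$ and $\int^{\rm reg}_{[r,i\infty]}=-\int^{\rm reg}_{[z_1,r]}+\int^{\rm reg}_{[z_1,i\infty]}$; the last is called well defined if both terms exist for every $z_1\in\mathbb H$ and the result does not depend on $z_1$. Here $[\cdot]_{\beta=0}$ is the limit, as $\beta\to0$ in $\operatorname{Im}\beta>0$, of the analytic continuation to $\operatorname{Im}\beta>0$ of the integral, which converges absolutely for $\operatorname{Re}\beta\gg0$; it is taken for $\operatorname{Re}\alpha\ll0$, and $[\cdot]_{\alpha=0}$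 is the value at $\alpha=0$ of its meromorphic continuation in $\alpha$, which is required to be analytic there. Statement. (1) For each $r\in\mathbb Q$, both series in $L^{\rm reg}_r(g,s)$ converge absolutely for all $s\in\mathbb C\setminus\{0,k\}$, and $L^{\rm reg}_r(g,s)$ is analytic there. If $g\in S^!_k(\Gamma_0(4N))$, then $L^{\rm reg}_r(g,s)$ is entire in $s$. (2) For each $r\in\mathbb Q$, $L_r^{\rm reg}(g,s)$ is meromorphic on $\mathbb C$, and for $\operatorname{Re}(s)>k$, $s\neq0$, the integral $\int^{\rm reg}_{[r,i\infty]}g(\tau)(\tau-r)^{s-1}d\tau$ is well defined and $$\frac1{\Gamma(s)}\left(\frac{2\pi}i\right)^s\int^{\rm reg}_{[r,i\infty]}g(\tau)(\tau-r)^{s-1}d\tau=L_r^{\rm reg}(g,s).$$ If $g\in S^!_k(\Gamma_0(4N))$, then the integral is well defined and this identity holds for all $s\in\mathbb C$, so that the left-hand side is entire. The definition of $L_r^{\rm reg}(g,s)$ is independent of the choice of $\gamma$ (and of the choice of the expansion at $\gamma$). (3) For $\gamma=\begin{pmatrix}a&b\\c&d\end{pmatrix}\in\Gamma_0(4N)$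 with $c\neq0$, $$\Gamma(s)(2\pi)^{-s}L^{\rm reg}_{\gamma(i\infty)}(g,s)=i^kc^{-k}(c^2)^{k-s}\chi_\theta(\gamma)^{2k}\,\Gamma(k-s)(2\pi)^{-(k-s)}L^{\rm reg}_{\gamma^{-1}(i\infty)}(g,k-s)$$ for all $s\in\mathbb C$ such that neither $s$ nor $k-s$ is a non-positive integer (hence as an identity of meromorphic functions). -/

import Mathlib

open Complex MeasureTheory Set Filter Topology
open UpperHalfPlane hiding I
open scoped MatrixGroups Manifold

noncomputable section

namespace RegL

/-! All complex powers are principal powers, with argument in `(-π, π]`. -/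

/-- The half-integral weight `k = m / 2`. -/
def wt (m : ℤ) : ℂ := (m : ℂ) / 2

/-- The automorphy factor `c z + d`. -/
def cd (γ : SL(2, ℤ)) (z : ℍ) : ℂ := ((γ 1 0 : ℤ) : ℂ) * (z : ℂ) + ((γ 1 1 : ℤ) : ℂ)

/-- The theta function `1 + 2 ∑_{n ≥ 1} q^{n²} = ∑_{n ∈ ℤ} exp (2 π i n² z)`. -/
def theta (z : ℍ) : ℂ := ∑' n : ℤ, cexp (2 * Real.pi * I * (n : ℂ) ^ 2 * (z : ℂ))

/-- The theta multiplier `θ(γz) / ((cz+d)^{1/2} θ(z))` of `γ ∈ Γ₀(4)`. The quotient does not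
depend on `z`, and it is evaluated at `z = i`. -/
def thetaMultiplier (γ : SL(2, ℤ)) : ℂ :=
  theta (γ • UpperHalfPlane.I) /
    (cd γ UpperHalfPlane.I ^ (1 / 2 : ℂ) * theta UpperHalfPlane.I)

/-- `(cz+d)^{-k} g(γz) = ∑_n b(n) exp (2 π i (n + κ) z / w)` on the upper half-plane, where
`κ ∈ [0,1)`, `w` is a positive integer and only finitely many `b(n)` with `n < 0` are nonzero. -/
structure HasFourierExpansion (m : ℤ) (g : ℍ → ℂ) (γ : SL(2, ℤ)) (κ : ℝ) (w : ℕ) (b : ℤ → ℂ) :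
    Prop where
  shift_nonneg : 0 ≤ κ
  shift_lt_one : κ < 1
  width_pos : 0 < w
  principal : ∃ n₀ : ℤ, ∀ n < n₀, b n = 0
  expansion : ∀ z : ℍ, HasSum
    (fun n : ℤ => b n * cexp (2 * Real.pi * I * ((n : ℂ) + (κ : ℂ)) * (z : ℂ) / (w : ℂ)))
    (cd γ z ^ (-wt m) * g (γ • z))

/-- The space `M^!_k(Γ₀(4N))`, `k = m/2`, of weakly holomorphic modular forms with multiplier
`χ_θ^{2k}`: holomorphic on the upper half-plane, modular, and meromorphic at all cusps. -/
structure IsWeaklyHolomorphic (N : ℕ) (m : ℤ) (g : ℍ → ℂ) : Prop where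
  holomorphic : MDiff g
  modular : ∀ γ ∈ CongruenceSubgroup.Gamma0 (4 * N), ∀ z : ℍ,
    g (γ • z) = thetaMultiplier γ ^ m * cd γ z ^ wt m * g z
  cusps : ∀ γ : SL(2, ℤ), ∃ (κ : ℝ) (w : ℕ) (b : ℤ → ℂ), HasFourierExpansion m g γ κ w b

/-- The constant terms of `g` vanish at all cusps. (For `κ ≠ 0` there is no constant term.) -/
def ConstantTermsVanish (m : ℤ) (g : ℍ → ℂ) : Prop :=
  ∀ (γ : SL(2, ℤ)) (w : ℕ) (b : ℤ → ℂ), HasFourierExpansion m g γ 0 w b → b 0 = 0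

/-- `r = γ(i∞)` for a rational number `r`, i.e. `c ≠ 0` and `r = a / c`. -/
def MapsInftyTo (γ : SL(2, ℤ)) (r : ℚ) : Prop :=
  γ 1 0 ≠ 0 ∧ r = ((γ 0 0 : ℤ) : ℚ) / ((γ 1 0 : ℤ) : ℚ)

/-- The incomplete gamma function `Γ(s, x)` for real `x ≠ 0`, an entire function of `s`.
It is `∫ e^{-ξ} ξ^{s-1} dξ` over a path from `x` to `+∞`. For `x > 0` the path is real. For `x < 0`
it is the upper half of the circle `|ξ| = |x|`, traversed from `x` to `|x|`, followed by the
ray from `|x|`; for `Re s > 0` this is the integral along the real line, with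
`t^{s-1} = |t|^{s-1} e^{π i (s-1)}` for `t < 0`, and in general its analytic continuation in `s`. -/
def incGamma (s : ℂ) (x : ℝ) : ℂ :=
  (∫ t in Ioi |x|, cexp (-(t : ℂ)) * (t : ℂ) ^ (s - 1)) -
    if x < 0 then
      ∫ θ in (0 : ℝ)..Real.pi,
        cexp (-(((|x| : ℝ) : ℂ) * cexp (θ * I))) * (((|x| : ℝ) : ℂ) * cexp (θ * I)) ^ (s - 1) *
          (I * (((|x| : ℝ) : ℂ) * cexp (θ * I)))
    else 0

/-- The data entering the formula for `L^reg_r(g,s)`: a matrix `γ` with `γ(i∞) = r`, the Fourier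
coefficients `b(n)` of `g` at `i∞`, and a Fourier expansion of `(cz+d)^{-k} g(γz)`. -/
structure LData (m : ℤ) (g : ℍ → ℂ) (r : ℚ) where
  γ : SL(2, ℤ)
  maps : MapsInftyTo γ r
  b : ℤ → ℂ
  expansion_infty : HasFourierExpansion m g 1 0 1 b
  κ : ℝ
  w : ℕ
  bγ : ℤ → ℂ
  expansion_cusp : HasFourierExpansion m g γ κ w bγ

namespace LData

variable {m : ℤ} {g : ℍ → ℂ} {r : ℚ}

/-- `b(n) e^{2πinr} n^{-s} Γ(s, 2πn)`, for `n ≠ 0`. -/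
def term₁ (D : LData m g r) (s : ℂ) (n : ℤ) : ℂ :=
  if n = 0 then 0 else
    D.b n * cexp (2 * Real.pi * I * (n : ℂ) * (r : ℂ)) / (n : ℂ) ^ s *
      incGamma s (2 * Real.pi * (n : ℝ))

/-- `b_γ(n) e^{2πi(n+κ)(-d/c)/w} ((n+κ)/w)^{-(k-s)} Γ(k-s, 2π(n+κ)/(c²w))`, for `n + κ ≠ 0`. -/
def term₂ (D : LData m g r) (s : ℂ) (n : ℤ) : ℂ :=
  if (n : ℝ) + D.κ = 0 then 0 else
    D.bγ n * cexp (2 * Real.pi * I * ((n : ℂ) + (D.κ : ℂ)) *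
        (-((D.γ 1 1 : ℤ) : ℂ) / ((D.γ 1 0 : ℤ) : ℂ)) / (D.w : ℂ)) /
      (((n : ℂ) + (D.κ : ℂ)) / (D.w : ℂ)) ^ (wt m - s) *
      incGamma (wt m - s)
        (2 * Real.pi * ((n : ℝ) + D.κ) / (((D.γ 1 0 : ℤ) : ℝ) ^ 2 * (D.w : ℝ)))

/-- The right-hand side of the formula defining `L^reg_r(g,s)`, for given data. -/
def value (D : LData m g r) (s : ℂ) : ℂ :=
  1 / Gamma s * ∑' n : ℤ, D.term₁ s n
    + I ^ wt m / (((D.γ 1 0 : ℤ) : ℂ) ^ wt m * Gamma s) * (2 * Real.pi : ℂ) ^ (2 * s - wt m) *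
        (((D.γ 1 0 : ℤ) : ℂ) ^ 2) ^ (wt m - s) * ∑' n : ℤ, D.term₂ s n
    - (2 * Real.pi : ℂ) ^ s * D.b 0 / (s * Gamma s)
    - (if D.κ = 0 then
        I ^ wt m * (2 * Real.pi : ℂ) ^ s * D.bγ 0 /
          (((D.γ 1 0 : ℤ) : ℂ) ^ wt m * (wt m - s) * Gamma s)
      else 0)

end LData

open Classical in
/-- The regularized twisted `L`-function `L^reg_r(g,s)`, computed from some choice of the data. -/
def regL (m : ℤ) (g : ℍ → ℂ) (r : ℚ) (s : ℂ) : ℂ :=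
  if h : Nonempty (LData m g r) then (Classical.choice h).value s else 0

/-- The point `z + i t` (for `t > 0`). -/
def vert (z : ℍ) (t : ℝ) : ℍ := ofComplex ((z : ℂ) + (t : ℂ) * I)

/-- The integrand of `∫_z^{i∞} f(τ) e^{2πiβτ} dτ`, along the vertical half-line `τ = z + i t`. -/
def betaIntegrand (f : ℍ → ℂ) (z : ℍ) (β : ℂ) (t : ℝ) : ℂ :=
  f (vert z t) * cexp (2 * Real.pi * I * β * (vert z t : ℂ)) * I

/-- `v = [∫_z^{i∞} f(τ) e^{2πiβτ} dτ]_{β=0}`: the integral converges absolutely for `Re β ≫ 0`, it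
continues analytically to `Im β > 0`, and the continuation tends to `v` as `β → 0`. (The
continuation can have branch points at real `β`; coming from `Im β > 0` is the choice that
corresponds to principal powers of negative reals.) -/
def IsBetaValue (f : ℍ → ℂ) (z : ℍ) (v : ℂ) : Prop :=
  ∃ B : ℝ, (∀ β : ℂ, B < β.re → IntegrableOn (betaIntegrand f z β) (Ioi 0)) ∧
    ∃ F : ℂ → ℂ, DifferentiableOn ℂ F {β | 0 < β.im} ∧
      (∀ β : ℂ, 0 < β.im → B < β.re → F β = ∫ t in Ioi (0 : ℝ), betaIntegrand f z β t) ∧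
      Tendsto F (𝓝[{β | 0 < β.im}] 0) (𝓝 v)

/-- `v = [[∫_z^{i∞} f_α(τ) e^{2πiβτ} dτ]_{β=0}]_{α=0}`: the value at `β = 0` exists for `Re α ≪ 0`,
and as a function of `α` it has a meromorphic continuation which is analytic at `α = 0` with
value `v`. -/
def IsAlphaBetaValue (f : ℂ → ℍ → ℂ) (z : ℍ) (v : ℂ) : Prop :=
  ∃ (A : ℝ) (J : ℂ → ℂ), (∀ α : ℂ, α.re < A → IsBetaValue (f α) z (J α)) ∧
    MeromorphicOn J univ ∧ AnalyticAt ℂ J 0 ∧ J 0 = v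

/-- `v = ∫^reg_{[z₁,i∞]} g(τ) (τ - z̄₂)^s dτ`. -/
def IsRegIntegralToInfty (g : ℍ → ℂ) (z₁ : ℍ) (z₂ s v : ℂ) : Prop :=
  IsAlphaBetaValue (fun α τ => g τ * ((τ : ℂ) - starRingEnd ℂ z₂) ^ (s + α)) z₁ v

/-- `v = ∫^reg_{[z₁,r]} g(τ) (τ - z̄₂)^s dτ` for the cusp `r = γ(i∞)`. -/
def IsRegIntegralToCusp (g : ℍ → ℂ) (γ : SL(2, ℤ)) (z₁ : ℍ) (z₂ s v : ℂ) : Prop :=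
  IsAlphaBetaValue
    (fun α τ => cd γ τ ^ (-2 + α) * g (γ • τ) *
      (((γ • τ : ℍ) : ℂ) - starRingEnd ℂ z₂) ^ (s + α)) (γ⁻¹ • z₁) v

/-- `v = ∫^reg_{[r,i∞]} g(τ) (τ - z̄₂)^s dτ` for the cusp `r = γ(i∞)`: for every `z₁` in the upper
half-plane, `v = -∫^reg_{[z₁,r]} + ∫^reg_{[z₁,i∞]}`. -/
def IsRegIntegral (g : ℍ → ℂ) (γ : SL(2, ℤ)) (z₂ s v : ℂ) : Prop :=
  ∀ z₁ : ℍ, ∃ v₁ v₂ : ℂ, IsRegIntegralToCusp g γ z₁ z₂ s v₁ ∧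
    IsRegIntegralToInfty g z₁ z₂ s v₂ ∧ v = -v₁ + v₂

/-- The integral `∫^reg_{[r,i∞]} g(τ) (τ - r)^{s-1} dτ`, `r = γ(i∞)`, is well defined, and
`(1/Γ(s)) (2π/i)^s ∫^reg_{[r,i∞]} g(τ) (τ - r)^{s-1} dτ = L`. -/
def IntegralRepresentation (g : ℍ → ℂ) (γ : SL(2, ℤ)) (r : ℚ) (s L : ℂ) : Prop :=
  (∃! v : ℂ, IsRegIntegral g γ (r : ℂ) (s - 1) v) ∧
    ∀ v : ℂ, IsRegIntegral g γ (r : ℂ) (s - 1) v →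
      1 / Gamma s * (2 * Real.pi / I : ℂ) ^ s * v = L

end RegL

end

noncomputable section

namespace RegL

/-! Write k = `wt m`. A vertical integral of H(τ) τ^{p-1} e^{2πiβτ} converges only for Re β large,
because H may grow exponentially upwards. For Im β > 0 it can be rotated to the horizontal ray from
the same base point. There every Fourier term, having a real frequency, keeps constant modulus,
while e^{2πiβτ} decays. So the horizontal integral `betaIntegral` is the required continuation in β
(`QExp.exists_vertical`, `QExp.differentiableOn_betaIntegral`), and it may be computed term by term
(`QExp.hasSum_betaIntegral`).

As β → 0, the term of frequency ν ≠ 0 tends to an incomplete gamma value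
(`tendsto_horizontalIntegral`). For ν < 0 the point ν + β reaches the negative axis from above, with
argument π, and this produces the upper semicircle in `incGamma`. The constant term contributes
-(iT)^p/p, a limit which is available when Re p < 0. Dominated convergence gives the sum `regValue`
(`QExp.tendsto_betaIntegral_base`). Its only possible pole in p comes from that quotient by p, so
analyticity and the effect of vanishing constant terms can be read off.

For Re p < 0, `regValue` is also an absolutely convergent integral of H
(`QExp.regValue_eq_integral`), so it depends on H alone and not on the chosen expansion. Since p ·
`regValue` agrees off p = 0 with an entire function, identities valid for Re p < 0 extend:
proportional functions have proportional values (`QExp.regValue_scaling`), and the base point can be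
moved (`QExp.regValue_shift`).

The substitution τ ↦ -1/(c²τ) exchanges the cusps r and i∞ and turns the exponent s into k - s
(`shiftFun_inversion`). Hence the integral from r to i∞ is a difference of two values of `regValue`,
at s and at k - s (`isRegIntegral`), and its normalization is the defining formula for L
(`LData.value_eq`). Different data at r give proportional functions, so the value is independent of
them. For γ in Γ₀(4N), the function at the cusp r is the multiplier times g near γ⁻¹(i∞). The two
values then change places, which is the functional equation (`LData.integralValue_inv`). -/

/-! ### Primitives and contour changes in the upper half-plane -/

/-- The upper half-plane as a subset of `ℂ`. -/
def upper : Set ℂ := {z | 0 < z.im}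

lemma isOpen_upper : IsOpen upper := isOpen_lt continuous_const continuous_im

lemma convex_upper : Convex ℝ upper := convex_halfSpace_im_gt 0

lemma ne_zero_of_upper {z : ℂ} (hz : z ∈ upper) : z ≠ 0 := by
  rintro rfl
  simp [upper] at hz

lemma slitPlane_of_upper {z : ℂ} (hz : z ∈ upper) : z ∈ slitPlane :=
  Or.inr (ne_of_gt hz)

lemma exists_primitive {f : ℂ → ℂ} (hf : DifferentiableOn ℂ f upper) :
    ∃ P : ℂ → ℂ, ∀ z ∈ upper, HasDerivAt P (f z) z := by
  obtain ⟨P, hP⟩ := convex_upper.exists_forall_hasDerivWithinAt hf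
  exact ⟨P, fun z hz => (hP z hz).hasDerivAt (isOpen_upper.mem_nhds hz)⟩

/-- The integral of `f` along the straight segment from `z` to `w`. -/
def seg (f : ℂ → ℂ) (z w : ℂ) : ℂ := ∫ t in (0 : ℝ)..1, f (z + t * (w - z)) * (w - z)

lemma segment_mem_upper {z w : ℂ} (hz : z ∈ upper) (hw : w ∈ upper) {t : ℝ}
    (ht : t ∈ Icc (0 : ℝ) 1) : z + t * (w - z) ∈ upper := by
  have := convex_upper.add_smul_sub_mem hz hw ht
  simpa using this

lemma integral_line_eq_sub {f P : ℂ → ℂ} (hf : ContinuousOn f upper)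
    (hP : ∀ z ∈ upper, HasDerivAt P (f z) z) {z ω : ℂ} {R : ℝ} (hR : 0 ≤ R)
    (h : ∀ t ∈ Icc (0 : ℝ) R, z + t * ω ∈ upper) :
    ∫ t in (0 : ℝ)..R, f (z + t * ω) * ω = P (z + R * ω) - P z := by
  have hu : uIcc (0 : ℝ) R = Icc 0 R := uIcc_of_le hR
  have := intervalIntegral.integral_eq_sub_of_hasDerivAt
    (f := fun t : ℝ => P (z + t * ω)) (f' := fun t : ℝ => f (z + t * ω) * ω) (a := 0) (b := R) ?_ ?_
  · simpa using this
  · intro t ht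
    rw [hu] at ht
    have h1 : HasDerivAt (fun t : ℝ => z + (t : ℂ) * ω) ω t := by
      simpa using ((hasDerivAt_id t).ofReal_comp.mul_const ω).const_add z
    exact (hP _ (h t ht)).comp_of_eq t h1 rfl
  · apply ContinuousOn.intervalIntegrable
    rw [hu]
    exact (hf.comp (by fun_prop) h).mul continuousOn_const

lemma seg_eq_sub {f P : ℂ → ℂ} (hf : ContinuousOn f upper)
    (hP : ∀ z ∈ upper, HasDerivAt P (f z) z) {z w : ℂ} (hz : z ∈ upper) (hw : w ∈ upper) :
    seg f z w = P w - P z := by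
  have := integral_line_eq_sub (ω := w - z) hf hP zero_le_one
    (fun t ht => segment_mem_upper hz hw ht)
  simpa [seg] using this

/-- Expressing ray integrals through one primitive reduces a change of contour to comparing the
limits of that primitive along two rays. -/
lemma primitive_tendsto_ray {f P : ℂ → ℂ} (hf : ContinuousOn f upper)
    (hP : ∀ z ∈ upper, HasDerivAt P (f z) z) {z ω : ℂ}
    (h : ∀ t : ℝ, 0 ≤ t → z + t * ω ∈ upper)
    (hi : IntegrableOn (fun t : ℝ => f (z + t * ω) * ω) (Ioi 0)) :
    Tendsto (fun R : ℝ => P (z + R * ω)) atTop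
      (𝓝 ((∫ t in Ioi (0 : ℝ), f (z + t * ω) * ω) + P z)) := by
  have h1 := intervalIntegral_tendsto_integral_Ioi 0 hi tendsto_id
  refine (h1.add_const (P z)).congr' ?_
  filter_upwards [eventually_ge_atTop 0] with R hR
  simp only [id]
  rw [integral_line_eq_sub hf hP hR fun t ht => h t ht.1]
  ring

/-- This is the vanishing of the closing side of the contour, by the mean value inequality on the
segment from `u R` to `v R`. -/
lemma primitive_sub_tendsto_zero {f P : ℂ → ℂ}
    (hP : ∀ z ∈ upper, HasDerivAt P (f z) z) {u v : ℝ → ℂ} {B : ℝ → ℝ}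
    (hu : ∀ᶠ R in atTop, u R ∈ upper) (hv : ∀ᶠ R in atTop, v R ∈ upper)
    (hB : ∀ᶠ R in atTop, ∀ τ ∈ segment ℝ (u R) (v R), ‖f τ‖ ≤ B R)
    (hlim : Tendsto (fun R => B R * ‖v R - u R‖) atTop (𝓝 0)) :
    Tendsto (fun R => P (v R) - P (u R)) atTop (𝓝 0) := by
  refine squeeze_zero_norm' ?_ hlim
  filter_upwards [hu, hv, hB] with R h1 h2 h3
  refine (convex_segment (u R) (v R)).norm_image_sub_le_of_norm_hasDerivWithin_le (f' := f)
    (fun x hx => (hP x (convex_upper.segment_subset h1 h2 hx)).hasDerivWithinAt) h3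
    (left_mem_segment ..) (right_mem_segment ..)

/-- Moving the base point of an integral over horizontal rays. -/
lemma integral_horizontal_sub {f : ℂ → ℂ} (hf : DifferentiableOn ℂ f upper) {z w : ℂ}
    (hz : z ∈ upper) (hw : w ∈ upper)
    (hiz : IntegrableOn (fun t : ℝ => f (z + t)) (Ioi 0))
    (hiw : IntegrableOn (fun t : ℝ => f (w + t)) (Ioi 0)) {B : ℝ → ℝ}
    (hlim : Tendsto B atTop (𝓝 0))
    (hB : ∀ᶠ R : ℝ in atTop, ∀ τ ∈ segment ℝ z w, ‖f (τ + R)‖ ≤ B R) :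
    (∫ t in Ioi (0 : ℝ), f (z + t)) = seg f z w + ∫ t in Ioi (0 : ℝ), f (w + t) := by
  obtain ⟨P, hP⟩ := exists_primitive hf
  have hmem : ∀ {z : ℂ} (_ : z ∈ upper) (t : ℝ), z + t ∈ upper := by
    intro z hz t
    simpa [upper] using hz
  have h1 := primitive_tendsto_ray (ω := 1) hf.continuousOn hP
    (fun t _ => by simpa using hmem hz t) (by simpa using hiz)
  have h2 := primitive_tendsto_ray (ω := 1) hf.continuousOn hP
    (fun t _ => by simpa using hmem hw t) (by simpa using hiw)
  simp only [mul_one] at h1 h2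
  have h3 := primitive_sub_tendsto_zero (u := fun R : ℝ => z + R) (v := fun R : ℝ => w + R)
    (B := B) hP (Eventually.of_forall fun R => hmem hz R) (Eventually.of_forall fun R => hmem hw R)
    ?_ (by simpa using hlim.mul_const ‖w - z‖)
  · have h4 := tendsto_nhds_unique (h2.sub h1) h3
    rw [seg_eq_sub hf.continuousOn hP hz hw]
    linear_combination -h4
  · filter_upwards [hB] with R hR τ hτ
    have : τ - R ∈ segment ℝ z w := by
      obtain ⟨a, b, ha, hb, hab, h⟩ := hτ
      refine ⟨a, b, ha, hb, hab, ?_⟩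
      have hc : (a : ℂ) + b = 1 := by exact_mod_cast hab
      simp only [real_smul] at h ⊢
      linear_combination h - (R : ℂ) * hc
    simpa using hR _ this

lemma tendsto_mul_exp_neg {a : ℝ} (ha : 0 < a) (C : ℝ) :
    Tendsto (fun R : ℝ => C * R * Real.exp (-a * R)) atTop (𝓝 0) := by
  have := (Real.tendsto_pow_mul_exp_neg_atTop_nhds_zero 1).comp
    (tendsto_id.const_mul_atTop ha)
  have := this.const_mul (C / a)
  simp only [Function.comp_def, id, pow_one, mul_zero] at this
  refine this.congr fun R => ?_
  field_simp

/-- Rotating a horizontal ray to a vertical one. -/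
lemma integral_horizontal_eq_vertical {f : ℂ → ℂ} (hf : DifferentiableOn ℂ f upper) {z : ℂ}
    (hz : z ∈ upper) {C a : ℝ} (ha : 0 < a)
    (hiz : IntegrableOn (fun t : ℝ => f (z + t)) (Ioi 0))
    (hiv : IntegrableOn (fun t : ℝ => f (z + t * I) * I) (Ioi 0))
    (hB : ∀ x y : ℝ, 0 ≤ x → 0 ≤ y → ‖f (z + x + y * I)‖ ≤ C * Real.exp (-a * (x + y))) :
    (∫ t in Ioi (0 : ℝ), f (z + t)) = ∫ t in Ioi (0 : ℝ), f (z + t * I) * I := by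
  obtain ⟨P, hP⟩ := exists_primitive hf
  have hmem : ∀ (t : ℝ), z + t ∈ upper := by
    intro t
    simpa [upper] using hz
  have hmem' : ∀ (t : ℝ), 0 ≤ t → z + t * I ∈ upper := by
    intro t ht
    simp only [upper, mem_ofPred_eq] at hz ⊢
    simp
    linarith
  have h1 := primitive_tendsto_ray (ω := 1) hf.continuousOn hP
    (fun t _ => by simpa using hmem t) (by simpa using hiz)
  have h2 := primitive_tendsto_ray hf.continuousOn hP hmem' hiv
  simp only [mul_one] at h1
  have h3 := primitive_sub_tendsto_zero (u := fun R : ℝ => z + R) (v := fun R : ℝ => z + R * I)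
    (B := fun R => C * Real.exp (-a * R)) hP (Eventually.of_forall fun R => hmem R)
    ((eventually_ge_atTop 0).mono fun R => hmem' R) ?_ ?_
  · have h4 := tendsto_nhds_unique (h2.sub h1) h3
    linear_combination -h4
  -- The closing segment from z + R to z + iR is the locus x + y = R in the quadrant, so the bound
  -- is uniformly C e^{-aR} on it.
  · filter_upwards [eventually_ge_atTop 0] with R hR τ hτ
    obtain ⟨p, q, hp, hq, hpq, h⟩ := hτ
    have hc : (p : ℂ) + q = 1 := by exact_mod_cast hpq
    have := hB (p * R) (q * R) (by positivity) (by positivity)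
    have h5 : z + (p * R : ℝ) + (q * R : ℝ) * I = τ := by
      rw [← h]
      simp only [real_smul, ofReal_mul]
      linear_combination -(z : ℂ) * hc
    rw [h5, ← add_mul, hpq, one_mul] at this
    exact this
  · have := tendsto_mul_exp_neg ha (C * ‖I - 1‖)
    refine this.congr' ?_
    filter_upwards [eventually_ge_atTop 0] with R hR
    have : z + R * I - (z + R) = R * (I - 1) := by ring
    rw [this, norm_mul, norm_real, Real.norm_of_nonneg hR]
    ring

/-! ### Growth of complex powers and Laplace transforms -/

lemma norm_cpow_le_mul_exp (z q : ℂ) :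
    ‖z ^ q‖ ≤ ‖z‖ ^ q.re * Real.exp (Real.pi * |q.im|) := by
  refine (norm_cpow_le z q).trans ?_
  rw [div_eq_mul_inv, ← Real.exp_neg]
  gcongr
  have h1 : |arg z| ≤ Real.pi := abs_arg_le_pi z
  calc -(arg z * q.im) ≤ |arg z * q.im| := neg_le_abs _
    _ = |arg z| * |q.im| := abs_mul _ _
    _ ≤ _ := by gcongr

/-- The exponential wins for large t, and compactness handles the rest. The lower limit y₀ > 0 is
needed because σ may be negative. -/
lemma exists_rpow_le_exp (σ : ℝ) {y₀ ε : ℝ} (hy₀ : 0 < y₀) (hε : 0 < ε) :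
    ∃ C : ℝ, 0 < C ∧ ∀ t : ℝ, y₀ ≤ t → t ^ σ ≤ C * Real.exp (ε * t) := by
  have h1 : (fun t : ℝ => t ^ σ) =o[atTop] fun t => Real.exp (ε * t) :=
    isLittleO_rpow_exp_pos_mul_atTop σ hε
  obtain ⟨M, hM⟩ := (eventually_atTop.1 (h1.bound one_pos))
  have hc : ContinuousOn (fun t : ℝ => t ^ σ) (Icc y₀ (max M y₀)) := by
    intro t ht
    exact (Real.continuousAt_rpow_const t σ (Or.inl (by linarith [ht.1]))).continuousWithinAt
  obtain ⟨K, hK⟩ := isCompact_Icc.exists_bound_of_continuousOn hc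
  refine ⟨max K 1, by positivity, fun t ht => ?_⟩
  have ht0 : 0 < t := by linarith
  rcases le_total M t with h | h
  · have := hM t h
    rw [Real.norm_of_nonneg (by positivity), Real.norm_of_nonneg (by positivity), one_mul] at this
    refine this.trans ?_
    exact le_mul_of_one_le_left (by positivity) (le_max_right _ _)
  · have := hK t ⟨ht, h.trans (le_max_left _ _)⟩
    rw [Real.norm_of_nonneg (by positivity)] at this
    calc t ^ σ ≤ max K 1 * 1 := by rw [mul_one]; exact this.trans (le_max_left _ _)
      _ ≤ _ := by
        gcongr
        exact Real.one_le_exp (by positivity)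

lemma exists_cpow_growth (q : ℂ) {y₀ ε : ℝ} (hy₀ : 0 < y₀) (hε : 0 < ε) :
    ∃ C : ℝ, 0 < C ∧ ∀ z : ℂ, y₀ ≤ z.im → ‖z ^ q‖ ≤ C * Real.exp (ε * ‖z‖) := by
  obtain ⟨C, hC, h⟩ := exists_rpow_le_exp q.re hy₀ hε
  refine ⟨C * Real.exp (Real.pi * |q.im|), by positivity, fun z hz => ?_⟩
  refine (norm_cpow_le_mul_exp _ q).trans ?_
  have := h ‖z‖ (hz.trans ((le_abs_self _).trans (abs_im_le_norm z)))
  calc _ ≤ C * Real.exp (ε * ‖z‖) * Real.exp (Real.pi * |q.im|) := by gcongr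
    _ = _ := by ring

/-- Functions on `[0, ∞)` that are continuous and of subexponential growth. -/
structure SubExp (φ : ℝ → ℂ) : Prop where
  cont : ContinuousOn φ (Ici 0)
  bound : ∀ ε : ℝ, 0 < ε → ∃ C : ℝ, ∀ x : ℝ, 0 ≤ x → ‖φ x‖ ≤ C * Real.exp (ε * x)

lemma integrableOn_of_exp_bound {f : ℝ → ℂ} (hf : ContinuousOn f (Ici 0)) {C a : ℝ} (ha : 0 < a)
    (h : ∀ x : ℝ, 0 ≤ x → ‖f x‖ ≤ C * Real.exp (-a * x)) : IntegrableOn f (Ioi 0) := by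
  refine Integrable.mono' ((exp_neg_integrableOn_Ioi 0 ha).const_mul C)
    ((hf.mono Ioi_subset_Ici_self).aestronglyMeasurable measurableSet_Ioi) ?_
  filter_upwards [ae_restrict_mem measurableSet_Ioi] with x hx
  exact h x hx.le

lemma SubExp.mul_id {φ : ℝ → ℂ} (h : SubExp φ) : SubExp fun x => x * φ x := by
  refine ⟨(continuous_ofReal.continuousOn).mul h.cont, fun ε hε => ?_⟩
  obtain ⟨C, hC⟩ := h.bound (ε / 2) (by positivity)
  refine ⟨(2 / ε) * C, fun x hx => ?_⟩
  have h1 : x ≤ 2 / ε * Real.exp (ε / 2 * x) := by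
    have := Real.add_one_le_exp (ε / 2 * x)
    have h2 : x = 2 / ε * (ε / 2 * x) := by field_simp
    rw [h2]
    gcongr
    rw [← h2]
    linarith
  have hn := (norm_nonneg _).trans (hC x hx)
  rw [norm_mul, norm_real, Real.norm_of_nonneg hx]
  calc x * ‖φ x‖ ≤ (2 / ε * Real.exp (ε / 2 * x)) * (C * Real.exp (ε / 2 * x)) := by
        gcongr
        exact hC x hx
    _ = 2 / ε * C * (Real.exp (ε / 2 * x) * Real.exp (ε / 2 * x)) := by ring
    _ = _ := by rw [← Real.exp_add]; ring_nf

lemma SubExp.norm_mul_exp_le {φ : ℝ → ℂ} (h : SubExp φ) {δ : ℝ} (hδ : 0 < δ) :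
    ∃ C : ℝ, 0 ≤ C ∧ ∀ μ : ℂ, δ ≤ μ.re → ∀ x : ℝ, 0 ≤ x →
      ‖φ x * cexp (-μ * x)‖ ≤ C * Real.exp (-(δ / 2) * x) := by
  obtain ⟨C, hC⟩ := h.bound (δ / 2) (by positivity)
  refine ⟨C, by simpa using (norm_nonneg _).trans (hC 0 le_rfl), fun μ hμ x hx => ?_⟩
  rw [norm_mul, norm_exp]
  have hre : (-μ * x).re = -(μ.re * x) := by simp
  have hn := (norm_nonneg _).trans (hC x hx)
  rw [hre]
  calc _ ≤ (C * Real.exp (δ / 2 * x)) * Real.exp (-(δ * x)) := by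
        gcongr
        exact hC x hx
    _ = _ := by rw [mul_assoc, ← Real.exp_add]; ring_nf

lemma SubExp.continuousOn_mul_exp {φ : ℝ → ℂ} (h : SubExp φ) (μ : ℂ) :
    ContinuousOn (fun x : ℝ => φ x * cexp (-μ * x)) (Ici 0) :=
  h.cont.mul (by fun_prop)

lemma SubExp.integrableOn {φ : ℝ → ℂ} (h : SubExp φ) {μ : ℂ} (hμ : 0 < μ.re) :
    IntegrableOn (fun x : ℝ => φ x * cexp (-μ * x)) (Ioi 0) := by
  obtain ⟨C, _, hC⟩ := h.norm_mul_exp_le hμ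
  exact integrableOn_of_exp_bound (h.continuousOn_mul_exp μ) (half_pos hμ) (hC μ le_rfl)

/-- The Laplace transform of a function of subexponential growth is holomorphic. -/
lemma SubExp.hasDerivAt_laplace {φ : ℝ → ℂ} (h : SubExp φ) {μ : ℂ} (hμ : 0 < μ.re) :
    HasDerivAt (fun μ : ℂ => ∫ x in Ioi (0 : ℝ), φ x * cexp (-μ * x))
      (∫ x in Ioi (0 : ℝ), -(x * φ x * cexp (-μ * x))) μ := by
  -- One halving of Re μ leaves room for a neighbourhood of μ; the other pays for the subexponential
  -- factor.
  obtain ⟨C, _, hC⟩ := h.mul_id.norm_mul_exp_le (half_pos hμ)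
  have hs : {ν : ℂ | μ.re / 2 < ν.re} ∈ 𝓝 μ :=
    (isOpen_lt continuous_const Complex.continuous_re).mem_nhds (by simp; linarith)
  refine (hasDerivAt_integral_of_dominated_loc_of_deriv_le
    (μ := volume.restrict (Ioi (0 : ℝ)))
    (F := fun (μ : ℂ) (x : ℝ) => φ x * cexp (-μ * x))
    (F' := fun (μ : ℂ) (x : ℝ) => -(x * φ x * cexp (-μ * x)))
    (bound := fun x => C * Real.exp (-(μ.re / 2 / 2) * x)) hs ?_ ?_ ?_ ?_ ?_ ?_).2
  · filter_upwards with ν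
    exact ((h.continuousOn_mul_exp ν).mono Ioi_subset_Ici_self).aestronglyMeasurable
      measurableSet_Ioi
  · exact h.integrableOn hμ
  · exact ((h.mul_id.continuousOn_mul_exp μ).mono Ioi_subset_Ici_self).neg.aestronglyMeasurable
      measurableSet_Ioi
  · filter_upwards [ae_restrict_mem measurableSet_Ioi] with x hx ν hν
    rw [norm_neg]
    exact hC ν (le_of_lt hν) x (le_of_lt hx)
  · exact (exp_neg_integrableOn_Ioi 0 (by positivity)).const_mul C
  · filter_upwards with x ν _
    have h1 : HasDerivAt (fun ν : ℂ => -ν * x) (-x) ν := by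
      simpa using (hasDerivAt_id ν).neg.mul_const (x : ℂ)
    have h2 := h1.cexp.const_mul (φ x)
    have h3 : φ x * (cexp (-ν * x) * -(x : ℂ)) = -(x * φ x * cexp (-ν * x)) := by ring
    rwa [h3] at h2

lemma add_ofReal_mem_upper {z : ℂ} (hz : z ∈ upper) (t : ℝ) : z + t ∈ upper := by
  simpa [upper] using hz

lemma add_ofReal_mul_I_mem_upper {z : ℂ} (hz : z ∈ upper) {t : ℝ} (ht : 0 ≤ t) :
    z + t * I ∈ upper := by
  have : 0 < z.im := hz
  simp only [upper, mem_ofPred_eq]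
  simp
  linarith

lemma mul_I_mem_upper {T : ℝ} (hT : 0 < T) : I * (T : ℂ) ∈ upper := by
  simpa [upper] using hT

lemma subExp_cpow {z ω q : ℂ} (hz : z ∈ upper) (hω : ‖ω‖ = 1) (hω' : 0 ≤ ω.im) :
    SubExp fun x : ℝ => (z + x * ω) ^ q := by
  have him : ∀ x : ℝ, 0 ≤ x → z.im ≤ (z + x * ω).im := by
    intro x hx
    have : (z + x * ω).im = z.im + x * ω.im := by simp
    rw [this]
    nlinarith
  have hz' : 0 < z.im := hz
  refine ⟨?_, fun ε hε => ?_⟩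
  · intro x hx
    have : ContinuousAt (fun x : ℝ => z + x * ω) x := by fun_prop
    exact (ContinuousAt.comp (f := fun x : ℝ => z + x * ω) (continuousAt_cpow_const
      (slitPlane_of_upper (hz'.trans_le (him x hx)))) this).continuousWithinAt
  · obtain ⟨C, hC, h⟩ := exists_cpow_growth q hz' hε
    refine ⟨C * Real.exp (ε * ‖z‖), fun x hx => (h _ (him x hx)).trans ?_⟩
    rw [mul_assoc, ← Real.exp_add]
    gcongr
    have := norm_add_le z (x * ω)
    rw [norm_mul, hω, norm_real, Real.norm_of_nonneg hx] at this
    nlinarith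

lemma subExp_cpow_horizontal {z : ℂ} (hz : z ∈ upper) (q : ℂ) :
    SubExp fun x : ℝ => (z + x) ^ q := by
  simpa using subExp_cpow (ω := 1) (q := q) hz (by simp) (by simp)

lemma subExp_cpow_vertical {z : ℂ} (hz : z ∈ upper) (q : ℂ) :
    SubExp fun x : ℝ => (z + x * I) ^ q :=
  subExp_cpow hz (by simp) (by simp)

/-! ### The basic exponential integrals over horizontal and vertical rays -/

/-- The integral of `e^{2πiμτ} τ^{p-1}` over the horizontal ray from `z`. -/
def horizontalIntegral (z p μ : ℂ) : ℂ :=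
  ∫ x in Ioi (0 : ℝ), cexp (2 * Real.pi * I * μ * (z + x)) * (z + x) ^ (p - 1)

/-- The integral of `e^{2πiμτ} τ^{p-1}` over the vertical ray from `z`. -/
def verticalIntegral (z p μ : ℂ) : ℂ :=
  ∫ x in Ioi (0 : ℝ), cexp (2 * Real.pi * I * μ * (z + x * I)) * (z + x * I) ^ (p - 1) * I

lemma re_neg_two_pi_I_mul (μ : ℂ) : (-(2 * Real.pi * I * μ)).re = 2 * Real.pi * μ.im := by
  simp

lemma horizontalIntegrand_eq (z p μ : ℂ) (x : ℝ) :
    cexp (2 * Real.pi * I * μ * (z + x)) * (z + x) ^ (p - 1) =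
      cexp (2 * Real.pi * I * μ * z) *
        ((z + x) ^ (p - 1) * cexp (-(-(2 * Real.pi * I * μ)) * x)) := by
  rw [mul_add, Complex.exp_add]
  ring_nf

lemma verticalIntegrand_eq (z p μ : ℂ) (x : ℝ) :
    cexp (2 * Real.pi * I * μ * (z + x * I)) * (z + x * I) ^ (p - 1) * I =
      I * cexp (2 * Real.pi * I * μ * z) *
        ((z + x * I) ^ (p - 1) * cexp (-(2 * Real.pi * μ) * x)) := by
  have : 2 * Real.pi * I * μ * (z + x * I) =
      2 * Real.pi * I * μ * z + -(2 * Real.pi * μ) * x := by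
    linear_combination 2 * Real.pi * μ * x * I_sq
  rw [this, Complex.exp_add]
  ring

lemma integrableOn_horizontal {z μ : ℂ} (hz : z ∈ upper) (p : ℂ) (hμ : μ ∈ upper) :
    IntegrableOn (fun x : ℝ => cexp (2 * Real.pi * I * μ * (z + x)) * (z + x) ^ (p - 1))
      (Ioi 0) := by
  simp_rw [horizontalIntegrand_eq]
  have : 0 < μ.im := hμ
  exact ((subExp_cpow_horizontal hz _).integrableOn
    (by rw [re_neg_two_pi_I_mul]; positivity)).const_mul _

lemma integrableOn_vertical {z μ : ℂ} (hz : z ∈ upper) (p : ℂ) (hμ : 0 < μ.re) :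
    IntegrableOn (fun x : ℝ => cexp (2 * Real.pi * I * μ * (z + x * I)) *
      (z + x * I) ^ (p - 1) * I) (Ioi 0) := by
  simp_rw [verticalIntegrand_eq]
  refine ((subExp_cpow_vertical hz _).integrableOn ?_).const_mul _
  have : (2 * Real.pi * μ).re = 2 * Real.pi * μ.re := by simp
  rw [this]
  positivity

lemma verticalIntegral_eq (z p μ : ℂ) :
    verticalIntegral z p μ = I * cexp (2 * Real.pi * I * μ * z) *
      ∫ x in Ioi (0 : ℝ), (z + x * I) ^ (p - 1) * cexp (-(2 * Real.pi * μ) * x) := by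
  simp_rw [verticalIntegral, verticalIntegrand_eq, integral_const_mul]

lemma horizontalIntegral_eq (z p μ : ℂ) :
    horizontalIntegral z p μ = cexp (2 * Real.pi * I * μ * z) *
      ∫ x in Ioi (0 : ℝ), (z + x) ^ (p - 1) * cexp (-(-(2 * Real.pi * I * μ)) * x) := by
  simp_rw [horizontalIntegral, horizontalIntegrand_eq, integral_const_mul]

lemma continuousAt_verticalIntegral {z μ : ℂ} (hz : z ∈ upper) (p : ℂ) (hμ : 0 < μ.re) :
    ContinuousAt (verticalIntegral z p) μ := by
  have h1 : (2 * Real.pi * μ).re = 2 * Real.pi * μ.re := by simp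
  have h2 := ((subExp_cpow_vertical hz (p - 1)).hasDerivAt_laplace
    (μ := 2 * Real.pi * μ) (by rw [h1]; positivity)).continuousAt
  have h3 : ContinuousAt (fun μ : ℂ => 2 * Real.pi * μ) μ := by fun_prop
  have h4 := ContinuousAt.comp (f := fun μ : ℂ => 2 * Real.pi * μ) h2 h3
  have h5 : verticalIntegral z p = fun μ => I * cexp (2 * Real.pi * I * μ * z) *
      ∫ x in Ioi (0 : ℝ), (z + x * I) ^ (p - 1) * cexp (-(2 * Real.pi * μ) * x) :=
    funext (verticalIntegral_eq z p)
  rw [h5]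
  exact ContinuousAt.mul (by fun_prop) h4

/-- Differentiation in μ brings down 2πiτ, which raises the exponent p by one. Together with
integration by parts this yields a first order equation in μ. -/
lemma hasDerivAt_horizontalIntegral {z μ : ℂ} (hz : z ∈ upper) (p : ℂ) (hμ : μ ∈ upper) :
    HasDerivAt (horizontalIntegral z p) (2 * Real.pi * I * horizontalIntegral z (p + 1) μ) μ := by
  have hμ' : 0 < μ.im := hμ
  have hre : 0 < (-(2 * Real.pi * I * μ)).re := by rw [re_neg_two_pi_I_mul]; positivity
  have h2 := (subExp_cpow_horizontal hz (p - 1)).hasDerivAt_laplace hre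
  have h3 : HasDerivAt (fun μ : ℂ => -(2 * Real.pi * I * μ)) (-(2 * Real.pi * I)) μ := by
    simpa using (hasDerivAt_id μ).const_mul (-(2 * Real.pi * I) : ℂ)
  have h4 := HasDerivAt.comp μ h2 h3
  have h6 : HasDerivAt (fun μ : ℂ => cexp (2 * Real.pi * I * μ * z))
      (cexp (2 * Real.pi * I * μ * z) * (2 * Real.pi * I * z)) μ := by
    have : HasDerivAt (fun μ : ℂ => 2 * Real.pi * I * μ * z) (2 * Real.pi * I * z) μ := by
      simpa using ((hasDerivAt_id μ).const_mul (2 * Real.pi * I : ℂ)).mul_const z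
    exact this.cexp
  have h5 : horizontalIntegral z p = fun μ => cexp (2 * Real.pi * I * μ * z) *
      ∫ x in Ioi (0 : ℝ), (z + x) ^ (p - 1) * cexp (-(-(2 * Real.pi * I * μ)) * x) :=
    funext (horizontalIntegral_eq z p)
  rw [h5]
  refine (h6.mul h4).congr_deriv ?_
  rw [horizontalIntegral_eq]
  have h7 : ∫ x in Ioi (0 : ℝ), (z + x) ^ (p + 1 - 1) * cexp (-(-(2 * Real.pi * I * μ)) * x) =
      z * (∫ x in Ioi (0 : ℝ), (z + x) ^ (p - 1) * cexp (-(-(2 * Real.pi * I * μ)) * x)) +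
      ∫ x in Ioi (0 : ℝ), x * (z + x) ^ (p - 1) * cexp (-(-(2 * Real.pi * I * μ)) * x) := by
    rw [← integral_const_mul, ← integral_add
      (((subExp_cpow_horizontal hz (p - 1)).integrableOn hre).const_mul z)
      ((subExp_cpow_horizontal hz (p - 1)).mul_id.integrableOn hre)]
    congr 1 with x
    have h8 : z + x ≠ 0 := ne_zero_of_upper (add_ofReal_mem_upper hz x)
    have : (z + x) ^ (p + 1 - 1) = (z + x) ^ (p - 1) * (z + x) := by
      rw [show p + 1 - 1 = (p - 1) + 1 by ring, cpow_add _ _ h8, cpow_one]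
    rw [this]
    ring
  rw [h7, integral_neg]
  simp only [Function.comp_apply]
  ring

lemma tendsto_zero_of_exp_bound {f : ℝ → ℂ} {C a : ℝ} (ha : 0 < a)
    (h : ∀ x : ℝ, 0 ≤ x → ‖f x‖ ≤ C * Real.exp (-a * x)) : Tendsto f atTop (𝓝 0) := by
  have h1 : Tendsto (fun x : ℝ => C * Real.exp (-a * x)) atTop (𝓝 0) := by
    have : Tendsto (fun x : ℝ => -a * x) atTop atBot :=
      tendsto_id.const_mul_atTop_of_neg (neg_lt_zero.2 ha)
    simpa using (Real.tendsto_exp_atBot.comp this).const_mul C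
  exact squeeze_zero_norm' ((eventually_ge_atTop 0).mono h) h1

/-- Integrate the derivative of e^{2πiμτ} τ^p. The boundary term at infinity vanishes because Im μ >
0. -/
lemma horizontalIntegral_by_parts {z μ : ℂ} (hz : z ∈ upper) (p : ℂ) (hμ : μ ∈ upper) :
    p * horizontalIntegral z p μ + 2 * Real.pi * I * μ * horizontalIntegral z (p + 1) μ =
      -(cexp (2 * Real.pi * I * μ * z) * z ^ p) := by
  have hμ' : 0 < μ.im := hμ
  have hre : 0 < (-(2 * Real.pi * I * μ)).re := by rw [re_neg_two_pi_I_mul]; positivity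
  have h1 := integral_Ioi_of_hasDerivAt_of_tendsto (a := 0) (m := 0)
    (f := fun x : ℝ => cexp (2 * Real.pi * I * μ * (z + x)) * (z + x) ^ p)
    (f' := fun x : ℝ => p * (cexp (2 * Real.pi * I * μ * (z + x)) * (z + x) ^ (p - 1)) +
      2 * Real.pi * I * μ * (cexp (2 * Real.pi * I * μ * (z + x)) * (z + x) ^ (p + 1 - 1)))
    ?_ ?_ ?_ ?_
  · rw [integral_add ((integrableOn_horizontal hz p hμ).const_mul _)
      ((integrableOn_horizontal hz (p + 1) hμ).const_mul _), integral_const_mul,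
      integral_const_mul] at h1
    simpa [horizontalIntegral] using h1
  · have : ContinuousAt (fun x : ℝ => cexp (2 * Real.pi * I * μ * (z + x)) * (z + x) ^ p) 0 := by
      have c : ContinuousAt (fun x : ℝ => z + (x : ℂ)) 0 := by fun_prop
      exact ContinuousAt.mul (by fun_prop) (ContinuousAt.comp (f := fun x : ℝ => z + (x : ℂ))
        (continuousAt_cpow_const (slitPlane_of_upper (add_ofReal_mem_upper hz 0))) c)
    exact this.continuousWithinAt
  · intro x _
    have h8 := add_ofReal_mem_upper hz x
    have h2 : HasDerivAt (fun x : ℝ => z + (x : ℂ)) 1 x := by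
      simpa using (hasDerivAt_id x).ofReal_comp.const_add z
    have h3 := (h2.const_mul (2 * Real.pi * I * μ)).cexp
    have h4 : HasDerivAt (fun x : ℝ => (z + (x : ℂ)) ^ p) (p * (z + x) ^ (p - 1) * 1) x :=
      (hasStrictDerivAt_cpow_const (slitPlane_of_upper h8)).hasDerivAt.comp_of_eq x h2 rfl
    refine (h3.mul h4).congr_deriv ?_
    rw [add_sub_cancel_right]
    ring
  · exact ((integrableOn_horizontal hz p hμ).const_mul _).add
      ((integrableOn_horizontal hz (p + 1) hμ).const_mul _)
  · obtain ⟨C, _, hC⟩ := (subExp_cpow_horizontal hz p).norm_mul_exp_le hre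
    have := (tendsto_zero_of_exp_bound (half_pos hre) (hC _ le_rfl)).const_mul
      (cexp (2 * Real.pi * I * μ * z))
    rw [mul_zero] at this
    refine this.congr fun x => ?_
    have := horizontalIntegrand_eq z (p + 1) μ x
    rw [add_sub_cancel_right] at this
    exact this.symm

/-- Im μ > 0 gives decay to the right and Re μ > 0 gives decay upwards. In the quadrant the
exponential decays at rate 2πδ with δ the smaller of the two, and half of that absorbs the power of
τ. -/
lemma horizontalIntegral_eq_vertical {z μ : ℂ} (hz : z ∈ upper) (p : ℂ) (hμ : μ ∈ upper)
    (hμ' : 0 < μ.re) : horizontalIntegral z p μ = verticalIntegral z p μ := by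
  have him : 0 < μ.im := hμ
  have hz' : 0 < z.im := hz
  set δ := min μ.im μ.re with hδ
  have hδ0 : 0 < δ := lt_min him hμ'
  obtain ⟨C, hC, hCb⟩ := exists_cpow_growth (p - 1) hz' (show 0 < Real.pi * δ by positivity)
  refine integral_horizontal_eq_vertical (a := Real.pi * δ)
    (C := Real.exp (2 * Real.pi * I * μ * z).re * C * Real.exp (Real.pi * δ * ‖z‖))
    (f := fun τ => cexp (2 * Real.pi * I * μ * τ) * τ ^ (p - 1)) ?_ hz
    (by positivity) (integrableOn_horizontal hz p hμ) (integrableOn_vertical hz p hμ') ?_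
  · intro τ hτ
    have := slitPlane_of_upper hτ
    exact ((by fun_prop : DifferentiableAt ℂ (fun τ => cexp (2 * Real.pi * I * μ * τ)) τ).mul
      (differentiableAt_id.cpow_const this)).differentiableWithinAt
  · intro x y hx hy
    rw [norm_mul, norm_exp]
    have h1 := hCb (z + x + y * I) (by simp [hy])
    have h2 : ‖z + x + y * I‖ ≤ ‖z‖ + x + y := by
      refine (norm_add₃_le).trans ?_
      simp [abs_of_nonneg hx, abs_of_nonneg hy]
    have h3 : (2 * Real.pi * I * μ * (z + x + y * I)).re =
        (2 * Real.pi * I * μ * z).re - 2 * Real.pi * (μ.im * x + μ.re * y) := by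
      simp
      ring
    have h4 : δ * (x + y) ≤ μ.im * x + μ.re * y := by
      have := mul_le_mul_of_nonneg_right (min_le_left μ.im μ.re) hx
      have := mul_le_mul_of_nonneg_right (min_le_right μ.im μ.re) hy
      nlinarith
    rw [h3]
    calc _ ≤ Real.exp ((2 * Real.pi * I * μ * z).re - 2 * Real.pi * (δ * (x + y))) *
          (C * Real.exp (Real.pi * δ * (‖z‖ + x + y))) := by
          gcongr
          exact h1.trans (by gcongr)
      _ = _ := by
          rw [sub_eq_add_neg, Real.exp_add]
          have : Real.exp (-(2 * Real.pi * (δ * (x + y)))) *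
              Real.exp (Real.pi * δ * (‖z‖ + x + y)) =
              Real.exp (Real.pi * δ * ‖z‖) * Real.exp (-(Real.pi * δ) * (x + y)) := by
            rw [← Real.exp_add, ← Real.exp_add]
            ring_nf
          linear_combination Real.exp (2 * Real.pi * I * μ * z).re * C * this

/-! ### Boundary values on the real axis and the incomplete gamma function -/

/-- The integrand, in polar coordinates, of the integral that continues the incomplete gamma
function from the positive to the negative real axis. -/
def arcIntegrand (T : ℝ) (p : ℂ) (l θ : ℝ) : ℂ :=
  I * cexp (p * (l + θ * I)) * cexp (-(2 * Real.pi * T * cexp (l + θ * I)))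

lemma polar_mem_upper (l : ℝ) {θ : ℝ} (h0 : 0 < θ) (h1 : θ < Real.pi) :
    cexp (l + θ * I) ∈ upper := by
  have := Real.sin_pos_of_pos_of_lt_pi h0 h1
  simp only [upper, mem_ofPred_eq, exp_im]
  simp
  positivity

/-- On the arc μ = e^{l+iθ}, the θ-derivative of μ^p times the horizontal integral is i μ^p times
the left side of `horizontalIntegral_by_parts`. It is therefore elementary, and integrating it from
θ = 0 gives the formula. Writing μ^p as e^{p(l+iθ)} avoids branch questions up to θ = π. -/
lemma horizontalIntegral_polar {T : ℝ} (hT : 0 < T) (p : ℂ) (l : ℝ) {θ : ℝ} (h0 : 0 < θ)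
    (h1 : θ < Real.pi) :
    cexp (p * (l + θ * I)) * horizontalIntegral (I * T) p (cexp (l + θ * I)) =
      cexp (p * l) * verticalIntegral (I * T) p (cexp l) -
        (I * T) ^ p * ∫ t in (0 : ℝ)..θ, arcIntegrand T p l t := by
  have hz := mul_I_mem_upper hT
  set Φ : ℝ → ℂ := fun t => cexp (p * (l + t * I)) *
    horizontalIntegral (I * T) p (cexp (l + t * I)) with hΦ
  have hd : ∀ t ∈ Ioo 0 Real.pi, HasDerivAt Φ (-((I * T) ^ p * arcIntegrand T p l t)) t := by
    intro t ht
    have hm := polar_mem_upper l ht.1 ht.2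
    have e1 : HasDerivAt (fun t : ℝ => (l : ℂ) + t * I) I t := by
      simpa using ((hasDerivAt_id t).ofReal_comp.mul_const I).const_add (l : ℂ)
    have e2 := (e1.const_mul p).cexp
    have e3 := (hasDerivAt_horizontalIntegral hz p hm).comp t e1.cexp
    refine (e2.mul e3).congr_deriv ?_
    have e4 := horizontalIntegral_by_parts hz p hm
    have e5 : 2 * Real.pi * I * cexp (l + t * I) * (I * T) =
        -(2 * Real.pi * T * cexp (l + t * I)) := by
      linear_combination 2 * Real.pi * T * cexp (l + t * I) * I_sq
    rw [e5] at e4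
    simp only [arcIntegrand, Function.comp_apply]
    linear_combination cexp (p * (l + t * I)) * I * e4
  have hcont : Continuous fun t : ℝ => arcIntegrand T p l t := by
    unfold arcIntegrand
    fun_prop
  -- At θ = 0 the parameter is real and the horizontal integral loses its decay; only its limit, the
  -- vertical integral, is used there.
  have h := intervalIntegral.integral_eq_sub_of_hasDerivAt_of_tendsto h0
    (f := Φ) (f' := fun t => -((I * T) ^ p * arcIntegrand T p l t))
    (fa := cexp (p * l) * verticalIntegral (I * T) p (cexp l)) (fb := Φ θ)
    (fun t ht => hd t ⟨ht.1, ht.2.trans h1⟩) ?_ ?_ ?_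
  · rw [intervalIntegral.integral_neg, intervalIntegral.integral_const_mul] at h
    linear_combination -h
  · exact ((hcont.const_smul ((I * T : ℂ) ^ p)).neg).intervalIntegrable _ _
  · have hre : 0 < (cexp (l : ℂ)).re := by
      rw [← ofReal_exp, ofReal_re]
      exact Real.exp_pos l
    have c1 : ContinuousAt (fun t : ℝ => cexp (l + t * I)) 0 := by fun_prop
    have c2 : ContinuousAt (verticalIntegral (I * T) p) (cexp (l + (0 : ℝ) * I)) := by
      apply continuousAt_verticalIntegral hz
      simpa using hre
    have c3 : ContinuousAt (fun t : ℝ => cexp (p * (l + t * I)) *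
        verticalIntegral (I * T) p (cexp (l + t * I))) 0 :=
      ContinuousAt.mul (by fun_prop) (ContinuousAt.comp (f := fun t : ℝ => cexp (l + t * I)) c2 c1)
    have c4 := c3.tendsto.mono_left (nhdsWithin_le_nhds (s := Ioi 0))
    simp only [ofReal_zero, zero_mul, add_zero] at c4
    refine c4.congr' ?_
    have c5 : ∀ᶠ t : ℝ in 𝓝[>] 0, t < Real.pi / 2 :=
      nhdsWithin_le_nhds (eventually_lt_nhds (by positivity))
    filter_upwards [self_mem_nhdsWithin, c5] with t ht ht'
    have ht0 : 0 < t := ht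
    rw [hΦ]
    simp only
    rw [horizontalIntegral_eq_vertical hz p (polar_mem_upper l ht0 (by linarith))]
    have : 0 < Real.cos t := Real.cos_pos_of_mem_Ioo ⟨by linarith, ht'⟩
    rw [exp_re]
    simp
    positivity
  · exact ((hd θ ⟨h0, h1⟩).continuousAt.tendsto).mono_left nhdsWithin_le_nhds


lemma ofReal_mul_cpow {a : ℝ} (ha : 0 < a) {z : ℂ} (hz : z ≠ 0) (q : ℂ) :
    ((a : ℂ) * z) ^ q = (a : ℂ) ^ q * z ^ q := by
  have ha' : (a : ℂ) ≠ 0 := by exact_mod_cast ha.ne'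
  rw [cpow_def_of_ne_zero (mul_ne_zero ha' hz), cpow_def_of_ne_zero ha', cpow_def_of_ne_zero hz,
    log_ofReal_mul ha hz, ofReal_log ha.le, add_mul, Complex.exp_add]

/-- Substitute t = 2πρ(x + T), that is τ = it/(2πρ). -/
lemma verticalIntegral_ofReal {T ρ : ℝ} (hT : 0 < T) (hρ : 0 < ρ) (p : ℂ) :
    verticalIntegral (I * T) p ρ = I ^ p * (2 * Real.pi : ℂ) ^ (-p) * (ρ : ℂ) ^ (-p) *
      ∫ t in Ioi (2 * Real.pi * ρ * T), cexp (-(t : ℂ)) * (t : ℂ) ^ (p - 1) := by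
  set c : ℝ := 2 * Real.pi * ρ with hc'
  have hc : 0 < c := by positivity
  have hcc : (c : ℂ) ≠ 0 := by exact_mod_cast hc.ne'
  have hcp : (2 * Real.pi : ℂ) ^ (-p) * (ρ : ℂ) ^ (-p) = (c : ℂ) ^ (-p) := by
    have := ofReal_mul_cpow (a := 2 * Real.pi) (by positivity) (z := (ρ : ℂ))
      (by exact_mod_cast hρ.ne') (-p)
    rw [hc']
    push_cast at this ⊢
    exact this.symm
  have h1 : ∀ x ∈ Ioi (0 : ℝ), cexp (2 * Real.pi * I * ρ * (I * T + x * I)) *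
      (I * T + x * I) ^ (p - 1) * I = I ^ p * (c : ℂ) ^ (-p) *
        (c * (cexp (-((c * x + c * T : ℝ) : ℂ)) * ((c * x + c * T : ℝ) : ℂ) ^ (p - 1))) := by
    intro x hx
    have hx0 : 0 < x + T := add_pos hx hT
    have hx1 : ((x + T : ℝ) : ℂ) ≠ 0 := by exact_mod_cast hx0.ne'
    have e1 : 2 * Real.pi * I * ρ * (I * T + x * I) = -((c * x + c * T : ℝ) : ℂ) := by
      rw [hc']
      push_cast
      linear_combination 2 * Real.pi * ρ * (x + T) * I_sq
    have e2 : I * T + x * I = ((x + T : ℝ) : ℂ) * I := by push_cast; ring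
    have e3 : (((c * x + c * T : ℝ) : ℂ)) = (c : ℂ) * ((x + T : ℝ) : ℂ) := by push_cast; ring
    have e4 : I ^ p = I ^ (p - 1) * I := by
      conv_lhs => rw [show p = (p - 1) + 1 by ring, cpow_add _ _ I_ne_zero, cpow_one]
    have e5 : (c : ℂ) ^ (-p) * c * (c : ℂ) ^ (p - 1) = 1 := by
      nth_rewrite 2 [← cpow_one (c : ℂ)]
      rw [← cpow_add _ _ hcc, ← cpow_add _ _ hcc, show -p + 1 + (p - 1) = 0 by ring, cpow_zero]
    rw [e1, e2, ofReal_mul_cpow hx0 I_ne_zero, e4, e3, ofReal_mul_cpow hc hx1, ← e3]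
    linear_combination -(I ^ (p - 1) * I * cexp (-((c * x + c * T : ℝ) : ℂ)) *
      ((x + T : ℝ) : ℂ) ^ (p - 1)) * e5
  rw [verticalIntegral, setIntegral_congr_fun measurableSet_Ioi h1, integral_const_mul,
    mul_assoc (I ^ p) ((2 * Real.pi : ℂ) ^ (-p)), hcp, integral_const_mul]
  congr 1
  have h2 := integral_comp_mul_left_Ioi
    (fun u : ℝ => cexp (-((u + c * T : ℝ) : ℂ)) * ((u + c * T : ℝ) : ℂ) ^ (p - 1)) 0 hc
  have h3 := (measurePreserving_add_right volume (c * T)).setIntegral_preimage_emb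
    (measurableEmbedding_addRight (c * T))
    (fun u : ℝ => cexp (-(u : ℂ)) * (u : ℂ) ^ (p - 1)) (Ioi (c * T))
  rw [preimage_add_const_Ioi, sub_self] at h3
  rw [h2, mul_zero, h3, real_smul, ← mul_assoc, ofReal_inv, mul_inv_cancel₀ hcc, one_mul]

lemma incGamma_of_pos (p : ℂ) {x : ℝ} (hx : 0 < x) :
    incGamma p x = ∫ t in Ioi x, cexp (-(t : ℂ)) * (t : ℂ) ^ (p - 1) := by
  rw [incGamma, if_neg hx.le.not_gt, sub_zero, abs_of_pos hx]

/-- With ξ = 2πTμ the two parametrizations of the semicircle coincide. The endpoint θ = π is still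
on the principal branch, whose arguments lie in (-π, π]. -/
lemma arcIntegrand_eq {T : ℝ} (hT : 0 < T) (p : ℂ) (l : ℝ) {θ : ℝ} (h0 : 0 ≤ θ)
    (h1 : θ ≤ Real.pi) :
    cexp (-(((2 * Real.pi * Real.exp l * T : ℝ) : ℂ) * cexp (θ * I))) *
      (((2 * Real.pi * Real.exp l * T : ℝ) : ℂ) * cexp (θ * I)) ^ (p - 1) *
      (I * (((2 * Real.pi * Real.exp l * T : ℝ) : ℂ) * cexp (θ * I))) =
      (2 * Real.pi : ℂ) ^ p * (T : ℂ) ^ p * arcIntegrand T p l θ := by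
  set X : ℝ := 2 * Real.pi * Real.exp l * T with hX
  have hX0 : 0 < X := by positivity
  have hXc : (X : ℂ) ≠ 0 := by exact_mod_cast hX0.ne'
  have hne : (X : ℂ) * cexp (θ * I) ≠ 0 := mul_ne_zero hXc (exp_ne_zero _)
  have e0 : cexp (-((X : ℂ) * cexp (θ * I))) = cexp (-(2 * Real.pi * T * cexp (l + θ * I))) := by
    rw [Complex.exp_add, hX]
    push_cast
    ring_nf
  have e1 : ((X : ℂ) * cexp (θ * I)) ^ (p - 1) * ((X : ℂ) * cexp (θ * I)) =
      ((X : ℂ) * cexp (θ * I)) ^ p := by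
    nth_rewrite 2 [← cpow_one ((X : ℂ) * cexp (θ * I))]
    rw [← cpow_add _ _ hne, sub_add_cancel]
  have e2 : (cexp (θ * I)) ^ p = cexp (p * (θ * I)) := by
    rw [cpow_def_of_ne_zero (exp_ne_zero _), log_exp, mul_comm]
    · simpa using by linarith [Real.pi_pos]
    · simpa using h1
  have e3 : (X : ℂ) ^ p = (2 * Real.pi : ℂ) ^ p * (T : ℂ) ^ p * cexp (p * l) := by
    have : (X : ℂ) = ((2 * Real.pi : ℝ) : ℂ) * ((T : ℂ) * (Real.exp l : ℝ)) := by
      rw [hX]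
      push_cast
      ring
    have hTc : (T : ℂ) ≠ 0 := by exact_mod_cast hT.ne'
    have hlc : ((Real.exp l : ℝ) : ℂ) ≠ 0 := by exact_mod_cast (Real.exp_pos l).ne'
    rw [this, ofReal_mul_cpow (by positivity) (mul_ne_zero hTc hlc), ofReal_mul_cpow hT hlc,
      cpow_def_of_ne_zero hlc, ← ofReal_log (Real.exp_pos l).le, Real.log_exp, mul_comm (l : ℂ)]
    push_cast
    ring
  have e4 : cexp (p * (l + θ * I)) = cexp (p * l) * cexp (p * (θ * I)) := by
    rw [← Complex.exp_add]
    ring_nf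
  rw [e0, arcIntegrand, e4]
  rw [ofReal_mul_cpow hX0 (exp_ne_zero _) p, e2, e3] at e1
  linear_combination I * cexp (-(2 * Real.pi * T * cexp (l + θ * I))) * e1

/-- The limit of `horizontalIntegral (I T) p μ` as `μ` tends to a real `ν ≠ 0`. -/
def rayValue (T : ℝ) (p : ℂ) (ν : ℝ) : ℂ :=
  I ^ p * (2 * Real.pi : ℂ) ^ (-p) * ((ν : ℂ) ^ p)⁻¹ * incGamma p (2 * Real.pi * ν * T)

lemma rayValue_of_pos {T ν : ℝ} (hT : 0 < T) (hν : 0 < ν) (p : ℂ) :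
    verticalIntegral (I * T) p ν = rayValue T p ν := by
  rw [rayValue, verticalIntegral_ofReal hT hν, incGamma_of_pos _ (by positivity), cpow_neg (ν : ℂ)]

/-- This is the shape of `horizontalIntegral_polar` at θ = π, so the boundary value on the negative
axis will follow by continuity in polar coordinates. -/
lemma rayValue_of_neg {T ρ : ℝ} (hT : 0 < T) (hρ : 0 < ρ) (p : ℂ) :
    rayValue T p (-ρ) = cexp (-(p * (Real.log ρ + Real.pi * I))) *
      (cexp (p * Real.log ρ) * verticalIntegral (I * T) p ρ -
        (I * T) ^ p * ∫ t in (0 : ℝ)..Real.pi, arcIntegrand T p (Real.log ρ) t) := by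
  have hx : 2 * Real.pi * (-ρ) * T = -(2 * Real.pi * ρ * T) := by ring
  have hX : 0 < 2 * Real.pi * ρ * T := by positivity
  have hρc : (ρ : ℂ) ≠ 0 := by exact_mod_cast hρ.ne'
  have hTc : (T : ℂ) ≠ 0 := by exact_mod_cast hT.ne'
  have hpi : (2 * Real.pi : ℂ) ≠ 0 := by exact_mod_cast Real.two_pi_pos.ne'
  have e1 : ∫ θ in (0 : ℝ)..Real.pi,
        cexp (-(((2 * Real.pi * ρ * T : ℝ) : ℂ) * cexp (θ * I))) *
        (((2 * Real.pi * ρ * T : ℝ) : ℂ) * cexp (θ * I)) ^ (p - 1) *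
          (I * (((2 * Real.pi * ρ * T : ℝ) : ℂ) * cexp (θ * I))) =
      (2 * Real.pi : ℂ) ^ p * (T : ℂ) ^ p *
        ∫ t in (0 : ℝ)..Real.pi, arcIntegrand T p (Real.log ρ) t := by
    rw [← intervalIntegral.integral_const_mul]
    refine intervalIntegral.integral_congr fun θ hθ => ?_
    rw [uIcc_of_le Real.pi_pos.le] at hθ
    have := arcIntegrand_eq hT p (Real.log ρ) hθ.1 hθ.2
    rwa [Real.exp_log hρ] at this
  have e2 : (((-ρ : ℝ) : ℂ) ^ p)⁻¹ = cexp (-(p * (Real.log ρ + Real.pi * I))) := by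
    have h3 : ((-ρ : ℝ) : ℂ) ≠ 0 := by exact_mod_cast (neg_lt_zero.2 hρ).ne
    have h4 : log ((-ρ : ℝ) : ℂ) = Real.log ρ + Real.pi * I := by
      have := log_ofReal_mul hρ (x := -1) (by simp)
      rw [log_neg_one] at this
      simpa using this
    rw [cpow_def_of_ne_zero h3, h4, ← Complex.exp_neg, mul_comm]
  have e3 : cexp (p * Real.log ρ) * (ρ : ℂ) ^ (-p) = 1 := by
    rw [cpow_def_of_ne_zero hρc, ← ofReal_log hρ.le, ← Complex.exp_add]
    ring_nf
    exact Complex.exp_zero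
  have e4 : (I * T : ℂ) ^ p = I ^ p * (T : ℂ) ^ p := by
    rw [mul_comm, ofReal_mul_cpow hT I_ne_zero, mul_comm]
  have e5 : (2 * Real.pi : ℂ) ^ (-p) * (2 * Real.pi : ℂ) ^ p = 1 := by
    rw [← cpow_add _ _ hpi, neg_add_cancel, cpow_zero]
  rw [rayValue, hx, incGamma, if_pos (neg_lt_zero.2 hX), abs_neg, abs_of_pos hX, e1, e2,
    verticalIntegral_ofReal hT hρ, e4]
  set R := ∫ t in Ioi (2 * Real.pi * ρ * T), cexp (-(t : ℂ)) * (t : ℂ) ^ (p - 1)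
  set A := ∫ t in (0 : ℝ)..Real.pi, arcIntegrand T p (Real.log ρ) t
  set E := cexp (-(p * (Real.log ρ + Real.pi * I)))
  linear_combination -E * I ^ p * (2 * Real.pi : ℂ) ^ (-p) * R * e3 -
    E * I ^ p * (T : ℂ) ^ p * A * e5

/-- Near ν > 0 the integral rotates to the vertical one, which is continuous across the axis. Near ν
< 0 the argument tends to π from below, and the right side of the polar formula is continuous up to
θ = π. -/
lemma tendsto_horizontalIntegral {T ν : ℝ} (hT : 0 < T) (hν : ν ≠ 0) (p : ℂ) :
    Tendsto (horizontalIntegral (I * T) p) (𝓝[upper] (ν : ℂ)) (𝓝 (rayValue T p ν)) := by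
  have hz := mul_I_mem_upper hT
  rcases hν.lt_or_gt with hν | hν
  · obtain ⟨ρ, hρ, rfl⟩ : ∃ ρ : ℝ, 0 < ρ ∧ ν = -ρ := ⟨-ν, by linarith, by ring⟩
    have hne : ((-ρ : ℝ) : ℂ) ≠ 0 := by exact_mod_cast hν.ne
    have hnorm : Tendsto (fun μ : ℂ => ‖μ‖) (𝓝[upper] ((-ρ : ℝ) : ℂ)) (𝓝 ρ) := by
      have := (continuous_norm (E := ℂ)).tendsto ((-ρ : ℝ) : ℂ)
      rw [norm_real, norm_neg, Real.norm_of_nonneg hρ.le] at this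
      exact this.mono_left nhdsWithin_le_nhds
    have hlog : Tendsto (fun μ : ℂ => Real.log ‖μ‖) (𝓝[upper] ((-ρ : ℝ) : ℂ)) (𝓝 (Real.log ρ)) :=
      hnorm.log hρ.ne'
    have harg : Tendsto (fun μ : ℂ => arg μ) (𝓝[upper] ((-ρ : ℝ) : ℂ)) (𝓝 Real.pi) := by
      have := (continuousWithinAt_arg_of_re_neg_of_im_zero (z := ((-ρ : ℝ) : ℂ))
        (by simpa using hρ) (by simp)).tendsto
      rw [arg_ofReal_of_neg hν] at this
      exact this.mono_left (nhdsWithin_mono _ fun z (hz : 0 < z.im) => hz.le)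
    have hnormc : Tendsto (fun μ : ℂ => ((‖μ‖ : ℝ) : ℂ)) (𝓝[upper] ((-ρ : ℝ) : ℂ)) (𝓝 (ρ : ℂ)) :=
      (continuous_ofReal.tendsto ρ).comp hnorm
    have hlogc : Tendsto (fun μ : ℂ => ((Real.log ‖μ‖ : ℝ) : ℂ)) (𝓝[upper] ((-ρ : ℝ) : ℂ))
        (𝓝 ((Real.log ρ : ℝ) : ℂ)) := (continuous_ofReal.tendsto _).comp hlog
    have hargc : Tendsto (fun μ : ℂ => ((arg μ : ℝ) : ℂ)) (𝓝[upper] ((-ρ : ℝ) : ℂ))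
        (𝓝 (Real.pi : ℂ)) := (continuous_ofReal.tendsto _).comp harg
    have hv := ((continuousAt_verticalIntegral hz p (μ := (ρ : ℂ)) (by simpa using hρ)).tendsto).comp
      hnormc
    have hA : Continuous fun x : ℝ × ℝ => ∫ t in (0 : ℝ)..x.2, arcIntegrand T p x.1 t := by
      apply intervalIntegral.continuous_parametric_intervalIntegral_of_continuous
      · unfold arcIntegrand
        fun_prop
      · fun_prop
    have ha := (hA.tendsto (Real.log ρ, Real.pi)).comp (hlog.prodMk_nhds harg)
    rw [rayValue_of_neg hT hρ]
    have hlim : Tendsto (fun μ : ℂ => cexp (-(p * ((Real.log ‖μ‖ : ℝ) + (arg μ : ℝ) * I))) *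
        (cexp (p * (Real.log ‖μ‖ : ℝ)) * verticalIntegral (I * T) p ((‖μ‖ : ℝ) : ℂ) -
        (I * T) ^ p * ∫ t in (0 : ℝ)..(arg μ), arcIntegrand T p (Real.log ‖μ‖) t))
        (𝓝[upper] ((-ρ : ℝ) : ℂ)) (𝓝 (cexp (-(p * (Real.log ρ + Real.pi * I))) *
      (cexp (p * Real.log ρ) * verticalIntegral (I * T) p ρ -
        (I * T) ^ p * ∫ t in (0 : ℝ)..Real.pi, arcIntegrand T p (Real.log ρ) t))) := by
      refine Tendsto.mul ?_ (Tendsto.sub (Tendsto.mul ?_ hv) (ha.const_mul _))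
      · exact (((hlogc.add (hargc.mul_const I)).const_mul p).neg).cexp
      · exact (hlogc.const_mul p).cexp
    refine hlim.congr' ?_
    filter_upwards [self_mem_nhdsWithin] with μ hμ
    have hμ0 := ne_zero_of_upper hμ
    have hexp : cexp ((Real.log ‖μ‖ : ℝ) + (arg μ : ℝ) * I) = μ := by
      have := exp_log hμ0
      rwa [Complex.log] at this
    have h0 : 0 < arg μ := by
      rcases (arg_nonneg_iff.2 (le_of_lt hμ)).lt_or_eq with h | h
      · exact h
      · exact absurd (arg_eq_zero_iff.1 h.symm).2 (ne_of_gt hμ)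
    have h1 : arg μ < Real.pi := arg_lt_pi_iff.2 (Or.inr (ne_of_gt hμ))
    have := horizontalIntegral_polar hT p (Real.log ‖μ‖) h0 h1
    rw [hexp, ← ofReal_exp, Real.exp_log (norm_pos_iff.2 hμ0)] at this
    rw [← this, ← mul_assoc, ← Complex.exp_add, neg_add_cancel, Complex.exp_zero, one_mul]
  · rw [← rayValue_of_pos hT hν]
    have := (continuousAt_verticalIntegral hz p (μ := (ν : ℂ)) (by simpa using hν)).tendsto.mono_left
      (nhdsWithin_le_nhds (s := upper))
    refine this.congr' ?_
    have hre : ∀ᶠ μ : ℂ in 𝓝[upper] (ν : ℂ), 0 < μ.re :=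
      nhdsWithin_le_nhds ((isOpen_lt continuous_const Complex.continuous_re).mem_nhds
        (by simpa using hν))
    filter_upwards [self_mem_nhdsWithin, hre] with μ hμ hμ'
    exact (horizontalIntegral_eq_vertical hz p hμ hμ').symm

/-! ### Holomorphy and uniform bounds in the exponent -/

/-- This serves both for powers, written as exponentials of p log, and for the factor e^{2πiβτ} on a
segment. -/
lemma differentiable_integral_mul_exp {u v : ℝ → ℂ} {a b : ℝ} (hu : ContinuousOn u (uIcc a b))
    (hv : ContinuousOn v (uIcc a b)) :
    Differentiable ℂ fun p : ℂ => ∫ t in a..b, v t * cexp (p * u t) := by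
  intro p
  obtain ⟨K, hK⟩ := isCompact_uIcc.exists_bound_of_continuousOn hu
  obtain ⟨M, hM⟩ := isCompact_uIcc.exists_bound_of_continuousOn hv
  have hc : ∀ q : ℂ, ContinuousOn (fun t => v t * cexp (q * u t)) (uIcc a b) := fun q =>
    hv.mul (continuousOn_const.mul hu).cexp
  have hm : ∀ {f : ℝ → ℂ}, ContinuousOn f (uIcc a b) →
      AEStronglyMeasurable f (volume.restrict (uIoc a b)) := fun hf =>
    (hf.mono uIoc_subset_uIcc).aestronglyMeasurable measurableSet_uIoc
  refine (intervalIntegral.hasDerivAt_integral_of_dominated_loc_of_deriv_le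
    (F := fun (q : ℂ) (t : ℝ) => v t * cexp (q * u t))
    (F' := fun (q : ℂ) (t : ℝ) => v t * (cexp (q * u t) * u t))
    (bound := fun _ => M * (Real.exp ((‖p‖ + 1) * K) * K)) (Metric.ball_mem_nhds p one_pos)
    (Eventually.of_forall fun q => hm (hc q)) (hc p).intervalIntegrable
    (hm (hv.mul ((continuousOn_const.mul hu).cexp.mul hu))) ?_ intervalIntegrable_const
    ?_).2.differentiableAt
  · filter_upwards with t ht q hq
    have ht' := uIoc_subset_uIcc ht
    have h1 : ‖q‖ ≤ ‖p‖ + 1 := by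
      have := norm_le_norm_add_norm_sub' q p
      have h2 : ‖q - p‖ < 1 := by simpa [dist_eq_norm] using hq
      linarith
    have hK0 := (norm_nonneg _).trans (hK t ht')
    have hM0 := (norm_nonneg _).trans (hM t ht')
    rw [norm_mul, norm_mul, norm_exp]
    gcongr
    · exact hM t ht'
    · refine (re_le_norm _).trans ?_
      rw [norm_mul]
      gcongr
      exact hK t ht'
    · exact hK t ht'
  · filter_upwards with t _ q _
    have h1 : HasDerivAt (fun q : ℂ => q * u t) (u t) q := by
      simpa using (hasDerivAt_id q).mul_const (u t)
    exact h1.cexp.const_mul (v t)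

/-- The ray part is the Mellin transform of an exponential cut off away from 0, so no condition on p
arises there. The arc part is an integral of exp(p log ξ) over a compact path. -/
lemma differentiable_incGamma {x : ℝ} (hx : x ≠ 0) : Differentiable ℂ fun p => incGamma p x := by
  have hX : 0 < |x| := abs_pos.2 hx
  unfold incGamma
  refine Differentiable.sub ?_ ?_
  · have hm : (fun p : ℂ => ∫ t in Ioi |x|, cexp (-(t : ℂ)) * (t : ℂ) ^ (p - 1)) =
        mellin ((Ioi |x|).indicator fun t : ℝ => cexp (-(t : ℂ))) := by
      funext p
      rw [mellin]
      have : ∀ t : ℝ, (t : ℂ) ^ (p - 1) • (Ioi |x|).indicator (fun t : ℝ => cexp (-(t : ℂ))) t =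
          (Ioi |x|).indicator (fun t : ℝ => cexp (-(t : ℂ)) * (t : ℂ) ^ (p - 1)) t := by
        intro t
        by_cases ht : t ∈ Ioi |x| <;> simp [ht, mul_comm]
      simp_rw [this]
      rw [setIntegral_indicator measurableSet_Ioi,
        inter_eq_right.2 (Ioi_subset_Ioi hX.le)]
    rw [hm]
    intro p
    refine mellin_differentiableAt_of_isBigO_rpow_exp (a := 1) (b := p.re - 1) one_pos ?_ ?_ ?_
      (by linarith)
    · refine (Continuous.locallyIntegrable (by fun_prop)).indicator measurableSet_Ioi
        |>.locallyIntegrableOn _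
    · refine Asymptotics.IsBigO.of_bound 1 ?_
      filter_upwards with t
      by_cases ht : t ∈ Ioi |x|
      · simp [ht, norm_exp, abs_of_pos (Real.exp_pos _)]
      · simp only [indicator_of_notMem ht, norm_zero]
        positivity
    · refine Asymptotics.IsBigO.of_bound 1 ?_
      filter_upwards [nhdsWithin_le_nhds (eventually_lt_nhds hX)] with t ht
      have : t ∉ Ioi |x| := not_lt.2 ht.le
      simp only [indicator_of_notMem this, norm_zero]
      positivity
  · split_ifs with h
    · have hl : ∀ θ : ℝ, θ ∈ uIcc 0 Real.pi → log (((|x| : ℝ) : ℂ) * cexp (θ * I)) =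
          Real.log |x| + θ * I := by
        intro θ hθ
        rw [uIcc_of_le Real.pi_pos.le] at hθ
        rw [log_ofReal_mul hX (exp_ne_zero _), log_exp]
        · simpa using by linarith [Real.pi_pos, hθ.1]
        · simpa using hθ.2
      have h1 := differentiable_integral_mul_exp (a := 0) (b := Real.pi)
        (u := fun θ : ℝ => (Real.log |x| : ℂ) + θ * I)
        (v := fun θ : ℝ => cexp (-(((|x| : ℝ) : ℂ) * cexp (θ * I))) * I)
        (by fun_prop) (by fun_prop)
      refine fun p' => (h1 p').congr_of_eventuallyEq (Eventually.of_forall fun p => ?_)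
      refine intervalIntegral.integral_congr fun θ hθ => ?_
      have hne : ((|x| : ℝ) : ℂ) * cexp (θ * I) ≠ 0 :=
        mul_ne_zero (by exact_mod_cast hX.ne') (exp_ne_zero _)
      have e1 : (((|x| : ℝ) : ℂ) * cexp (θ * I)) ^ (p - 1) * (((|x| : ℝ) : ℂ) * cexp (θ * I)) =
          cexp (p * (Real.log |x| + θ * I)) := by
        nth_rewrite 2 [← cpow_one (((|x| : ℝ) : ℂ) * cexp (θ * I))]
        rw [← cpow_add _ _ hne, sub_add_cancel, cpow_def_of_ne_zero hne, hl θ hθ, mul_comm]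
      rw [← e1]
      ring
    · exact differentiable_const 0

lemma exists_cpow_growth_of_norm_le (R : ℝ) {y₀ ε : ℝ} (hy₀ : 0 < y₀) (hε : 0 < ε) :
    ∃ C : ℝ, 0 < C ∧ ∀ q : ℂ, ‖q‖ ≤ R → ∀ z : ℂ, y₀ ≤ z.im →
      ‖z ^ q‖ ≤ C * Real.exp (ε * ‖z‖) := by
  obtain ⟨C₁, hC₁, h₁⟩ := exists_rpow_le_exp R hy₀ hε
  obtain ⟨C₂, hC₂, h₂⟩ := exists_rpow_le_exp (-R) hy₀ hε
  refine ⟨(C₁ + C₂) * Real.exp (Real.pi * R), by positivity, fun q hq z hz => ?_⟩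
  have hn : y₀ ≤ ‖z‖ := hz.trans ((le_abs_self _).trans (abs_im_le_norm z))
  have hn0 : 0 < ‖z‖ := hy₀.trans_le hn
  have hre := abs_le.1 ((abs_re_le_norm q).trans hq)
  have him := (abs_im_le_norm q).trans hq
  have h3 : ‖z‖ ^ q.re ≤ ‖z‖ ^ R + ‖z‖ ^ (-R) := by
    rcases le_total 1 ‖z‖ with h | h
    · exact (Real.rpow_le_rpow_of_exponent_le h hre.2).trans (by linarith [Real.rpow_pos_of_pos hn0 (-R)])
    · exact (Real.rpow_le_rpow_of_exponent_ge hn0 h hre.1).trans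
        (by linarith [Real.rpow_pos_of_pos hn0 R])
  calc _ ≤ ‖z‖ ^ q.re * Real.exp (Real.pi * |q.im|) := norm_cpow_le_mul_exp _ q
    _ ≤ (C₁ * Real.exp (ε * ‖z‖) + C₂ * Real.exp (ε * ‖z‖)) * Real.exp (Real.pi * R) := by
        gcongr
        exact h3.trans (add_le_add (h₁ _ hn) (h₂ _ hn))
    _ = _ := by ring

/-- The factor e^{-2π Re(μ) T} is the size of the Fourier term of frequency Re μ at τ = iT. Sums of
these integrals are thus dominated by the absolutely convergent expansion at iT. -/
lemma exists_norm_verticalIntegral_le {T δ : ℝ} (hT : 0 < T) (hδ : 0 < δ) (R : ℝ) :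
    ∃ C : ℝ, 0 ≤ C ∧ ∀ p : ℂ, ‖p‖ ≤ R → ∀ μ : ℂ, δ ≤ μ.re →
      ‖verticalIntegral (I * T) p μ‖ ≤ C * Real.exp (-(2 * Real.pi * μ.re * T)) := by
  obtain ⟨C, hC, h⟩ := exists_cpow_growth_of_norm_le (R + 1) hT (show 0 < Real.pi * δ by positivity)
  refine ⟨∫ x in Ioi (0 : ℝ), C * Real.exp (Real.pi * δ * T) * Real.exp (-(Real.pi * δ) * x),
    integral_nonneg fun x => by positivity, fun p hp μ hμ => ?_⟩
  have e1 : ‖I * cexp (2 * Real.pi * I * μ * (I * T))‖ = Real.exp (-(2 * Real.pi * μ.re * T)) := by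
    rw [norm_mul, norm_I, one_mul, norm_exp]
    congr 1
    simp
  rw [verticalIntegral_eq, norm_mul, e1, mul_comm]
  gcongr
  refine norm_integral_le_of_norm_le
    ((exp_neg_integrableOn_Ioi 0 (by positivity)).const_mul _) ?_
  filter_upwards [ae_restrict_mem measurableSet_Ioi] with x hx
  have hx0 : 0 < x := hx
  have hq : ‖p - 1‖ ≤ R + 1 := (norm_sub_le p 1).trans (by simpa using hp)
  have h1 := h (p - 1) hq (I * T + x * I) (by simpa using hx0.le)
  have h2 : ‖I * T + x * I‖ ≤ T + x := by
    refine (norm_add_le _ _).trans ?_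
    simp [abs_of_pos hx0, abs_of_pos hT]
  have h3 : (-(2 * Real.pi * μ) * x).re = -(2 * Real.pi * μ.re * x) := by simp
  rw [norm_mul, norm_exp, h3]
  calc _ ≤ (C * Real.exp (Real.pi * δ * (T + x))) * Real.exp (-(2 * Real.pi * δ * x)) := by
        gcongr
        exact h1.trans (by gcongr)
    _ = _ := by
        rw [mul_assoc C, mul_assoc C, ← Real.exp_add, ← Real.exp_add]
        ring_nf

/-! ### Generalized Fourier expansions and their gamma series -/

/-- The frequency `(n + κ) / w`. -/
def freq (κ : ℝ) (w : ℕ) (n : ℤ) : ℝ := ((n : ℝ) + κ) / w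

/-- `H` has the expansion `∑ a(n) e^{2πi(n+κ)τ/w}` on the upper half-plane. -/
structure QExp (κ : ℝ) (w : ℕ) (a : ℤ → ℂ) (H : ℂ → ℂ) : Prop where
  shift_nonneg : 0 ≤ κ
  shift_lt_one : κ < 1
  width_pos : 0 < w
  principal : ∃ n₀ : ℤ, ∀ n < n₀, a n = 0
  expansion : ∀ τ ∈ upper, HasSum
    (fun n : ℤ => a n * cexp (2 * Real.pi * I * (freq κ w n : ℝ) * τ)) (H τ)

/-- The constant term of an expansion. -/
def constTerm (κ : ℝ) (a : ℤ → ℂ) : ℂ := if κ = 0 then a 0 else 0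

/-- `a(n) ((n+κ)/w)^{-p} Γ(p, 2π(n+κ)T/w)` for `n + κ ≠ 0`. -/
def gammaTerm (T : ℝ) (κ : ℝ) (w : ℕ) (a : ℤ → ℂ) (p : ℂ) (n : ℤ) : ℂ :=
  if freq κ w n = 0 then 0 else
    a n / (freq κ w n : ℂ) ^ p * incGamma p (2 * Real.pi * freq κ w n * T)

/-- The part of the regularized integral `∫_{iT}^{i∞} H(τ) τ^{p-1} dτ` that does not come from the
constant term. -/
def gammaSum (T : ℝ) (κ : ℝ) (w : ℕ) (a : ℤ → ℂ) (p : ℂ) : ℂ :=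
  I ^ p * (2 * Real.pi : ℂ) ^ (-p) * ∑' n : ℤ, gammaTerm T κ w a p n

/-- The regularized integral `∫_{iT}^{i∞} H(τ) τ^{p-1} dτ`. -/
def regValue (T : ℝ) (κ : ℝ) (w : ℕ) (a : ℤ → ℂ) (p : ℂ) : ℂ :=
  gammaSum T κ w a p - constTerm κ a * (I * T) ^ p / p

lemma gammaTerm_eq_rayValue {T κ : ℝ} {w : ℕ} {a : ℤ → ℂ} {p : ℂ} {n : ℤ}
    (h : freq κ w n ≠ 0) :
    I ^ p * (2 * Real.pi : ℂ) ^ (-p) * gammaTerm T κ w a p n = a n * rayValue T p (freq κ w n) := by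
  rw [gammaTerm, if_neg h, rayValue]
  ring

namespace QExp

variable {κ : ℝ} {w : ℕ} {a : ℤ → ℂ} {H : ℂ → ℂ}

lemma freq_eq_zero_iff (h : QExp κ w a H) {n : ℤ} : freq κ w n = 0 ↔ n = 0 ∧ κ = 0 := by
  have hw : (w : ℝ) ≠ 0 := by exact_mod_cast h.width_pos.ne'
  rw [freq, div_eq_zero_iff, or_iff_left hw]
  constructor
  · intro hn
    have h1 : (-1 : ℝ) < n := by linarith [h.shift_lt_one]
    have h2 : (n : ℝ) ≤ 0 := by linarith [h.shift_nonneg]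
    have h3 : (-1 : ℤ) < n := by exact_mod_cast h1
    have h4 : n ≤ 0 := by exact_mod_cast h2
    obtain rfl : n = 0 := by omega
    exact ⟨rfl, by simpa using hn⟩
  · rintro ⟨rfl, rfl⟩
    simp

lemma norm_term (n : ℤ) (a : ℤ → ℂ) (τ : ℂ) :
    ‖a n * cexp (2 * Real.pi * I * (freq κ w n : ℝ) * τ)‖ =
      ‖a n‖ * Real.exp (-(2 * Real.pi * freq κ w n * τ.im)) := by
  rw [norm_mul, norm_exp]
  simp

lemma summable_norm (h : QExp κ w a H) {y : ℝ} (hy : 0 < y) :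
    Summable fun n : ℤ => ‖a n‖ * Real.exp (-(2 * Real.pi * freq κ w n * y)) := by
  have := (h.expansion (I * y) (mul_I_mem_upper hy)).summable.norm
  simp_rw [norm_term] at this
  simpa using this

/-- Only finitely many terms escape the uniform estimates for frequencies at least 1; they are
treated one at a time. -/
lemma finite_small (h : QExp κ w a H) (M : ℝ) : {n : ℤ | a n ≠ 0 ∧ freq κ w n < M}.Finite := by
  obtain ⟨n₀, hn₀⟩ := h.principal
  have hw : (0 : ℝ) < w := by exact_mod_cast h.width_pos
  refine (finite_Icc n₀ ⌈M * w⌉).subset ?_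
  rintro n ⟨h1, h2⟩
  refine ⟨?_, ?_⟩
  · by_contra hlt
    exact h1 (hn₀ n (not_le.1 hlt))
  · rw [freq, div_lt_iff₀ hw] at h2
    have : (n : ℝ) ≤ M * w := by linarith [h.shift_nonneg]
    exact_mod_cast this.trans (Int.le_ceil _)

lemma exists_le_freq (h : QExp κ w a H) : ∃ M : ℝ, 0 ≤ M ∧ ∀ n, a n ≠ 0 → -M ≤ freq κ w n := by
  obtain ⟨n₀, hn₀⟩ := h.principal
  have hw : (1 : ℝ) ≤ w := by exact_mod_cast h.width_pos
  refine ⟨|(n₀ : ℝ)|, abs_nonneg _, fun n hn => ?_⟩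
  have h1 : n₀ ≤ n := by
    by_contra hlt
    exact hn (hn₀ n (not_le.1 hlt))
  have h2 : (n₀ : ℝ) ≤ n := by exact_mod_cast h1
  rw [freq, le_div_iff₀ (by linarith)]
  have h3 := neg_abs_le (n₀ : ℝ)
  have h4 := abs_nonneg (n₀ : ℝ)
  nlinarith [h.shift_nonneg]

lemma exists_bound (h : QExp κ w a H) {y₀ : ℝ} (hy₀ : 0 < y₀) :
    ∃ C B : ℝ, 0 ≤ C ∧ 0 ≤ B ∧ ∀ τ : ℂ, y₀ ≤ τ.im → ‖H τ‖ ≤ C * Real.exp (B * τ.im) := by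
  obtain ⟨M, hM, hf⟩ := h.exists_le_freq
  have hs := h.summable_norm hy₀
  refine ⟨∑' n : ℤ, ‖a n‖ * Real.exp (-(2 * Real.pi * freq κ w n * y₀)), 2 * Real.pi * M,
    tsum_nonneg fun n => by positivity, by positivity, fun τ hτ => ?_⟩
  have h1 := h.expansion τ (hy₀.trans_le hτ)
  rw [← h1.tsum_eq]
  refine tsum_of_norm_bounded (hs.hasSum.mul_right (Real.exp (2 * Real.pi * M * τ.im))) fun n => ?_
  rw [norm_term, mul_assoc ‖a n‖, ← Real.exp_add]
  by_cases hn : a n = 0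
  · simp [hn]
  · gcongr
    have := hf n hn
    have h2 : 0 ≤ (freq κ w n + M) * (τ.im - y₀) := mul_nonneg (by linarith) (by linarith)
    have h3 : 0 ≤ M * y₀ := by positivity
    have h4 : 0 ≤ Real.pi * ((freq κ w n + M) * (τ.im - y₀) + M * y₀) := by positivity
    nlinarith

lemma differentiableOn (h : QExp κ w a H) : DifferentiableOn ℂ H upper := by
  intro z hz
  have hz' : 0 < z.im := hz
  set U : Set ℂ := {τ | z.im / 2 < τ.im ∧ τ.im < 2 * z.im} with hU
  have hUo : IsOpen U := (isOpen_lt continuous_const Complex.continuous_im).inter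
    (isOpen_lt Complex.continuous_im continuous_const)
  have hzU : z ∈ U := ⟨by linarith, by linarith⟩
  have h1 : DifferentiableOn ℂ (fun τ => ∑' n : ℤ, a n *
      cexp (2 * Real.pi * I * (freq κ w n : ℝ) * τ)) U := by
    refine differentiableOn_tsum_of_summable_norm
      ((h.summable_norm (half_pos hz')).add (h.summable_norm (mul_pos two_pos hz')))
      (fun n => by fun_prop) hUo fun n τ hτ => ?_
    rw [norm_term, ← mul_add]
    gcongr
    -- Terms of nonnegative frequency are largest at the lower edge of the strip, the others at the
    -- upper edge; hence the sum of two majorants.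
    rcases le_total 0 (freq κ w n) with hn | hn
    · refine le_add_of_le_of_nonneg (Real.exp_le_exp.2 ?_) (Real.exp_pos _).le
      have := mul_le_mul_of_nonneg_left hτ.1.le (mul_nonneg Real.two_pi_pos.le hn)
      linarith
    · refine le_add_of_nonneg_of_le (Real.exp_pos _).le (Real.exp_le_exp.2 ?_)
      have := mul_le_mul_of_nonpos_left hτ.2.le
        (mul_nonpos_of_nonneg_of_nonpos Real.two_pi_pos.le hn)
      linarith
  have h2 : DifferentiableAt ℂ (fun τ => ∑' n : ℤ, a n *
      cexp (2 * Real.pi * I * (freq κ w n : ℝ) * τ)) z := h1.differentiableAt (hUo.mem_nhds hzU)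
  refine (h2.congr_of_eventuallyEq ?_).differentiableWithinAt
  filter_upwards [isOpen_upper.mem_nhds hz] with τ hτ
  exact (h.expansion τ hτ).tsum_eq.symm

lemma differentiable_gammaTerm {T : ℝ} (hT : 0 < T) (n : ℤ) :
    Differentiable ℂ fun p => gammaTerm T κ w a p n := by
  unfold gammaTerm
  split_ifs with hn
  · exact differentiable_const 0
  · have hn' : (freq κ w n : ℂ) ≠ 0 := by exact_mod_cast hn
    have h1 : Differentiable ℂ fun p : ℂ => (freq κ w n : ℂ) ^ p := fun p =>
      differentiableAt_id.const_cpow (Or.inl hn')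
    have h2 : Differentiable ℂ fun p : ℂ => a n / (freq κ w n : ℂ) ^ p :=
      (differentiable_const _).div h1 fun p => by simp [cpow_eq_zero_iff, hn']
    exact h2.mul (differentiable_incGamma
      (mul_ne_zero (mul_ne_zero Real.two_pi_pos.ne' hn) hT.ne'))

/-- For frequency at least 1 the term is a vertical integral up to a factor bounded for bounded p,
hence comparable to the Fourier term at iT. The finitely many remaining terms are entire in p, hence
bounded on the ball. -/
lemma exists_summable_bound (h : QExp κ w a H) {T : ℝ} (hT : 0 < T) (R : ℝ) :
    ∃ u : ℤ → ℝ, Summable u ∧ ∀ p : ℂ, ‖p‖ ≤ R → ∀ n, ‖gammaTerm T κ w a p n‖ ≤ u n := by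
  obtain ⟨C, hC, hCb⟩ := exists_norm_verticalIntegral_le hT one_pos R
  have hpi : (2 * Real.pi : ℂ) ≠ 0 := by exact_mod_cast Real.two_pi_pos.ne'
  have hK : ∃ K : ℝ, ∀ p ∈ Metric.closedBall (0 : ℂ) R, ‖(I ^ (-p) * (2 * Real.pi : ℂ) ^ p)‖ ≤ K := by
    refine (isCompact_closedBall _ _).exists_bound_of_continuousOn (Continuous.continuousOn ?_)
    exact (continuous_neg.const_cpow (Or.inl I_ne_zero)).mul
      (continuous_id.const_cpow (Or.inl hpi))
  obtain ⟨K, hK⟩ := hK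
  have hB : ∀ n : ℤ, ∃ B : ℝ, ∀ p ∈ Metric.closedBall (0 : ℂ) R, ‖gammaTerm T κ w a p n‖ ≤ B :=
    fun n => (isCompact_closedBall _ _).exists_bound_of_continuousOn
      (differentiable_gammaTerm hT n).continuous.continuousOn
  choose B hB using hB
  set S := {n : ℤ | a n ≠ 0 ∧ freq κ w n < 1} with hS
  have hSf : S.Finite := h.finite_small 1
  refine ⟨fun n => K * C * (‖a n‖ * Real.exp (-(2 * Real.pi * freq κ w n * T))) +
    S.indicator (fun n => |B n|) n, ?_, fun p hp n => ?_⟩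
  · exact ((h.summable_norm hT).mul_left _).add
      (summable_of_hasFiniteSupport (hSf.subset support_indicator_subset))
  · have hp' : p ∈ Metric.closedBall (0 : ℂ) R := by simpa using hp
    have hK0 : 0 ≤ K := (norm_nonneg _).trans (hK p hp')
    beta_reduce
    by_cases hn : n ∈ S
    · rw [indicator_of_mem hn]
      exact le_add_of_nonneg_of_le (by positivity) ((hB n p hp').trans (le_abs_self _))
    · rw [indicator_of_notMem hn, add_zero]
      by_cases han : a n = 0
      · have : gammaTerm T κ w a p n = 0 := by simp [gammaTerm, han]
        rw [this, norm_zero]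
        positivity
      · have hf : 1 ≤ freq κ w n := by
          by_contra hlt
          exact hn ⟨han, not_le.1 hlt⟩
        have hf0 : freq κ w n ≠ 0 := by linarith
        have e1 := gammaTerm_eq_rayValue (T := T) (a := a) (p := p) hf0
        have e2 : gammaTerm T κ w a p n = (I ^ (-p) * (2 * Real.pi : ℂ) ^ p) *
            (a n * verticalIntegral (I * T) p (freq κ w n : ℝ)) := by
          rw [rayValue_of_pos hT (by linarith), ← e1]
          have e3 : I ^ (-p) * I ^ p = 1 := by
            rw [← cpow_add _ _ I_ne_zero, neg_add_cancel, cpow_zero]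
          have e4 : (2 * Real.pi : ℂ) ^ p * (2 * Real.pi : ℂ) ^ (-p) = 1 := by
            rw [← cpow_add _ _ hpi, add_neg_cancel, cpow_zero]
          linear_combination -gammaTerm T κ w a p n * (I ^ (-p) * I ^ p) * e4 -
            gammaTerm T κ w a p n * e3
        rw [e2, norm_mul, norm_mul (a n)]
        have h1 := hCb p hp (freq κ w n : ℝ) (by simpa using hf)
        rw [ofReal_re] at h1
        calc _ ≤ K * (‖a n‖ * (C * Real.exp (-(2 * Real.pi * freq κ w n * T)))) := by
              gcongr
              exact hK p hp'
          _ = _ := by ring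

lemma summable_gammaTerm (h : QExp κ w a H) {T : ℝ} (hT : 0 < T) (p : ℂ) :
    Summable fun n => ‖gammaTerm T κ w a p n‖ := by
  obtain ⟨u, hu, hub⟩ := h.exists_summable_bound hT ‖p‖
  exact Summable.of_nonneg_of_le (fun n => norm_nonneg _) (hub p le_rfl) hu

lemma differentiable_tsum_gammaTerm (h : QExp κ w a H) {T : ℝ} (hT : 0 < T) :
    Differentiable ℂ fun p => ∑' n : ℤ, gammaTerm T κ w a p n := by
  intro p
  obtain ⟨u, hu, hub⟩ := h.exists_summable_bound hT (‖p‖ + 1)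
  have h1 := differentiableOn_tsum_of_summable_norm hu (U := Metric.ball p 1)
    (F := fun n p => gammaTerm T κ w a p n)
    (fun n => (differentiable_gammaTerm hT n).differentiableOn) Metric.isOpen_ball
    fun n q hq => hub q (by
      have := norm_le_norm_add_norm_sub' q p
      have h2 : ‖q - p‖ < 1 := by simpa [dist_eq_norm] using hq
      linarith) n
  exact h1.differentiableAt (Metric.ball_mem_nhds p one_pos)

lemma differentiable_gammaSum (h : QExp κ w a H) {T : ℝ} (hT : 0 < T) :
    Differentiable ℂ (gammaSum T κ w a) := by
  have hpi : (2 * Real.pi : ℂ) ≠ 0 := by exact_mod_cast Real.two_pi_pos.ne'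
  unfold gammaSum
  refine Differentiable.mul (Differentiable.mul ?_ ?_) (h.differentiable_tsum_gammaTerm hT)
  · exact fun p => differentiableAt_id.const_cpow (Or.inl I_ne_zero)
  · exact fun p => differentiableAt_id.neg.const_cpow (Or.inl hpi)

end QExp

/-! ### Regularization in β -/

/-- The function `H(τ) τ^{p-1} e^{2πiβτ}`. -/
def betaFun (H : ℂ → ℂ) (p β τ : ℂ) : ℂ := H τ * τ ^ (p - 1) * cexp (2 * Real.pi * I * β * τ)

/-- The integral of `H(τ) τ^{p-1} e^{2πiβτ}` over the horizontal ray from `z`. -/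
def betaIntegral (H : ℂ → ℂ) (p z β : ℂ) : ℂ := ∫ x in Ioi (0 : ℝ), betaFun H p β (z + x)

lemma SubExp.mul_bounded {φ h : ℝ → ℂ} (hφ : SubExp φ) (hc : ContinuousOn h (Ici 0)) {K : ℝ}
    (hK : ∀ x : ℝ, 0 ≤ x → ‖h x‖ ≤ K) : SubExp fun x => h x * φ x := by
  refine ⟨hc.mul hφ.cont, fun ε hε => ?_⟩
  obtain ⟨C, hC⟩ := hφ.bound ε hε
  refine ⟨K * C, fun x hx => ?_⟩
  have h0 := (norm_nonneg _).trans (hK x hx)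
  rw [norm_mul, mul_assoc]
  gcongr
  · exact hK x hx
  · exact hC x hx

lemma norm_horizontal_factor (β z : ℂ) (x : ℝ) :
    ‖cexp (2 * Real.pi * I * β * (z + x))‖ =
      ‖cexp (2 * Real.pi * I * β * z)‖ * Real.exp (-(2 * Real.pi * β.im * x)) := by
  rw [mul_add, Complex.exp_add, norm_mul, norm_exp (2 * Real.pi * I * β * x)]
  simp

lemma norm_exp_two_pi_le (β z : ℂ) :
    ‖cexp (2 * Real.pi * I * β * z)‖ ≤ Real.exp (2 * Real.pi * ‖β‖ * ‖z‖) := by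
  rw [norm_exp]
  gcongr
  refine (re_le_norm _).trans ?_
  simp [abs_of_pos Real.pi_pos]

lemma integrableOn_norm_cpow {T : ℝ} (hT : 0 < T) {p : ℂ} (hp : p.re < 0) :
    IntegrableOn (fun x : ℝ => ‖(I * T + x : ℂ) ^ (p - 1)‖) (Ioi 0) := by
  have hσ : p.re - 1 < -1 := by linarith
  have h1 := integrableOn_add_rpow_Ioi_of_lt (c := 0) (m := T) hσ (by linarith)
  have h2 := h1.const_mul ((2 : ℝ) ^ (-(p.re - 1)) * Real.exp (Real.pi * |p.im|))
  refine Integrable.mono' h2 ?_ ?_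
  · exact ((subExp_cpow_horizontal (mul_I_mem_upper hT) (p - 1)).cont.mono
      Ioi_subset_Ici_self).norm.aestronglyMeasurable measurableSet_Ioi
  · filter_upwards [ae_restrict_mem measurableSet_Ioi] with x hx
    have hx0 : 0 < x := hx
    have h3 := norm_cpow_le_mul_exp (I * T + x) (p - 1)
    -- The modulus dominates both coordinates, hence their mean. As the exponent is negative, this
    -- bounds the power from above by an integrable one.
    have h4 : (x + T) / 2 ≤ ‖(I * T + x : ℂ)‖ := by
      have e1 := (le_abs_self _).trans (abs_re_le_norm (I * T + x : ℂ))
      have e2 := (le_abs_self _).trans (abs_im_le_norm (I * T + x : ℂ))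
      simp at e1 e2
      linarith
    have h5 := Real.rpow_le_rpow_of_nonpos (by positivity) h4 (show p.re - 1 ≤ 0 by linarith)
    rw [Real.div_rpow (by positivity) (by positivity), div_eq_mul_inv, ← Real.rpow_neg two_pos.le] at h5
    rw [norm_norm]
    simp only [sub_re, one_re, sub_im, one_im, sub_zero] at h3
    calc _ ≤ _ := h3
      _ ≤ ((x + T) ^ (p.re - 1) * 2 ^ (-(p.re - 1))) * Real.exp (Real.pi * |p.im|) := by gcongr
      _ = _ := by ring

/-- For Re p < 0 the power is absolutely integrable on the horizontal ray and |e^{2πiβτ}| stays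
bounded for small β with Im β > 0, so dominated convergence applies. -/
lemma tendsto_integral_beta {T : ℝ} (hT : 0 < T) {p : ℂ} (hp : p.re < 0) {h : ℝ → ℂ}
    (hc : ContinuousOn h (Ici 0)) {K : ℝ} (hK : ∀ x : ℝ, 0 ≤ x → ‖h x‖ ≤ K) :
    Tendsto (fun β : ℂ => ∫ x in Ioi (0 : ℝ), h x * (I * T + x : ℂ) ^ (p - 1) *
      cexp (2 * Real.pi * I * β * (I * T + x))) (𝓝[upper] 0)
      (𝓝 (∫ x in Ioi (0 : ℝ), h x * (I * T + x : ℂ) ^ (p - 1))) := by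
  have hφ := (subExp_cpow_horizontal (mul_I_mem_upper hT) (p - 1)).mul_bounded hc hK
  refine tendsto_integral_filter_of_dominated_convergence
    (fun x => K * ‖(I * T + x : ℂ) ^ (p - 1)‖ * Real.exp (2 * Real.pi * 1 * ‖I * (T : ℂ)‖)) ?_ ?_ ?_ ?_
  · refine Eventually.of_forall fun β => ContinuousOn.aestronglyMeasurable ?_ measurableSet_Ioi
    exact (hφ.cont.mono Ioi_subset_Ici_self).mul (by fun_prop)
  · have h1 : ∀ᶠ β : ℂ in 𝓝[upper] 0, ‖β‖ < 1 :=
      nhdsWithin_le_nhds ((isOpen_lt continuous_norm continuous_const).mem_nhds (by simp))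
    filter_upwards [h1, self_mem_nhdsWithin] with β hβ hβ'
    filter_upwards [ae_restrict_mem measurableSet_Ioi] with x hx
    have hx0 : 0 < x := hx
    have hβ0 : 0 < β.im := hβ'
    have h0 := (norm_nonneg _).trans (hK x hx0.le)
    rw [norm_mul, norm_mul]
    gcongr
    · exact hK x hx0.le
    · rw [norm_horizontal_factor]
      have h2 : Real.exp (-(2 * Real.pi * β.im * x)) ≤ 1 := by
        rw [Real.exp_le_one_iff]
        have : 0 ≤ 2 * Real.pi * β.im * x := by positivity
        linarith
      calc _ ≤ Real.exp (2 * Real.pi * ‖β‖ * ‖I * (T : ℂ)‖) * 1 := by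
            gcongr
            exact norm_exp_two_pi_le _ _
        _ ≤ _ := by rw [mul_one]; gcongr
  · exact ((integrableOn_norm_cpow hT hp).const_mul K).mul_const _
  · refine Eventually.of_forall fun x => ?_
    have : Continuous fun β : ℂ => h x * (I * T + x : ℂ) ^ (p - 1) *
      cexp (2 * Real.pi * I * β * (I * T + x)) := by fun_prop
    simpa using (this.tendsto 0).mono_left (nhdsWithin_le_nhds (s := upper))

lemma integral_cpow_horizontal {T : ℝ} (hT : 0 < T) {p : ℂ} (hp : p.re < 0) :
    ∫ x in Ioi (0 : ℝ), (I * T + x : ℂ) ^ (p - 1) = -((I * T) ^ p / p) := by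
  have hp0 : p ≠ 0 := by
    rintro rfl
    simp at hp
  have hmem := fun x : ℝ => slitPlane_of_upper (add_ofReal_mem_upper (mul_I_mem_upper hT) x)
  have h1 := integral_Ioi_of_hasDerivAt_of_tendsto (a := 0) (m := 0)
    (f := fun x : ℝ => (I * T + x : ℂ) ^ p / p)
    (f' := fun x : ℝ => (I * T + x : ℂ) ^ (p - 1)) ?_ ?_ ?_ ?_
  · simpa using h1
  · have c : ContinuousAt (fun x : ℝ => I * T + (x : ℂ)) 0 := by fun_prop
    exact ((ContinuousAt.comp (f := fun x : ℝ => I * T + (x : ℂ))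
      (continuousAt_cpow_const (hmem 0)) c).div_const p).continuousWithinAt
  · intro x _
    have h2 : HasDerivAt (fun x : ℝ => I * T + (x : ℂ)) 1 x := by
      simpa using (hasDerivAt_id x).ofReal_comp.const_add (I * (T : ℂ))
    have h3 := ((hasStrictDerivAt_cpow_const (c := p) (hmem x)).hasDerivAt.comp_of_eq x h2 rfl).div_const p
    refine h3.congr_deriv ?_
    field_simp
  · have := integrableOn_norm_cpow hT hp
    refine Integrable.mono' this ?_ (Eventually.of_forall fun x => le_rfl)
    exact ((subExp_cpow_horizontal (mul_I_mem_upper hT) (p - 1)).cont.mono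
      Ioi_subset_Ici_self).aestronglyMeasurable measurableSet_Ioi
  · rw [← zero_div p]
    refine Tendsto.div_const ?_ p
    have h4 : Tendsto (fun x : ℝ => x ^ p.re * Real.exp (Real.pi * |p.im|)) atTop (𝓝 0) := by
      have := (tendsto_rpow_neg_atTop (y := -p.re) (by linarith)).mul_const
        (Real.exp (Real.pi * |p.im|))
      simpa using this
    refine squeeze_zero_norm' ?_ h4
    filter_upwards [eventually_gt_atTop 0] with x hx
    refine (norm_cpow_le_mul_exp _ p).trans ?_
    refine mul_le_mul_of_nonneg_right (Real.rpow_le_rpow_of_nonpos hx ?_ hp.le) (Real.exp_pos _).le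
    have e1 := (le_abs_self _).trans (abs_re_le_norm (I * T + x : ℂ))
    simpa using e1

lemma tendsto_horizontalIntegral_zero {T : ℝ} (hT : 0 < T) {p : ℂ} (hp : p.re < 0) :
    Tendsto (horizontalIntegral (I * T) p) (𝓝[upper] 0) (𝓝 (-((I * T) ^ p / p))) := by
  have := tendsto_integral_beta hT hp (h := fun _ => 1) (K := 1) continuousOn_const (by simp)
  simp only [one_mul, integral_cpow_horizontal hT hp] at this
  refine this.congr fun β => ?_
  rw [horizontalIntegral]
  simp_rw [mul_comm]

namespace QExp

variable {κ : ℝ} {w : ℕ} {a : ℤ → ℂ} {H : ℂ → ℂ}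

lemma continuousOn_horizontal (h : QExp κ w a H) {z : ℂ} (hz : z ∈ upper) :
    ContinuousOn (fun x : ℝ => H (z + x)) (Ici 0) :=
  h.differentiableOn.continuousOn.comp (by fun_prop) fun x _ => add_ofReal_mem_upper hz x

lemma exists_bound_horizontal (h : QExp κ w a H) {z : ℂ} (hz : z ∈ upper) :
    ∃ K : ℝ, ∀ x : ℝ, ‖H (z + x)‖ ≤ K := by
  obtain ⟨C, B, _, _, hb⟩ := h.exists_bound (show 0 < z.im from hz)
  exact ⟨C * Real.exp (B * z.im), fun x => by simpa using hb (z + x) (by simp)⟩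

lemma differentiableOn_betaFun (h : QExp κ w a H) (p β : ℂ) :
    DifferentiableOn ℂ (betaFun H p β) upper := by
  refine (h.differentiableOn.mul fun τ hτ => ?_).mul (by fun_prop)
  exact (differentiableAt_id.cpow_const (slitPlane_of_upper hτ)).differentiableWithinAt

lemma subExp_horizontal (h : QExp κ w a H) {z : ℂ} (hz : z ∈ upper) (q : ℂ) :
    SubExp fun x : ℝ => H (z + x) * (z + x) ^ q := by
  obtain ⟨K, hK⟩ := h.exists_bound_horizontal hz
  exact (subExp_cpow_horizontal hz q).mul_bounded (h.continuousOn_horizontal hz) fun x _ => hK x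

lemma betaFun_horizontal (H : ℂ → ℂ) (p z β : ℂ) (x : ℝ) :
    betaFun H p β (z + x) = cexp (2 * Real.pi * I * β * z) *
      (H (z + x) * (z + x) ^ (p - 1) * cexp (-(-(2 * Real.pi * I * β)) * x)) := by
  rw [betaFun, mul_add, Complex.exp_add]
  ring_nf

lemma integrableOn_betaFun (h : QExp κ w a H) {z : ℂ} (hz : z ∈ upper) (p : ℂ) {β : ℂ}
    (hβ : β ∈ upper) : IntegrableOn (fun x : ℝ => betaFun H p β (z + x)) (Ioi 0) := by
  have : 0 < β.im := hβ
  simp_rw [betaFun_horizontal]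
  exact ((h.subExp_horizontal hz _).integrableOn
    (by rw [re_neg_two_pi_I_mul]; positivity)).const_mul _

lemma differentiableOn_betaIntegral (h : QExp κ w a H) {z : ℂ} (hz : z ∈ upper) (p : ℂ) :
    DifferentiableOn ℂ (betaIntegral H p z) upper := by
  intro β hβ
  have hβ' : 0 < β.im := hβ
  have h2 := (h.subExp_horizontal hz (p - 1)).hasDerivAt_laplace
    (μ := -(2 * Real.pi * I * β)) (by rw [re_neg_two_pi_I_mul]; positivity)
  have h3 : DifferentiableAt ℂ (fun β : ℂ => -(2 * Real.pi * I * β)) β := by fun_prop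
  have h4 := DifferentiableAt.comp (f := fun β : ℂ => -(2 * Real.pi * I * β)) β
    h2.differentiableAt h3
  have h5 : betaIntegral H p z = fun β => cexp (2 * Real.pi * I * β * z) *
      ∫ x in Ioi (0 : ℝ), H (z + x) * (z + x) ^ (p - 1) *
        cexp (-(-(2 * Real.pi * I * β)) * x) := by
    funext β
    simp_rw [betaIntegral, betaFun_horizontal, integral_const_mul]
  rw [h5]
  exact (DifferentiableAt.mul (by fun_prop) h4).differentiableWithinAt

/-- H grows at most like e^{By} upwards and stays bounded sideways. B does not depend on ε or β, so
one half-plane of β serves for the vertical integral. -/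
lemma exists_betaFun_bound (h : QExp κ w a H) {z : ℂ} (hz : z ∈ upper) (p : ℂ) :
    ∃ B : ℝ, 0 ≤ B ∧ ∀ ε : ℝ, 0 < ε → ∃ C : ℝ, ∀ β : ℂ, ∀ x y : ℝ, 0 ≤ x → 0 ≤ y →
      ‖betaFun H p β (z + x + y * I)‖ ≤ C * ‖cexp (2 * Real.pi * I * β * z)‖ *
        Real.exp (B * y + ε * (x + y) - 2 * Real.pi * (β.im * x + β.re * y)) := by
  have hz' : 0 < z.im := hz
  obtain ⟨C, B, hC, hB, hb⟩ := h.exists_bound hz'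
  refine ⟨B, hB, fun ε hε => ?_⟩
  obtain ⟨C', hC', hb'⟩ := exists_cpow_growth (p - 1) hz' hε
  refine ⟨C * Real.exp (B * z.im) * (C' * Real.exp (ε * ‖z‖)), fun β x y hx hy => ?_⟩
  have him : (z + x + y * I).im = z.im + y := by simp
  have h1 := hb (z + x + y * I) (by rw [him]; linarith)
  have h2 := hb' (z + x + y * I) (by rw [him]; linarith)
  have h3 : ‖z + x + y * I‖ ≤ ‖z‖ + x + y := by
    refine (norm_add₃_le).trans ?_
    simp [abs_of_nonneg hx, abs_of_nonneg hy]
  have h4 : ‖cexp (2 * Real.pi * I * β * (z + x + y * I))‖ =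
      ‖cexp (2 * Real.pi * I * β * z)‖ * Real.exp (-(2 * Real.pi * (β.im * x + β.re * y))) := by
    rw [show 2 * Real.pi * I * β * (z + x + y * I) = 2 * Real.pi * I * β * z +
      2 * Real.pi * I * β * (x + y * I) by ring, Complex.exp_add, norm_mul,
      norm_exp (2 * Real.pi * I * β * (x + y * I))]
    congr 2
    simp
    ring
  rw [him] at h1
  rw [betaFun, norm_mul, norm_mul, h4]
  calc _ ≤ (C * Real.exp (B * (z.im + y))) * (C' * Real.exp (ε * (‖z‖ + x + y))) *
        (‖cexp (2 * Real.pi * I * β * z)‖ *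
          Real.exp (-(2 * Real.pi * (β.im * x + β.re * y)))) := by
        gcongr
        exact h2.trans (by gcongr)
    _ = _ := by
        rw [mul_add B, Real.exp_add, show ε * (‖z‖ + x + y) = ε * ‖z‖ + ε * (x + y) by ring,
          Real.exp_add, sub_eq_add_neg, Real.exp_add, Real.exp_add]
        ring

lemma continuousOn_betaFun_vertical (h : QExp κ w a H) {z : ℂ} (hz : z ∈ upper) (p β : ℂ) :
    ContinuousOn (fun t : ℝ => betaFun H p β (z + t * I) * I) (Ici 0) :=
  ((h.differentiableOn_betaFun p β).continuousOn.comp (by fun_prop)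
    fun _ ht => add_ofReal_mul_I_mem_upper hz ht).mul continuousOn_const

/-- For `Re β` large the integral over the vertical ray converges, and it agrees with the integral
over the horizontal ray. -/
lemma exists_vertical (h : QExp κ w a H) {z : ℂ} (hz : z ∈ upper) (p : ℂ) :
    ∃ B : ℝ, ∀ β : ℂ, B < β.re →
      IntegrableOn (fun t : ℝ => betaFun H p β (z + t * I) * I) (Ioi 0) ∧
      (β ∈ upper → betaIntegral H p z β =
        ∫ t in Ioi (0 : ℝ), betaFun H p β (z + t * I) * I) := by
  obtain ⟨B, hB, hb⟩ := h.exists_betaFun_bound hz p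
  refine ⟨(B + 1) / (2 * Real.pi), fun β hβ => ?_⟩
  rw [div_lt_iff₀ Real.two_pi_pos] at hβ
  have hint : IntegrableOn (fun t : ℝ => betaFun H p β (z + t * I) * I) (Ioi 0) := by
    obtain ⟨C, hC⟩ := hb (1 / 2) one_half_pos
    refine integrableOn_of_exp_bound (h.continuousOn_betaFun_vertical hz p β)
      (C := C * ‖cexp (2 * Real.pi * I * β * z)‖) one_half_pos fun t ht => ?_
    have h1 := hC β 0 t le_rfl ht
    have h0 : 0 ≤ C * ‖cexp (2 * Real.pi * I * β * z)‖ := by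
      have := (norm_nonneg _).trans (hC β 0 0 le_rfl le_rfl)
      exact nonneg_of_mul_nonneg_left this (Real.exp_pos _)
    rw [ofReal_zero, add_zero] at h1
    rw [norm_mul, norm_I, mul_one]
    refine h1.trans ?_
    gcongr
    nlinarith
  refine ⟨hint, fun hβu => ?_⟩
  have hβ0 : 0 < β.im := hβu
  set ε := min (2 * Real.pi * β.im) 1 / 2 with hε
  have hε1 : 2 * ε ≤ 1 := by
    have := min_le_right (2 * Real.pi * β.im) 1
    linarith
  have hε2 : 2 * ε ≤ 2 * Real.pi * β.im := by
    have := min_le_left (2 * Real.pi * β.im) 1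
    linarith
  have hε0 : 0 < ε := by positivity
  obtain ⟨C, hC⟩ := hb ε hε0
  refine integral_horizontal_eq_vertical (h.differentiableOn_betaFun p β) hz
    (C := C * ‖cexp (2 * Real.pi * I * β * z)‖) hε0 (h.integrableOn_betaFun hz p hβu) hint
    fun x y hx hy => (hC β x y hx hy).trans ?_
  have h0 : 0 ≤ C * ‖cexp (2 * Real.pi * I * β * z)‖ := by
    have := (norm_nonneg _).trans (hC β 0 0 le_rfl le_rfl)
    exact nonneg_of_mul_nonneg_left this (Real.exp_pos _)
  gcongr
  nlinarith

/-- Both rays run to the right, and the segment closing them far out is a translate of the segment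
between the base points. On it H is bounded and e^{2πiβτ} decays, because Im β > 0. -/
lemma betaIntegral_eq_seg_add (h : QExp κ w a H) {z z' : ℂ} (hz : z ∈ upper) (hz' : z' ∈ upper)
    (p : ℂ) {β : ℂ} (hβ : β ∈ upper) :
    betaIntegral H p z β = seg (betaFun H p β) z z' + betaIntegral H p z' β := by
  have hβ0 : 0 < β.im := hβ
  have hcomp : IsCompact (segment ℝ z z') := by
    rw [segment_eq_image]
    exact isCompact_Icc.image (by fun_prop)
  have hsub : segment ℝ z z' ⊆ upper := convex_upper.segment_subset hz hz'
  obtain ⟨m, hm, hmin⟩ := hcomp.exists_isMinOn ⟨z, left_mem_segment ℝ z z'⟩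
    Complex.continuous_im.continuousOn
  have hy₀ : 0 < m.im := hsub hm
  obtain ⟨C, B, hC, hB, hb⟩ := h.exists_bound hy₀
  obtain ⟨C', hC', hb'⟩ := exists_cpow_growth (p - 1) hy₀ (show 0 < Real.pi * β.im by positivity)
  have hcont : Continuous fun τ : ℂ => Real.exp (B * τ.im) * Real.exp (Real.pi * β.im * ‖τ‖) *
      ‖cexp (2 * Real.pi * I * β * τ)‖ := by fun_prop
  obtain ⟨K, hK⟩ := hcomp.exists_bound_of_continuousOn hcont.continuousOn
  refine integral_horizontal_sub (B := fun R => C * C' * K * Real.exp (-(Real.pi * β.im) * R))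
    (h.differentiableOn_betaFun p β) hz hz' (h.integrableOn_betaFun hz p hβ)
    (h.integrableOn_betaFun hz' p hβ) ?_ ?_
  · have : Tendsto (fun x : ℝ => -(Real.pi * β.im) * x) atTop atBot :=
      tendsto_id.const_mul_atTop_of_neg (neg_lt_zero.2 (by positivity))
    simpa using (Real.tendsto_exp_atBot.comp this).const_mul (C * C' * K)
  · filter_upwards [eventually_ge_atTop 0] with R hR τ hτ
    have him : m.im ≤ (τ + R).im := by simpa using hmin hτ
    have h1 := hb _ him
    have h2 := hb' _ him
    have h3 : ‖τ + R‖ ≤ ‖τ‖ + R := (norm_add_le _ _).trans (by simp [abs_of_nonneg hR])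
    have h4 := (le_abs_self _).trans (hK τ hτ)
    have h5 : (τ + R).im = τ.im := by simp
    rw [betaFun, norm_mul, norm_mul, norm_horizontal_factor]
    rw [h5] at h1
    calc _ ≤ (C * Real.exp (B * τ.im)) * (C' * Real.exp (Real.pi * β.im * (‖τ‖ + R))) *
          (‖cexp (2 * Real.pi * I * β * τ)‖ * Real.exp (-(2 * Real.pi * β.im * R))) := by
          gcongr
          exact h2.trans (by gcongr)
      _ = C * C' * (Real.exp (B * τ.im) * Real.exp (Real.pi * β.im * ‖τ‖) *
          ‖cexp (2 * Real.pi * I * β * τ)‖) *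
          (Real.exp (Real.pi * β.im * R) * Real.exp (-(2 * Real.pi * β.im * R))) := by
          rw [mul_add, Real.exp_add]
          ring
      _ ≤ C * C' * K * (Real.exp (Real.pi * β.im * R) * Real.exp (-(2 * Real.pi * β.im * R))) := by
          gcongr
      _ = _ := by
          rw [← Real.exp_add]
          ring_nf

/-- A Fourier term has constant modulus on the horizontal ray. The L¹ norm of the n-th integrand is
thus its size at iT times an integral independent of n, and these norms are summable. -/
lemma hasSum_betaIntegral (h : QExp κ w a H) {T : ℝ} (hT : 0 < T) (p : ℂ) {β : ℂ}
    (hβ : β ∈ upper) :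
    HasSum (fun n => a n * horizontalIntegral (I * T) p ((freq κ w n : ℝ) + β))
      (betaIntegral H p (I * T) β) := by
  have hz := mul_I_mem_upper hT
  have hmem : ∀ n, ((freq κ w n : ℝ) : ℂ) + β ∈ upper := by
    intro n
    simpa [upper] using hβ
  have hsplit : ∀ (n : ℤ) (x : ℝ), a n * (cexp (2 * Real.pi * I * ((freq κ w n : ℝ) + β) *
      (I * T + x)) * (I * T + x) ^ (p - 1)) =
      (a n * cexp (2 * Real.pi * I * (freq κ w n : ℝ) * (I * T + x))) *
      (cexp (2 * Real.pi * I * β * (I * T + x)) * (I * T + x) ^ (p - 1)) := by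
    intro n x
    rw [show 2 * Real.pi * I * ((freq κ w n : ℝ) + β) * (I * T + x) =
      2 * Real.pi * I * (freq κ w n : ℝ) * (I * T + x) +
      2 * Real.pi * I * β * (I * T + x) by ring, Complex.exp_add]
    ring
  have h1 := hasSum_integral_of_summable_integral_norm (μ := volume.restrict (Ioi (0 : ℝ)))
    (F := fun (n : ℤ) (x : ℝ) => a n * (cexp (2 * Real.pi * I * ((freq κ w n : ℝ) + β) *
      (I * T + x)) * (I * T + x) ^ (p - 1)))
    (fun n => (integrableOn_horizontal hz p (hmem n)).const_mul _) ?_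
  · simp_rw [integral_const_mul] at h1
    have e : betaIntegral H p (I * T) β = ∫ x in Ioi (0 : ℝ), ∑' n : ℤ,
        a n * (cexp (2 * Real.pi * I * ((freq κ w n : ℝ) + β) *
          (I * T + x)) * (I * T + x) ^ (p - 1)) := by
      refine integral_congr_ae (Eventually.of_forall fun x => ?_)
      have h2 := h.expansion _ (add_ofReal_mem_upper hz x)
      simp only [hsplit]
      rw [(h2.mul_right _).tsum_eq, betaFun]
      ring
    rw [e]
    exact h1
  · have h3 : ∀ n : ℤ, ∫ x in Ioi (0 : ℝ), ‖a n * (cexp (2 * Real.pi * I *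
        ((freq κ w n : ℝ) + β) * (I * T + x)) * (I * T + x) ^ (p - 1))‖ =
        (‖a n‖ * Real.exp (-(2 * Real.pi * freq κ w n * T))) * ∫ x in Ioi (0 : ℝ),
          ‖cexp (2 * Real.pi * I * β * (I * T + x)) * (I * T + x) ^ (p - 1)‖ := by
      intro n
      rw [← integral_const_mul]
      refine integral_congr_ae (Eventually.of_forall fun x => ?_)
      simp only
      rw [hsplit, norm_mul, norm_term]
      simp
    simp_rw [h3]
    exact (h.summable_norm hT).mul_right _

lemma hasSum_regValue (h : QExp κ w a H) {T : ℝ} (hT : 0 < T) (p : ℂ) :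
    HasSum (fun n => I ^ p * (2 * Real.pi : ℂ) ^ (-p) * gammaTerm T κ w a p n +
      if freq κ w n = 0 then a n * -((I * T) ^ p / p) else 0) (regValue T κ w a p) := by
  have h1 := ((h.summable_gammaTerm hT p).of_norm.hasSum).mul_left
    (I ^ p * (2 * Real.pi : ℂ) ^ (-p))
  have h2 : ∀ n : ℤ, (if freq κ w n = 0 then a n * -((I * T) ^ p / p) else 0) =
      if n = 0 then constTerm κ a * -((I * T) ^ p / p) else 0 := by
    intro n
    simp only [h.freq_eq_zero_iff, constTerm]
    by_cases hn : n = 0 <;> by_cases hκ : κ = 0 <;> simp [hn, hκ]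
  simp_rw [h2]
  have h3 := h1.add (hasSum_ite_eq (0 : ℤ) (constTerm κ a * -((I * T) ^ p / p)))
  have e : regValue T κ w a p = I ^ p * (2 * Real.pi : ℂ) ^ (-p) *
      (∑' n : ℤ, gammaTerm T κ w a p n) + constTerm κ a * -((I * T) ^ p / p) := by
    rw [regValue, gammaSum]
    ring
  rw [e]
  exact h3

/-- Dominated convergence for the sum over n. Frequencies at least 1 are controlled by the vertical
integral; the finitely many others converge individually and are bounded by their limit plus one.
The hypothesis on p concerns only the term of frequency zero. -/
lemma tendsto_betaIntegral_base (h : QExp κ w a H) {T : ℝ} (hT : 0 < T) {p : ℂ}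
    (hp : p.re < 0 ∨ constTerm κ a = 0) :
    Tendsto (betaIntegral H p (I * T)) (𝓝[upper] 0) (𝓝 (regValue T κ w a p)) := by
  obtain ⟨C, hC, hCb⟩ := exists_norm_verticalIntegral_le hT one_half_pos ‖p‖
  rw [← (h.hasSum_regValue hT p).tsum_eq]
  set S := {n : ℤ | a n ≠ 0 ∧ freq κ w n < 1} with hS
  have hSf : S.Finite := h.finite_small 1
  set G : ℤ → ℂ := fun n => I ^ p * (2 * Real.pi : ℂ) ^ (-p) * gammaTerm T κ w a p n +
      if freq κ w n = 0 then a n * -((I * T) ^ p / p) else 0 with hG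
  have hlim : ∀ n : ℤ, Tendsto (fun β => a n * horizontalIntegral (I * T) p ((freq κ w n : ℝ) + β))
      (𝓝[upper] 0) (𝓝 (G n)) := by
    intro n
    have hadd : Tendsto (fun β : ℂ => ((freq κ w n : ℝ) : ℂ) + β) (𝓝[upper] 0)
        (𝓝[upper] ((freq κ w n : ℝ) : ℂ)) := by
      refine tendsto_nhdsWithin_iff.2 ⟨?_, ?_⟩
      · have : Continuous fun β : ℂ => ((freq κ w n : ℝ) : ℂ) + β := by fun_prop
        simpa using (this.tendsto 0).mono_left (nhdsWithin_le_nhds (s := upper))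
      · filter_upwards [self_mem_nhdsWithin] with β hβ
        simpa [upper] using hβ
    by_cases hn : freq κ w n = 0
    · have hg : G n = a n * -((I * T) ^ p / p) := by simp [hG, hn, gammaTerm]
      rw [hg]
      rcases hp with hp | hp
      · have := (tendsto_horizontalIntegral_zero hT hp).const_mul (a n)
        simpa [hn] using this
      · obtain ⟨rfl, hκ⟩ := h.freq_eq_zero_iff.1 hn
        have ha : a 0 = 0 := by simpa [constTerm, hκ] using hp
        rw [ha]
        simp only [zero_mul]
        exact tendsto_const_nhds
    · have hg : G n = a n * rayValue T p (freq κ w n) := by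
        rw [← gammaTerm_eq_rayValue hn]
        simp [hG, hn]
      rw [hg]
      exact ((tendsto_horizontalIntegral hT hn p).comp hadd).const_mul (a n)
  have htan := tendsto_tsum_of_dominated_convergence (𝓕 := 𝓝[upper] (0 : ℂ))
    (f := fun β n => a n * horizontalIntegral (I * T) p ((freq κ w n : ℝ) + β)) (g := G)
    (bound := fun n => C * Real.exp (Real.pi * T) *
      (‖a n‖ * Real.exp (-(2 * Real.pi * freq κ w n * T))) + S.indicator (fun n => ‖G n‖ + 1) n)
    ?_ hlim ?_
  · refine htan.congr' ?_
    filter_upwards [self_mem_nhdsWithin] with β hβ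
    exact (h.hasSum_betaIntegral hT p hβ).tsum_eq
  · exact ((h.summable_norm hT).mul_left _).add
      (summable_of_hasFiniteSupport (hSf.subset support_indicator_subset))
  · have h1 : ∀ᶠ β : ℂ in 𝓝[upper] 0, ∀ n ∈ S,
        ‖a n * horizontalIntegral (I * T) p ((freq κ w n : ℝ) + β)‖ < ‖G n‖ + 1 :=
      (eventually_all_finite hSf).2 fun n _ =>
        (hlim n).norm.eventually (eventually_lt_nhds (by linarith))
    -- Frequencies at least 1 keep real part at least 1/2 after adding β, and the shift costs a
    -- factor e^{πT} at most.
    have h2 : ∀ᶠ β : ℂ in 𝓝[upper] 0, ‖β‖ < 1 / 2 :=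
      nhdsWithin_le_nhds ((isOpen_lt continuous_norm continuous_const).mem_nhds (by simp))
    filter_upwards [h1, h2, self_mem_nhdsWithin] with β hβ1 hβ2 hβ n
    by_cases hn : n ∈ S
    · rw [indicator_of_mem hn]
      exact le_add_of_nonneg_of_le (by positivity) (hβ1 n hn).le
    · rw [indicator_of_notMem hn, add_zero]
      by_cases han : a n = 0
      · simp [han]
      · have hf : 1 ≤ freq κ w n := by
          by_contra hlt
          exact hn ⟨han, not_le.1 hlt⟩
        have hre := (abs_le.1 ((abs_re_le_norm β).trans hβ2.le)).1
        have hre' : (((freq κ w n : ℝ) : ℂ) + β).re = freq κ w n + β.re := by simp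
        have hmem : ((freq κ w n : ℝ) : ℂ) + β ∈ upper := by simpa [upper] using hβ
        rw [norm_mul, horizontalIntegral_eq_vertical (mul_I_mem_upper hT) p hmem
          (by rw [hre']; linarith)]
        have h3 := hCb p le_rfl (((freq κ w n : ℝ) : ℂ) + β) (by rw [hre']; linarith)
        rw [hre'] at h3
        calc _ ≤ ‖a n‖ * (C * (Real.exp (Real.pi * T) *
              Real.exp (-(2 * Real.pi * freq κ w n * T)))) := by
              gcongr
              refine h3.trans ?_
              rw [← Real.exp_add]
              gcongr
              have : 0 ≤ Real.pi * T := by positivity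
              nlinarith
          _ = _ := by ring

lemma tendsto_betaIntegral (h : QExp κ w a H) {T : ℝ} (hT : 0 < T) {p z : ℂ} (hz : z ∈ upper)
    (hp : p.re < 0 ∨ constTerm κ a = 0) :
    Tendsto (betaIntegral H p z) (𝓝[upper] 0)
      (𝓝 (seg (betaFun H p 0) z (I * T) + regValue T κ w a p)) := by
  have hb := mul_I_mem_upper hT
  have h1 : Continuous fun β => seg (betaFun H p β) z (I * T) := by
    have hu : ContinuousOn (fun t : ℝ => z + t * (I * T - z)) (uIcc 0 1) := by fun_prop
    have hmem : MapsTo (fun t : ℝ => z + t * (I * T - z)) (uIcc 0 1) upper := by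
      intro t ht
      rw [uIcc_of_le zero_le_one] at ht
      exact segment_mem_upper hz hb ht
    have hv : ContinuousOn (fun t : ℝ => betaFun H p 0 (z + t * (I * T - z)) * (I * T - z))
        (uIcc 0 1) := ((h.differentiableOn_betaFun p 0).continuousOn.comp hu hmem).mul
          continuousOn_const
    have h2 := (differentiable_integral_mul_exp
      (u := fun t : ℝ => 2 * Real.pi * I * (z + t * (I * T - z))) (by fun_prop) hv).continuous
    refine h2.congr fun β => intervalIntegral.integral_congr fun t _ => ?_
    simp only [betaFun, mul_zero, zero_mul, Complex.exp_zero, mul_one]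
    rw [show β * (2 * Real.pi * I * (z + t * (I * T - z))) =
      2 * Real.pi * I * β * (z + t * (I * T - z)) by ring]
    ring
  have h2 := ((h1.tendsto 0).mono_left (nhdsWithin_le_nhds (s := upper))).add
    (h.tendsto_betaIntegral_base hT hp)
  refine h2.congr' ?_
  filter_upwards [self_mem_nhdsWithin] with β hβ
  exact (h.betaIntegral_eq_seg_add hz hb p hβ).symm

instance neBot_upper : (𝓝[upper] (0 : ℂ)).NeBot := by
  rw [← mem_closure_iff_nhdsWithin_neBot]
  refine mem_closure_of_tendsto (b := 𝓝[>] (0 : ℝ)) (f := fun t : ℝ => (t : ℂ) * I) ?_ ?_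
  · have : Continuous fun t : ℝ => (t : ℂ) * I := by fun_prop
    simpa using (this.tendsto 0).mono_left (nhdsWithin_le_nhds (s := Ioi 0))
  · filter_upwards [self_mem_nhdsWithin] with t ht
    simpa [upper] using ht

/-- The same limit is computed term by term and under the integral sign. The resulting formula
involves H alone, so `regValue` does not see which expansion was used. -/
lemma regValue_eq_integral (h : QExp κ w a H) {T : ℝ} (hT : 0 < T) {p : ℂ} (hp : p.re < 0) :
    regValue T κ w a p = ∫ x in Ioi (0 : ℝ), H (I * T + x) * (I * T + x) ^ (p - 1) := by
  obtain ⟨K, hK⟩ := h.exists_bound_horizontal (mul_I_mem_upper hT)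
  exact tendsto_nhds_unique (h.tendsto_betaIntegral_base hT (Or.inl hp))
    (tendsto_integral_beta hT hp (h.continuousOn_horizontal (mul_I_mem_upper hT)) fun x _ => hK x)

lemma regValue_shift_of_re_neg (h : QExp κ w a H) {T T' : ℝ} (hT : 0 < T) (hT' : 0 < T') {p : ℂ}
    (hp : p.re < 0) :
    regValue T κ w a p = seg (betaFun H p 0) (I * T) (I * T') + regValue T' κ w a p :=
  tendsto_nhds_unique (h.tendsto_betaIntegral_base hT (Or.inl hp))
    (h.tendsto_betaIntegral hT' (mul_I_mem_upper hT) (Or.inl hp))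

end QExp

/-! ### Continuation in the exponent: scaling and change of base point -/

lemma eq_of_eq_of_re_neg {f g : ℂ → ℂ} (hf : Differentiable ℂ f) (hg : Differentiable ℂ g)
    (h : ∀ p : ℂ, p.re < 0 → f p = g p) : f = g := by
  have ha : ∀ {f : ℂ → ℂ}, Differentiable ℂ f → AnalyticOnNhd ℂ f univ := fun hf z _ =>
    hf.analyticAt z
  refine (ha hf).eq_of_eventuallyEq (ha hg) (z₀ := -1) ?_
  filter_upwards [(isOpen_lt Complex.continuous_re continuous_const).mem_nhds
    (show (-1 : ℂ).re < 0 by simp)] with p hp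
  exact h p hp

lemma differentiable_seg {H : ℂ → ℂ} (hH : ContinuousOn H upper) {z z' : ℂ} (hz : z ∈ upper)
    (hz' : z' ∈ upper) : Differentiable ℂ fun p => seg (betaFun H p 0) z z' := by
  have hu : ContinuousOn (fun t : ℝ => z + t * (z' - z)) (uIcc 0 1) := by fun_prop
  have hmem : MapsTo (fun t : ℝ => z + t * (z' - z)) (uIcc 0 1) upper := by
    intro t ht
    rw [uIcc_of_le zero_le_one] at ht
    exact segment_mem_upper hz hz' ht
  have hl : ContinuousOn log upper := fun τ hτ =>
    (continuousAt_clog (slitPlane_of_upper hτ)).continuousWithinAt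
  have hv : ContinuousOn (fun t : ℝ => H (z + t * (z' - z)) * (z + t * (z' - z))⁻¹ * (z' - z))
      (uIcc 0 1) := ((hH.comp hu hmem).mul (hu.inv₀ fun t ht => ne_zero_of_upper (hmem ht))).mul
        continuousOn_const
  have h2 := differentiable_integral_mul_exp (hl.comp hu hmem) hv
  refine fun p' => (h2 p').congr_of_eventuallyEq (Eventually.of_forall fun p => ?_)
  refine intervalIntegral.integral_congr fun t ht => ?_
  have hne := ne_zero_of_upper (hmem ht)
  simp only [betaFun, mul_zero, zero_mul, Complex.exp_zero, mul_one, Function.comp_apply]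
  rw [cpow_sub _ _ hne, cpow_one, cpow_def_of_ne_zero hne, mul_comm p]
  ring

namespace QExp

variable {κ κ' : ℝ} {w w' : ℕ} {a a' : ℤ → ℂ} {H H' : ℂ → ℂ}

/-- The entire function `p ↦ p · regValue p`. -/
lemma differentiable_mul_regValue (h : QExp κ w a H) {T : ℝ} (hT : 0 < T) :
    Differentiable ℂ fun p => p * gammaSum T κ w a p - constTerm κ a * (I * T) ^ p := by
  have hc : (I * T : ℂ) ≠ 0 := ne_zero_of_upper (mul_I_mem_upper hT)
  refine (differentiable_id.mul (h.differentiable_gammaSum hT)).sub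
    ((differentiable_const _).mul fun p => differentiableAt_id.const_cpow (Or.inl hc))

lemma mul_regValue {T : ℝ} {p : ℂ} (hp : p ≠ 0) :
    p * regValue T κ w a p = p * gammaSum T κ w a p - constTerm κ a * (I * T) ^ p := by
  rw [regValue]
  field_simp

lemma ne_zero_of_re_neg {p : ℂ} (hp : p.re < 0) : p ≠ 0 := by
  rintro rfl
  simp at hp

/-- For Re p < 0 both sides are integrals of proportional functions, and multiplication by p makes
them entire. Evaluation at p = 0 isolates the constant terms; the gamma sums then agree for p ≠ 0,
and at p = 0 by continuity. -/
lemma scaling (h : QExp κ w a H) (h' : QExp κ' w' a' H') {C : ℂ}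
    (hH : ∀ τ ∈ upper, H' τ = C * H τ) {T : ℝ} (hT : 0 < T) :
    constTerm κ' a' = C * constTerm κ a ∧
      ∀ p, gammaSum T κ' w' a' p = C * gammaSum T κ w a p := by
  have key := eq_of_eq_of_re_neg (h'.differentiable_mul_regValue hT)
    ((h.differentiable_mul_regValue hT).const_mul C) fun p hp => by
      have hp0 := ne_zero_of_re_neg hp
      rw [← mul_regValue hp0, ← mul_regValue hp0, h.regValue_eq_integral hT hp,
        h'.regValue_eq_integral hT hp, mul_left_comm, ← integral_const_mul C]
      refine congrArg (p * ·) (setIntegral_congr_fun measurableSet_Ioi fun x _ => ?_)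
      rw [hH _ (add_ofReal_mem_upper (mul_I_mem_upper hT) x), mul_assoc]
  have h0 : constTerm κ' a' = C * constTerm κ a := by
    have := congrFun key 0
    simp only [zero_mul, cpow_zero, mul_one, zero_sub] at this
    linear_combination -this
  refine ⟨h0, fun p => ?_⟩
  refine congrFun (Continuous.ext_on (dense_compl_singleton (0 : ℂ))
    (h'.differentiable_gammaSum hT).continuous
    ((h.differentiable_gammaSum hT).const_mul C).continuous fun p hp => ?_) p
  have := congrFun key p
  simp only [h0] at this
  have hp0 : p ≠ 0 := hp
  exact mul_left_cancel₀ hp0 (by linear_combination this)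

lemma regValue_scaling (h : QExp κ w a H) (h' : QExp κ' w' a' H') {C : ℂ}
    (hH : ∀ τ ∈ upper, H' τ = C * H τ) {T : ℝ} (hT : 0 < T) (p : ℂ) :
    regValue T κ' w' a' p = C * regValue T κ w a p := by
  obtain ⟨h0, h1⟩ := h.scaling h' hH hT
  rw [regValue, regValue, h0, h1]
  ring

/-- The relation for Re p < 0 continues to all p after multiplication by p. It is divided back at
the end, which excludes the possible pole p = 0. -/
lemma regValue_shift (h : QExp κ w a H) {T T' : ℝ} (hT : 0 < T) (hT' : 0 < T') {p : ℂ}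
    (hp : p ≠ 0) :
    regValue T κ w a p = seg (betaFun H p 0) (I * T) (I * T') + regValue T' κ w a p := by
  have key := eq_of_eq_of_re_neg (h.differentiable_mul_regValue hT)
    ((differentiable_id.mul (differentiable_seg h.differentiableOn.continuousOn
      (mul_I_mem_upper hT) (mul_I_mem_upper hT'))).add (h.differentiable_mul_regValue hT'))
    fun p hp => by
      have hp0 := ne_zero_of_re_neg hp
      simp only [Pi.add_apply, Pi.mul_apply, id]
      rw [← mul_regValue hp0, ← mul_regValue hp0, h.regValue_shift_of_re_neg hT hT' hp]
      ring
  have := congrFun key p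
  simp only [Pi.add_apply, Pi.mul_apply, id] at this
  rw [← mul_regValue hp, ← mul_regValue hp] at this
  exact mul_left_cancel₀ hp (by linear_combination this)

end QExp

/-! ### Existence and uniqueness of the regularized values -/

lemma vert_coe (z : ℍ) {t : ℝ} (ht : 0 ≤ t) : ((vert z t : ℍ) : ℂ) = (z : ℂ) + t * I := by
  rw [vert, ofComplex_apply_of_im_pos]
  exact add_ofReal_mul_I_mem_upper z.im_pos ht

/-- The real translation by x₀ only introduces the factor e^{2πiβx₀}, which tends to 1. -/
lemma QExp.isBetaValue {κ : ℝ} {w : ℕ} {a : ℤ → ℂ} {H : ℂ → ℂ} (h : QExp κ w a H) {T : ℝ}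
    (hT : 0 < T) {p : ℂ} (hp : p.re < 0 ∨ constTerm κ a = 0) {f : ℍ → ℂ} {C : ℂ} {x₀ : ℝ}
    (hf : ∀ τ : ℍ, f τ = C * (H (τ - x₀) * ((τ : ℂ) - x₀) ^ (p - 1))) (z : ℍ) :
    IsBetaValue f z (C * (seg (betaFun H p 0) (z - x₀) (I * T) + regValue T κ w a p)) := by
  have hz : (z : ℂ) - x₀ ∈ upper := by
    have := add_ofReal_mem_upper (show (z : ℂ) ∈ upper from z.im_pos) (-x₀)
    simpa [sub_eq_add_neg] using this
  obtain ⟨B, hB⟩ := h.exists_vertical hz p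
  have hint : ∀ β : ℂ, ∀ t ∈ Ioi (0 : ℝ), betaIntegrand f z β t =
      C * cexp (2 * Real.pi * I * β * x₀) * (betaFun H p β (z - x₀ + t * I) * I) := by
    intro β t ht
    rw [betaIntegrand, hf, vert_coe z (le_of_lt ht), betaFun,
      show (z : ℂ) + t * I - x₀ = z - x₀ + t * I by ring,
      show 2 * Real.pi * I * β * (z + t * I) = 2 * Real.pi * I * β * x₀ +
        2 * Real.pi * I * β * (z - x₀ + t * I) by ring, Complex.exp_add]
    ring
  refine ⟨B, fun β hβ => ?_, fun β => C * cexp (2 * Real.pi * I * β * x₀) *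
    betaIntegral H p (z - x₀) β, ?_, fun β hβ hβB => ?_, ?_⟩
  · have h1 : IntegrableOn (fun t : ℝ => C * cexp (2 * Real.pi * I * β * x₀) *
        (betaFun H p β (z - x₀ + t * I) * I)) (Ioi 0) := (hB β hβ).1.const_mul _
    exact h1.congr_fun (fun t ht => (hint β t ht).symm) measurableSet_Ioi
  · exact DifferentiableOn.mul (by fun_prop) (h.differentiableOn_betaIntegral hz p)
  · beta_reduce
    rw [setIntegral_congr_fun measurableSet_Ioi (hint β), integral_const_mul, (hB β hβB).2 hβ]
  · have h1 : Continuous fun β : ℂ => C * cexp (2 * Real.pi * I * β * x₀) := by fun_prop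
    have h2 := (h1.tendsto 0).mono_left (nhdsWithin_le_nhds (s := upper))
    simp only [mul_zero, zero_mul, Complex.exp_zero, mul_one] at h2
    exact h2.mul (h.tendsto_betaIntegral hT hz hp)

/-- Two continuations agree far to the right, hence on the connected half-plane Im β > 0, of which 0
is a limit point. -/
lemma IsBetaValue.unique {f : ℍ → ℂ} {z : ℍ} {v v' : ℂ} (h : IsBetaValue f z v)
    (h' : IsBetaValue f z v') : v = v' := by
  obtain ⟨B, _, F, hF, hFe, hFt⟩ := h
  obtain ⟨B', _, F', hF', hFe', hFt'⟩ := h'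
  set M := max B B'
  have hopen : IsOpen {β : ℂ | 0 < β.im} := isOpen_upper
  have hmem : (M + 1 : ℝ) + I ∈ {β : ℂ | 0 < β.im} := by simp
  have heq : F =ᶠ[𝓝 ((M + 1 : ℝ) + I : ℂ)] F' := by
    filter_upwards [hopen.mem_nhds hmem, (isOpen_lt continuous_const Complex.continuous_re).mem_nhds
      (show M < ((M + 1 : ℝ) + I : ℂ).re by simp)] with β h1 h2
    have h2' : M < β.re := h2
    rw [hFe β h1 ((le_max_left _ _).trans_lt h2'), hFe' β h1 ((le_max_right _ _).trans_lt h2')]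
  have hE := (hF.analyticOnNhd hopen).eqOn_of_preconnected_of_eventuallyEq (hF'.analyticOnNhd hopen)
    convex_upper.isPreconnected hmem heq
  have : (𝓝[{β : ℂ | 0 < β.im}] (0 : ℂ)).NeBot := QExp.neBot_upper
  refine tendsto_nhds_unique (hFt.congr' ?_) hFt'
  filter_upwards [self_mem_nhdsWithin] with β hβ
  exact hE hβ

/-- The difference of two continuations vanishes on a left half-plane, so it has infinite order
everywhere by connectedness of the plane. Analyticity at 0 then forces equal values there. -/
lemma IsAlphaBetaValue.unique {f : ℂ → ℍ → ℂ} {z : ℍ} {v v' : ℂ} (h : IsAlphaBetaValue f z v)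
    (h' : IsAlphaBetaValue f z v') : v = v' := by
  obtain ⟨A, J, hJ, hm, ha, rfl⟩ := h
  obtain ⟨A', J', hJ', hm', ha', rfl⟩ := h'
  have hmer : Meromorphic (J - J') := (meromorphicOn_univ.1 hm).sub (meromorphicOn_univ.1 hm')
  set M := min A A'
  have h1 : meromorphicOrderAt (J - J') ((M - 1 : ℝ) : ℂ) = ⊤ := by
    rw [meromorphicOrderAt_eq_top_iff]
    refine eventually_nhdsWithin_of_eventually_nhds ?_
    filter_upwards [(isOpen_lt Complex.continuous_re continuous_const).mem_nhds
      (show ((M - 1 : ℝ) : ℂ).re < M by simp)] with α hα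
    have hα' : α.re < M := hα
    rw [Pi.sub_apply, (hJ α (hα'.trans_le (min_le_left _ _))).unique
      (hJ' α (hα'.trans_le (min_le_right _ _))), sub_self]
  have h2 : meromorphicOrderAt (J - J') 0 = ⊤ := by
    by_contra hne
    exact (hmer.exists_meromorphicOrderAt_ne_top_iff_forall.1 ⟨0, hne⟩ _) h1
  rw [meromorphicOrderAt_eq_top_iff] at h2
  have h3 : Tendsto (J - J') (𝓝[≠] 0) (𝓝 (J 0 - J' 0)) :=
    ((ha.sub ha').continuousAt.tendsto).mono_left nhdsWithin_le_nhds
  have h4 : Tendsto (J - J') (𝓝[≠] 0) (𝓝 0) :=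
    tendsto_const_nhds.congr' (h2.mono fun x hx => hx.symm)
  exact sub_eq_zero.1 (tendsto_nhds_unique h3 h4)

lemma IsRegIntegral.unique {g : ℍ → ℂ} {γ : SL(2, ℤ)} {z₂ s v v' : ℂ}
    (h : IsRegIntegral g γ z₂ s v) (h' : IsRegIntegral g γ z₂ s v') : v = v' := by
  obtain ⟨v₁, v₂, h1, h2, rfl⟩ := h UpperHalfPlane.I
  obtain ⟨v₁', v₂', h1', h2', rfl⟩ := h' UpperHalfPlane.I
  rw [IsAlphaBetaValue.unique h1 h1', IsAlphaBetaValue.unique h2 h2']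

/-! ### Branches of the logarithm and the inversion between cusps -/

/-- The constant `log(cτ) - log τ` for `τ` in the upper half-plane. -/
def logScale (c : ℤ) : ℂ := (Real.log |(c : ℝ)| : ℂ) - if c < 0 then Real.pi * I else 0

lemma log_neg_of_upper {τ : ℂ} (hτ : τ ∈ upper) : log (-τ) = log τ - Real.pi * I := by
  rw [Complex.log, Complex.log, norm_neg, arg_neg_eq_arg_sub_pi_of_im_pos hτ]
  push_cast
  ring

/-- For c < 0 write cτ = |c|(-τ): passing from τ to -τ lowers the argument by π. By contrast, log c
itself carries +πi. -/
lemma log_intCast_mul {c : ℤ} (hc : c ≠ 0) {τ : ℂ} (hτ : τ ∈ upper) :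
    log ((c : ℂ) * τ) = logScale c + log τ := by
  have hc' : (c : ℝ) ≠ 0 := by exact_mod_cast hc
  have hpos : 0 < |(c : ℝ)| := abs_pos.2 hc'
  rcases lt_or_gt_of_ne hc with h | h
  · have h' : (c : ℝ) < 0 := by exact_mod_cast h
    have e : (c : ℂ) * τ = ((|(c : ℝ)| : ℝ) : ℂ) * -τ := by
      rw [abs_of_neg h']
      push_cast
      ring
    rw [e, log_ofReal_mul hpos (neg_ne_zero.2 (ne_zero_of_upper hτ)), log_neg_of_upper hτ, logScale,
      if_pos h]
    ring
  · have h' : 0 < (c : ℝ) := by exact_mod_cast h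
    have e : (c : ℂ) * τ = ((|(c : ℝ)| : ℝ) : ℂ) * τ := by
      rw [abs_of_pos h']
      push_cast
      ring
    rw [e, log_ofReal_mul hpos (ne_zero_of_upper hτ), logScale, if_neg h.not_gt]
    ring

lemma log_intCast {c : ℤ} (hc : c ≠ 0) :
    log (c : ℂ) = (Real.log |(c : ℝ)| : ℂ) + if c < 0 then Real.pi * I else 0 := by
  have hc' : (c : ℝ) ≠ 0 := by exact_mod_cast hc
  have hpos : 0 < |(c : ℝ)| := abs_pos.2 hc'
  rcases lt_or_gt_of_ne hc with h | h
  · have h' : (c : ℝ) < 0 := by exact_mod_cast h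
    have e : (c : ℂ) = ((|(c : ℝ)| : ℝ) : ℂ) * -1 := by
      rw [abs_of_neg h']
      push_cast
      ring
    rw [e, log_ofReal_mul hpos (by simp), log_neg_one, if_pos h]
  · have h' : 0 < (c : ℝ) := by exact_mod_cast h
    rw [if_neg h.not_gt, add_zero, abs_of_pos h', ofReal_log h'.le, ofReal_intCast]

lemma sq_abs_intCast (c : ℤ) : ((|(c : ℝ)| : ℝ) : ℂ) ^ 2 = (c : ℂ) ^ 2 := by
  rw [← ofReal_pow, sq_abs]
  push_cast
  rfl

lemma log_intCast_sq {c : ℤ} (hc : c ≠ 0) : log ((c : ℂ) ^ 2) = 2 * (Real.log |(c : ℝ)| : ℂ) := by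
  have hc' : (c : ℝ) ≠ 0 := by exact_mod_cast hc
  have hpos : 0 < |(c : ℝ)| := abs_pos.2 hc'
  rw [← sq_abs_intCast, ← ofReal_pow, ← ofReal_log (by positivity), Real.log_pow]
  push_cast
  ring

/-- The map `τ ↦ -1/(c²τ)`. -/
def inversion (c : ℤ) (τ : ℂ) : ℂ := -1 / ((c : ℂ) ^ 2 * τ)

lemma inversion_eq {c : ℤ} (τ : ℂ) :
    inversion c τ = (((|(c : ℝ)| ^ 2)⁻¹ : ℝ) : ℂ) * -τ⁻¹ := by
  rw [inversion, ofReal_inv, ofReal_pow, sq_abs_intCast, neg_div, one_div, mul_inv]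
  ring

lemma im_inv_neg {τ : ℂ} (hτ : τ ∈ upper) : τ⁻¹.im < 0 := by
  have h : 0 < τ.im := hτ
  rw [inv_im]
  have := normSq_pos.2 (ne_zero_of_upper hτ)
  exact div_neg_of_neg_of_pos (by linarith) this

lemma inversion_mem_upper {c : ℤ} (hc : c ≠ 0) {τ : ℂ} (hτ : τ ∈ upper) :
    inversion c τ ∈ upper := by
  have hc' : (c : ℝ) ≠ 0 := by exact_mod_cast hc
  have hpos : 0 < |(c : ℝ)| := abs_pos.2 hc'
  rw [inversion_eq, upper, mem_ofPred_eq, im_ofReal_mul, neg_im]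
  have := im_inv_neg hτ
  have h2 : 0 < (|(c : ℝ)| ^ 2)⁻¹ := by positivity
  nlinarith

lemma inversion_inversion {c : ℤ} (hc : c ≠ 0) {τ : ℂ} (hτ : τ ∈ upper) :
    inversion c (inversion c τ) = τ := by
  have h1 : (c : ℂ) ≠ 0 := by exact_mod_cast hc
  have h2 := ne_zero_of_upper hτ
  rw [inversion, inversion]
  field_simp

lemma inversion_neg (c : ℤ) (τ : ℂ) : inversion (-c) τ = inversion c τ := by
  simp [inversion]

lemma log_inversion {c : ℤ} (hc : c ≠ 0) {τ : ℂ} (hτ : τ ∈ upper) :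
    log (inversion c τ) = Real.pi * I - 2 * (Real.log |(c : ℝ)| : ℂ) - log τ := by
  have hc' : (c : ℝ) ≠ 0 := by exact_mod_cast hc
  have hpos : 0 < |(c : ℝ)| := abs_pos.2 hc'
  have h0 := ne_zero_of_upper hτ
  have harg : arg τ ≠ Real.pi := by
    intro h
    rw [arg_eq_pi_iff] at h
    exact (ne_of_gt (show 0 < τ.im from hτ)) h.2
  have h1 : log (-τ⁻¹) = Real.pi * I - log τ := by
    have e : log (-τ⁻¹) = log τ⁻¹ + Real.pi * I := by
      rw [Complex.log, Complex.log, norm_neg, arg_neg_eq_arg_add_pi_of_im_neg (im_inv_neg hτ)]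
      push_cast
      ring
    rw [e, Complex.log_inv _ harg]
    ring
  rw [inversion_eq, log_ofReal_mul (by positivity) (neg_ne_zero.2 (inv_ne_zero h0)), h1,
    Real.log_inv, Real.log_pow]
  push_cast
  ring

/-- The factor by which the integrands at the cusps `γ(i∞)` and `i∞` differ. -/
def cuspFactor (m : ℤ) (c : ℤ) (s α : ℂ) : ℂ :=
  cexp ((wt m - 2 + α) * logScale c +
    (s - 1 + α) * (Real.pi * I - 2 * (Real.log |(c : ℝ)| : ℂ)))

lemma cuspFactor_ne_zero (m c : ℤ) (s α : ℂ) : cuspFactor m c s α ≠ 0 := exp_ne_zero _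

/-- For c < 0 the phase of (cτ)^k relative to τ^k is e^{-πik}, which is the phase of c^{-k} and not
of c^k. This is why c^{-k} appears together with (c²)^{k-s}. The minus sign comes from e^{πi(s-1)}.
-/
lemma cuspFactor_zero (m : ℤ) {c : ℤ} (hc : c ≠ 0) (s : ℂ) :
    cuspFactor m c s 0 = -(cexp (Real.pi * I * s) * ((c : ℂ) ^ wt m)⁻¹ *
      ((c : ℂ) ^ 2) ^ (wt m - s)) := by
  have hc' : (c : ℂ) ≠ 0 := by exact_mod_cast hc
  have hneg : ∀ x : ℂ, -x = cexp (Real.pi * I) * x := by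
    intro x
    rw [exp_pi_mul_I]
    ring
  rw [cpow_def_of_ne_zero hc', cpow_def_of_ne_zero (pow_ne_zero 2 hc'), log_intCast hc,
    log_intCast_sq hc, cuspFactor, logScale, ← Complex.exp_neg, ← Complex.exp_add, ← Complex.exp_add,
    hneg, ← Complex.exp_add, Complex.exp_eq_exp_iff_exists_int]
  -- The exponents agree exactly for c < 0 and differ by 2πi for c > 0.
  split_ifs
  · refine ⟨0, ?_⟩
    push_cast
    ring
  · refine ⟨-1, ?_⟩
    push_cast
    ring

/-- The function `τ ↦ g(r + τ)`. -/
def shiftFun (g : ℍ → ℂ) (r : ℂ) (τ : ℂ) : ℂ := g (ofComplex (r + τ))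

/-- The function `(cz+d)^{-k} g(γz)` of `z = x + τ`. -/
def slashFun (m : ℤ) (g : ℍ → ℂ) (γ : SL(2, ℤ)) (x : ℂ) (τ : ℂ) : ℂ :=
  cd γ (ofComplex (x + τ)) ^ (-wt m) * g (γ • ofComplex (x + τ))

/-- The point `γ⁻¹(i∞)`. -/
def pole (γ : SL(2, ℤ)) : ℝ := -((γ 1 1 : ℤ) : ℝ) / ((γ 1 0 : ℤ) : ℝ)

lemma ofReal_add_mem_upper {τ : ℂ} (hτ : τ ∈ upper) (x : ℝ) : (x : ℂ) + τ ∈ upper := by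
  rw [add_comm]
  exact add_ofReal_mem_upper hτ x

lemma coe_ofComplex {z : ℂ} (hz : z ∈ upper) : ((ofComplex z : ℍ) : ℂ) = z := by
  rw [ofComplex_apply_of_im_pos hz]

lemma HasFourierExpansion.qExp {m : ℤ} {g : ℍ → ℂ} {γ : SL(2, ℤ)} {κ : ℝ} {w : ℕ} {b : ℤ → ℂ}
    (h : HasFourierExpansion m g γ κ w b) (x : ℝ) :
    QExp κ w (fun n => b n * cexp (2 * Real.pi * I * ((n : ℂ) + κ) * x / w))
      (slashFun m g γ x) := by
  refine ⟨h.shift_nonneg, h.shift_lt_one, h.width_pos, ?_, fun τ hτ => ?_⟩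
  · obtain ⟨n₀, hn₀⟩ := h.principal
    exact ⟨n₀, fun n hn => by simp [hn₀ n hn]⟩
  · have h1 := h.expansion (ofComplex ((x : ℂ) + τ))
    rw [coe_ofComplex (ofReal_add_mem_upper hτ x)] at h1
    have e : ∀ n : ℤ, b n * cexp (2 * Real.pi * I * ((n : ℂ) + κ) * x / w) *
        cexp (2 * Real.pi * I * (freq κ w n : ℝ) * τ) =
        b n * cexp (2 * Real.pi * I * ((n : ℂ) + κ) * (x + τ) / w) := by
      intro n
      rw [mul_assoc, ← Complex.exp_add, freq]
      congr 2
      push_cast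
      ring
    simp only [e]
    exact h1

lemma cd_one (z : ℍ) : cd 1 z = 1 := by simp [cd]

lemma slashFun_one (m : ℤ) (g : ℍ → ℂ) (x : ℂ) : slashFun m g 1 x = shiftFun g x := by
  funext τ
  simp [slashFun, shiftFun, cd_one]

lemma cd_eq {γ : SL(2, ℤ)} (hc : γ 1 0 ≠ 0) (z : ℍ) :
    cd γ z = ((γ 1 0 : ℤ) : ℂ) * ((z : ℂ) - pole γ) := by
  have hc' : ((γ 1 0 : ℤ) : ℂ) ≠ 0 := by exact_mod_cast hc
  rw [cd, pole]
  push_cast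
  field_simp
  ring

lemma sub_pole_mem_upper (γ : SL(2, ℤ)) (z : ℍ) : (z : ℂ) - pole γ ∈ upper := by
  have := add_ofReal_mem_upper (show (z : ℂ) ∈ upper from z.im_pos) (-pole γ)
  simpa [sub_eq_add_neg] using this

lemma coe_smul_eq {γ : SL(2, ℤ)} {r : ℚ} (hr : MapsInftyTo γ r) (z : ℍ) :
    ((γ • z : ℍ) : ℂ) = r + inversion (γ 1 0) ((z : ℂ) - pole γ) := by
  obtain ⟨hc, rfl⟩ := hr
  have hc' : ((γ 1 0 : ℤ) : ℂ) ≠ 0 := by exact_mod_cast hc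
  have hz := ne_zero_of_upper (sub_pole_mem_upper γ z)
  have hcd := cd_eq hc z
  have hcd0 : cd γ z ≠ 0 := by
    rw [hcd]
    exact mul_ne_zero hc' hz
  have hdet : ((γ 0 0 : ℤ) : ℂ) * ((γ 1 1 : ℤ) : ℂ) - ((γ 0 1 : ℤ) : ℂ) * ((γ 1 0 : ℤ) : ℂ) = 1 := by
    have := Matrix.det_fin_two (γ : Matrix (Fin 2) (Fin 2) ℤ)
    rw [γ.det_coe] at this
    exact_mod_cast this.symm
  rw [coe_specialLinearGroup_apply, inversion]
  have e1 : ((γ 1 0 : ℤ) : ℂ) ^ 2 * ((z : ℂ) - pole γ) = ((γ 1 0 : ℤ) : ℂ) * cd γ z := by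
    rw [hcd]
    ring
  rw [e1]
  rw [cd] at hcd0 ⊢
  simp only [algebraMap_int_eq, eq_intCast, ofReal_intCast]
  push_cast
  rw [eq_comm, div_add_div _ _ hc' (mul_ne_zero hc' hcd0), div_eq_div_iff
    (mul_ne_zero hc' (mul_ne_zero hc' hcd0)) hcd0]
  linear_combination ((((γ 1 0 : ℤ) : ℂ) * (((γ 1 0 : ℤ) : ℂ) * (z : ℂ) + ((γ 1 1 : ℤ) : ℂ)))) * hdet

lemma slashFun_pole {m : ℤ} {g : ℍ → ℂ} {γ : SL(2, ℤ)} (z : ℍ) :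
    slashFun m g γ (pole γ) ((z : ℂ) - pole γ) = cd γ z ^ (-wt m) * g (γ • z) := by
  simp only [slashFun, add_sub_cancel, ofComplex_apply]

/-- With σ = z + d/c, cz + d is cσ and γz - r is -1/(c²σ), so the powers of σ depending on α cancel
and α survives only in a constant. Regularization in α therefore gains nothing at this cusp, and the
exponent k - s must be handled directly. -/
lemma cusp_integrand_eq (m : ℤ) (g : ℍ → ℂ) {γ : SL(2, ℤ)} {r : ℚ} (hr : MapsInftyTo γ r)
    (s α : ℂ) (z : ℍ) :
    cd γ z ^ (-2 + α) * g (γ • z) * (((γ • z : ℍ) : ℂ) - r) ^ (s - 1 + α) =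
      cuspFactor m (γ 1 0) s α * (slashFun m g γ (pole γ) ((z : ℂ) - pole γ) *
        ((z : ℂ) - pole γ) ^ (wt m - s - 1)) := by
  have hc := hr.1
  have hz := sub_pole_mem_upper γ z
  have hc' : ((γ 1 0 : ℤ) : ℂ) ≠ 0 := by exact_mod_cast hc
  rw [slashFun_pole, coe_smul_eq hr, add_sub_cancel_left, cd_eq hc,
    cpow_def_of_ne_zero (mul_ne_zero hc' (ne_zero_of_upper hz)),
    cpow_def_of_ne_zero (mul_ne_zero hc' (ne_zero_of_upper hz)),
    cpow_def_of_ne_zero (ne_zero_of_upper (inversion_mem_upper hc hz)),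
    cpow_def_of_ne_zero (ne_zero_of_upper hz), log_intCast_mul hc hz, log_inversion hc hz,
    cuspFactor]
  set L := log ((z : ℂ) - pole γ)
  set l := logScale (γ 1 0)
  set q := (Real.log |((γ 1 0 : ℤ) : ℝ)| : ℂ)
  have e : cexp ((l + L) * (-2 + α)) * cexp ((Real.pi * I - 2 * q - L) * (s - 1 + α)) =
      cexp ((wt m - 2 + α) * l + (s - 1 + α) * (Real.pi * I - 2 * q)) *
        (cexp ((l + L) * -wt m) * cexp (L * (wt m - s - 1))) := by
    simp only [← Complex.exp_add]
    congr 1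
    ring
  linear_combination g (γ • z) * e

/-- The change of variables `τ ↦ -1/(c²τ)` between the cusps `γ(i∞)` and `i∞`. -/
lemma shiftFun_inversion (m : ℤ) (g : ℍ → ℂ) {γ : SL(2, ℤ)} {r : ℚ} (hr : MapsInftyTo γ r) (s : ℂ)
    {τ : ℂ} (hτ : τ ∈ upper) :
    betaFun (shiftFun g r) s 0 (inversion (γ 1 0) τ) * (((γ 1 0 : ℤ) : ℂ) ^ 2 * τ ^ 2)⁻¹ =
      cuspFactor m (γ 1 0) s 0 * betaFun (slashFun m g γ (pole γ)) (wt m - s) 0 τ := by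
  have hc := hr.1
  set z : ℍ := ofComplex ((pole γ : ℂ) + τ)
  have hz : (z : ℂ) - pole γ = τ := by
    rw [coe_ofComplex (ofReal_add_mem_upper hτ _), add_sub_cancel_left]
  have h1 := cusp_integrand_eq m g hr s 0 z
  have h2 := coe_smul_eq hr z
  rw [hz] at h1 h2
  have h3 : shiftFun g r (inversion (γ 1 0) τ) = g (γ • z) := by
    rw [shiftFun, ← h2, ofComplex_apply]
  have h4 : cd γ z ^ (-2 + 0 : ℂ) = (((γ 1 0 : ℤ) : ℂ) ^ 2 * τ ^ 2)⁻¹ := by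
    rw [cd_eq hc, hz, add_zero, cpow_neg, ← mul_pow]
    norm_cast
  rw [h2, add_sub_cancel_left, h4, add_zero] at h1
  simp only [betaFun, h3, mul_zero, zero_mul, Complex.exp_zero, mul_one]
  linear_combination h1

/-- Up to a nonzero constant, the function at the cusp depends only on g, r and c². This is what
makes different choices of γ comparable. -/
lemma slashFun_eq_mul (m : ℤ) (g : ℍ → ℂ) {γ : SL(2, ℤ)} {r : ℚ} (hr : MapsInftyTo γ r) (s : ℂ)
    {τ : ℂ} (hτ : τ ∈ upper) :
    cuspFactor m (γ 1 0) s 0 * slashFun m g γ (pole γ) τ =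
      betaFun (shiftFun g r) s 0 (inversion (γ 1 0) τ) * (((γ 1 0 : ℤ) : ℂ) ^ 2 * τ ^ 2)⁻¹ *
        (τ ^ (wt m - s - 1))⁻¹ := by
  have h0 : τ ^ (wt m - s - 1) ≠ 0 := by simp [cpow_eq_zero_iff, ne_zero_of_upper hτ]
  rw [shiftFun_inversion m g hr s hτ]
  simp only [betaFun, mul_zero, zero_mul, Complex.exp_zero, mul_one]
  field_simp

/-- The inversion need not map segments to segments, so primitives are transported instead: a
primitive composed with the inversion is, up to `cuspFactor`, a primitive of the other integrand. -/
lemma seg_inversion {m : ℤ} {g : ℍ → ℂ} {γ : SL(2, ℤ)} {r : ℚ} (hr : MapsInftyTo γ r) (s : ℂ)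
    {κ κ' : ℝ} {w w' : ℕ} {a a' : ℤ → ℂ} (h₁ : QExp κ w a (shiftFun g r))
    (h₂ : QExp κ' w' a' (slashFun m g γ (pole γ))) {σ σ' : ℂ} (hσ : σ ∈ upper)
    (hσ' : σ' ∈ upper) :
    seg (betaFun (shiftFun g r) s 0) (inversion (γ 1 0) σ) (inversion (γ 1 0) σ') =
      cuspFactor m (γ 1 0) s 0 *
        seg (betaFun (slashFun m g γ (pole γ)) (wt m - s) 0) σ σ' := by
  have hc := hr.1
  have hc' : ((γ 1 0 : ℤ) : ℂ) ≠ 0 := by exact_mod_cast hc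
  have hd := h₁.differentiableOn_betaFun s 0
  have hd' := h₂.differentiableOn_betaFun (wt m - s) 0
  obtain ⟨P, hP⟩ := exists_primitive hd
  have hinv : ∀ τ ∈ upper, HasDerivAt (inversion (γ 1 0)) (((γ 1 0 : ℤ) : ℂ) ^ 2 * τ ^ 2)⁻¹ τ := by
    intro τ hτ
    have h0 := ne_zero_of_upper hτ
    have e : inversion (γ 1 0) = fun τ => (-(((γ 1 0 : ℤ) : ℂ) ^ 2)⁻¹) * τ⁻¹ := by
      funext τ
      rw [inversion, neg_div, one_div, mul_inv]
      ring
    rw [e]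
    refine ((hasDerivAt_inv h0).const_mul _).congr_deriv ?_
    field_simp
  have hQ : ∀ τ ∈ upper, HasDerivAt (fun τ => (cuspFactor m (γ 1 0) s 0)⁻¹ *
      P (inversion (γ 1 0) τ)) (betaFun (slashFun m g γ (pole γ)) (wt m - s) 0 τ) τ := by
    intro τ hτ
    have h1 := ((hP _ (inversion_mem_upper hc hτ)).comp τ (hinv τ hτ)).const_mul
      (cuspFactor m (γ 1 0) s 0)⁻¹
    rw [shiftFun_inversion m g hr s hτ, inv_mul_cancel_left₀ (cuspFactor_ne_zero _ _ _ _)] at h1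
    exact h1
  rw [seg_eq_sub hd.continuousOn hP (inversion_mem_upper hc hσ) (inversion_mem_upper hc hσ'),
    seg_eq_sub hd'.continuousOn hQ hσ hσ', ← mul_sub,
    mul_inv_cancel_left₀ (cuspFactor_ne_zero _ _ _ _)]

lemma wt_re (m : ℤ) : (wt m).re = (m : ℝ) / 2 := by
  have : wt m = (((m : ℝ) / 2 : ℝ) : ℂ) := by
    rw [wt]
    push_cast
    rfl
  rw [this, ofReal_re]

lemma two_pi_div_I_cpow (s : ℂ) : (2 * Real.pi / I : ℂ) ^ s = (2 * Real.pi : ℂ) ^ s * (I ^ s)⁻¹ := by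
  have h := ofReal_mul_cpow (a := 2 * Real.pi) (by positivity) (inv_ne_zero I_ne_zero) s
  rw [inv_cpow_eq_ite, if_neg (by rw [arg_I]; linarith [Real.pi_pos])] at h
  push_cast at h
  rw [div_eq_mul_inv, h]

lemma exp_pi_mul_I_mul (s : ℂ) : cexp (Real.pi * I * s) = I ^ s * I ^ s := by
  rw [cpow_def_of_ne_zero I_ne_zero, log_I, ← Complex.exp_add]
  ring_nf

lemma ofReal_two_pi_ne_zero : (2 * Real.pi : ℂ) ≠ 0 := by exact_mod_cast Real.two_pi_pos.ne'

/-- The height of `-1/(c²τ)` at `τ = i`. -/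
def cuspHeight (c : ℤ) : ℝ := ((c : ℝ) ^ 2)⁻¹

lemma cuspHeight_pos {c : ℤ} (hc : c ≠ 0) : 0 < cuspHeight c := by
  have : (c : ℝ) ≠ 0 := by exact_mod_cast hc
  unfold cuspHeight
  positivity

lemma inversion_I_mul_one (c : ℤ) : inversion c (I * (1 : ℝ)) = I * cuspHeight c := by
  rw [inversion, cuspHeight]
  push_cast
  rw [mul_one, neg_div, one_div, mul_inv, inv_I]
  ring

lemma inversion_I_mul_cuspHeight {c : ℤ} (hc : c ≠ 0) :
    inversion c (I * cuspHeight c) = I * (1 : ℝ) := by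
  rw [← inversion_I_mul_one, inversion_inversion hc (mul_I_mem_upper one_pos)]

/-! ### The regularized integrals from a cusp to infinity -/

section RegularizedIntegrals

variable {m : ℤ} {g : ℍ → ℂ} {κ κ' : ℝ} {w w' : ℕ} {a a' : ℤ → ℂ}

lemma meromorphicAt_regValue {H : ℂ → ℂ} (h : QExp κ w a H) {T : ℝ} (hT : 0 < T) (p : ℂ) :
    MeromorphicAt (regValue T κ w a) p := by
  have hc : (I * T : ℂ) ≠ 0 := ne_zero_of_upper (mul_I_mem_upper hT)
  have h2 : Differentiable ℂ fun p : ℂ => constTerm κ a * (I * T) ^ p :=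
    (differentiable_const _).mul fun p => differentiableAt_id.const_cpow (Or.inl hc)
  exact ((h.differentiable_gammaSum hT).analyticAt p).meromorphicAt.sub
    ((h2.analyticAt p).meromorphicAt.div analyticAt_id.meromorphicAt)

lemma analyticAt_regValue {H : ℂ → ℂ} (h : QExp κ w a H) {T : ℝ} (hT : 0 < T) {p : ℂ}
    (hp : p ≠ 0 ∨ constTerm κ a = 0) : AnalyticAt ℂ (regValue T κ w a) p := by
  have hc : (I * T : ℂ) ≠ 0 := ne_zero_of_upper (mul_I_mem_upper hT)
  rcases hp with hp | hp
  · have h2 : Differentiable ℂ fun p : ℂ => constTerm κ a * (I * T) ^ p :=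
      (differentiable_const _).mul fun p => differentiableAt_id.const_cpow (Or.inl hc)
    exact ((h.differentiable_gammaSum hT).analyticAt p).sub
      ((h2.analyticAt p).div analyticAt_id hp)
  · have : regValue T κ w a = gammaSum T κ w a := by
      funext q
      simp [regValue, hp]
    rw [this]
    exact (h.differentiable_gammaSum hT).analyticAt p

/-- Here α shifts the exponent to s + α, so Re α < -Re s reaches the range where the limit in β
exists. The continuation is analytic at α = 0 unless s meets the pole produced by the constant term.
-/
lemma isRegIntegralToInfty {r : ℚ} (h : QExp κ w a (shiftFun g r)) {s : ℂ}
    (hs : s ≠ 0 ∨ constTerm κ a = 0) (z : ℍ) :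
    IsRegIntegralToInfty g z r (s - 1)
      (seg (betaFun (shiftFun g r) s 0) (z - (r : ℝ)) (I * (1 : ℝ)) + regValue 1 κ w a s) := by
  have hz : (z : ℂ) - (r : ℝ) ∈ upper := by
    have := add_ofReal_mem_upper (show (z : ℂ) ∈ upper from z.im_pos) (-(r : ℝ))
    simpa [sub_eq_add_neg] using this
  have hseg := differentiable_seg h.differentiableOn.continuousOn hz (mul_I_mem_upper one_pos)
  refine ⟨-s.re, fun α => seg (betaFun (shiftFun g r) (s + α) 0) (z - (r : ℝ)) (I * (1 : ℝ)) +
    regValue 1 κ w a (s + α), fun α hα => ?_, ?_, ?_, by simp⟩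
  · have := h.isBetaValue one_pos (p := s + α) (Or.inl (by simp; linarith)) (C := 1)
      (x₀ := (r : ℝ)) (f := fun τ => g τ * ((τ : ℂ) - starRingEnd ℂ (r : ℂ)) ^ (s - 1 + α)) ?_ z
    · simpa using this
    · intro τ
      have e : shiftFun g r ((τ : ℂ) - (r : ℝ)) = g τ := by
        rw [shiftFun, ofReal_ratCast, add_sub_cancel, ofComplex_apply]
      rw [e, one_mul, ← ofReal_ratCast, conj_ofReal, show s + α - 1 = s - 1 + α by ring]
  · intro α _
    have hadd : AnalyticAt ℂ (fun α => s + α) α := by fun_prop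
    refine MeromorphicAt.add ?_ ?_
    · exact ((hseg.comp ((differentiable_const s).add differentiable_id)).analyticAt α).meromorphicAt
    · exact (meromorphicAt_regValue h one_pos (s + α)).comp_analyticAt hadd
  · refine AnalyticAt.add ?_ ?_
    · exact (hseg.comp ((differentiable_const s).add differentiable_id)).analyticAt 0
    · have hadd : AnalyticAt ℂ (fun α => s + α) 0 := by fun_prop
      exact AnalyticAt.fun_comp (by simpa using analyticAt_regValue h one_pos hs) hadd

lemma isRegIntegralToCusp {γ : SL(2, ℤ)} {r : ℚ} (hr : MapsInftyTo γ r)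
    (h : QExp κ w a (slashFun m g γ (pole γ))) {s : ℂ}
    (hs : (wt m - s).re < 0 ∨ constTerm κ a = 0) (z : ℍ) :
    IsRegIntegralToCusp g γ z r (s - 1) (cuspFactor m (γ 1 0) s 0 *
      (seg (betaFun (slashFun m g γ (pole γ)) (wt m - s) 0) ((γ⁻¹ • z : ℍ) - pole γ)
        (I * cuspHeight (γ 1 0)) + regValue (cuspHeight (γ 1 0)) κ w a (wt m - s))) := by
  have hcf : Differentiable ℂ (cuspFactor m (γ 1 0) s) := by
    unfold cuspFactor
    fun_prop
  refine ⟨0, fun α => cuspFactor m (γ 1 0) s α *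
      (seg (betaFun (slashFun m g γ (pole γ)) (wt m - s) 0) ((γ⁻¹ • z : ℍ) - pole γ)
        (I * cuspHeight (γ 1 0)) + regValue (cuspHeight (γ 1 0)) κ w a (wt m - s)),
    fun α _ => ?_, ?_, ?_, rfl⟩
  · refine h.isBetaValue (cuspHeight_pos hr.1) hs (x₀ := pole γ) (fun τ => ?_) (γ⁻¹ • z)
    have := cusp_integrand_eq m g hr s α τ
    rw [← this, ← ofReal_ratCast, conj_ofReal]
  · exact fun α _ => ((hcf.mul_const _).analyticAt α).meromorphicAt
  · exact (hcf.mul_const _).analyticAt 0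

/-- The parts depending on z₁ are two segment integrals, which cancel because the inversion carries
the base points γ⁻¹z₁ + d/c and i/c² to z₁ - r and i. -/
lemma isRegIntegral {γ : SL(2, ℤ)} {r : ℚ} (hr : MapsInftyTo γ r)
    (h : QExp κ w a (shiftFun g r)) (h' : QExp κ' w' a' (slashFun m g γ (pole γ))) {s : ℂ}
    (hs : s ≠ 0 ∨ constTerm κ a = 0) (hs' : (wt m - s).re < 0 ∨ constTerm κ' a' = 0) :
    IsRegIntegral g γ r (s - 1) (regValue 1 κ w a s -
      cuspFactor m (γ 1 0) s 0 * regValue (cuspHeight (γ 1 0)) κ' w' a' (wt m - s)) := by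
  intro z
  refine ⟨_, _, isRegIntegralToCusp hr h' hs' z, isRegIntegralToInfty h hs z, ?_⟩
  have h1 := seg_inversion hr s h h' (sub_pole_mem_upper γ (γ⁻¹ • z))
    (mul_I_mem_upper (cuspHeight_pos hr.1))
  have h2 := coe_smul_eq hr (γ⁻¹ • z)
  rw [smul_inv_smul] at h2
  have h3 : (z : ℂ) - (r : ℝ) = inversion (γ 1 0) ((γ⁻¹ • z : ℍ) - pole γ) := by
    rw [h2, ofReal_ratCast, add_sub_cancel_left]
  rw [h3, ← inversion_I_mul_cuspHeight hr.1, h1]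
  ring

end RegularizedIntegrals

/-! ### The L-series as a normalized regularized integral -/

namespace LData

variable {m : ℤ} {g : ℍ → ℂ} {r : ℚ}

/-- The coefficients of `τ ↦ g(r + τ)`. -/
def coeff₁ (D : LData m g r) (n : ℤ) : ℂ :=
  D.b n * cexp (2 * Real.pi * I * ((n : ℂ) + (0 : ℝ)) * (r : ℝ) / (1 : ℕ))

/-- The coefficients of `(cz+d)^{-k} g(γz)` as a function of `τ = z + d/c`. -/
def coeff₂ (D : LData m g r) (n : ℤ) : ℂ :=
  D.bγ n * cexp (2 * Real.pi * I * ((n : ℂ) + D.κ) * (pole D.γ) / D.w)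

lemma qExp₁ (D : LData m g r) : QExp 0 1 D.coeff₁ (shiftFun g r) := by
  have := D.expansion_infty.qExp (r : ℝ)
  rwa [slashFun_one, ofReal_ratCast] at this

lemma qExp₂ (D : LData m g r) : QExp D.κ D.w D.coeff₂ (slashFun m g D.γ (pole D.γ)) :=
  D.expansion_cusp.qExp (pole D.γ)

lemma term₁_eq (D : LData m g r) (s : ℂ) (n : ℤ) :
    D.term₁ s n = gammaTerm 1 0 1 D.coeff₁ s n := by
  have h0 : freq 0 1 n = n := by simp [freq]
  rw [term₁, gammaTerm, h0, coeff₁]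
  simp

lemma term₂_eq (D : LData m g r) (s : ℂ) (n : ℤ) :
    D.term₂ s n = gammaTerm (cuspHeight (D.γ 1 0)) D.κ D.w D.coeff₂ (wt m - s) n := by
  have hw : (D.w : ℝ) ≠ 0 := by exact_mod_cast D.expansion_cusp.width_pos.ne'
  have h1 : freq D.κ D.w n = 0 ↔ (n : ℝ) + D.κ = 0 := by
    rw [freq, div_eq_zero_iff, or_iff_left hw]
  have h2 : 2 * Real.pi * freq D.κ D.w n * cuspHeight (D.γ 1 0) =
      2 * Real.pi * ((n : ℝ) + D.κ) / (((D.γ 1 0 : ℤ) : ℝ) ^ 2 * (D.w : ℝ)) := by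
    rw [freq, cuspHeight, div_eq_mul_inv, div_eq_mul_inv, mul_inv]
    ring
  rw [term₂, gammaTerm, h2, coeff₂, pole]
  simp only [h1]
  rw [freq]
  push_cast
  rfl

/-- The value of the regularized integral `∫_{[r,i∞]} g(τ) (τ-r)^{s-1} dτ`. -/
def integralValue (D : LData m g r) (s : ℂ) : ℂ :=
  regValue 1 0 1 D.coeff₁ s - cuspFactor m (D.γ 1 0) s 0 *
    regValue (cuspHeight (D.γ 1 0)) D.κ D.w D.coeff₂ (wt m - s)

lemma constTerm₁ (D : LData m g r) : constTerm 0 D.coeff₁ = D.b 0 := by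
  simp [constTerm, coeff₁]

lemma constTerm₂ (D : LData m g r) : constTerm D.κ D.coeff₂ = if D.κ = 0 then D.bγ 0 else 0 := by
  rw [constTerm]
  split_ifs with h
  · simp [coeff₂, h]
  · rfl

lemma value_eq (D : LData m g r) (s : ℂ) :
    D.value s = 1 / Gamma s * (2 * Real.pi / I : ℂ) ^ s * D.integralValue s := by
  have hc := D.maps.1
  have hc' : ((D.γ 1 0 : ℤ) : ℂ) ≠ 0 := by exact_mod_cast hc
  have hIs : I ^ s ≠ 0 := by simp [cpow_eq_zero_iff]
  have hps : (2 * Real.pi : ℂ) ^ s ≠ 0 := by simp [cpow_eq_zero_iff, Real.pi_ne_zero]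
  have hpk : (2 * Real.pi : ℂ) ^ wt m ≠ 0 := by simp [cpow_eq_zero_iff, Real.pi_ne_zero]
  have hck : ((D.γ 1 0 : ℤ) : ℂ) ^ wt m ≠ 0 := by simp [cpow_eq_zero_iff, hc']
  have hcs : (((D.γ 1 0 : ℤ) : ℂ) ^ 2) ^ (wt m - s) ≠ 0 := by simp [cpow_eq_zero_iff, hc']
  have e1 : (2 * Real.pi : ℂ) ^ (2 * s - wt m) =
      (2 * Real.pi : ℂ) ^ s * (2 * Real.pi : ℂ) ^ (-(wt m - s)) := by
    rw [← cpow_add _ _ ofReal_two_pi_ne_zero]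
    ring_nf
  have e2 : I ^ (wt m - s) = I ^ wt m / I ^ s := cpow_sub _ _ I_ne_zero
  have e3 : (I * (cuspHeight (D.γ 1 0) : ℂ)) ^ (wt m - s) =
      I ^ (wt m - s) * ((((D.γ 1 0 : ℤ) : ℂ) ^ 2) ^ (wt m - s))⁻¹ := by
    rw [mul_comm, ofReal_mul_cpow (cuspHeight_pos hc) I_ne_zero, mul_comm, cuspHeight]
    push_cast
    rw [inv_cpow_eq_ite, if_neg]
    rw [← sq_abs_intCast, ← ofReal_pow, arg_ofReal_of_nonneg (by positivity)]
    exact Real.pi_pos.ne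
  have e4 : (2 * Real.pi : ℂ) ^ (-s) = ((2 * Real.pi : ℂ) ^ s)⁻¹ := cpow_neg _ _
  rw [value, integralValue, regValue, regValue, gammaSum, gammaSum, constTerm₁, constTerm₂,
    two_pi_div_I_cpow, cuspFactor_zero m hc, exp_pi_mul_I_mul, e1, e3, e2, e4]
  -- What remains is algebra in the powers of i, 2π and c. They become independent atoms, subject
  -- only to the three inverse relations `f1`, `f2`, `f3`.
  simp_rw [term₁_eq, term₂_eq]
  generalize ∑' n : ℤ, gammaTerm 1 0 1 D.coeff₁ s n = S₁
  generalize ∑' n : ℤ, gammaTerm (cuspHeight (D.γ 1 0)) D.κ D.w D.coeff₂ (wt m - s) n = S₂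
  generalize (2 * Real.pi : ℂ) ^ s = P at *
  generalize (2 * Real.pi : ℂ) ^ (-(wt m - s)) = Q at *
  generalize (((D.γ 1 0 : ℤ) : ℂ) ^ 2) ^ (wt m - s) = X at *
  generalize ((D.γ 1 0 : ℤ) : ℂ) ^ wt m = Y at *
  generalize I ^ wt m = J at *
  rw [ofReal_one, mul_one]
  generalize I ^ s = K at *
  have f1 : K * K⁻¹ = 1 := mul_inv_cancel₀ hIs
  have f2 : P * P⁻¹ = 1 := mul_inv_cancel₀ hps
  have f3 : X * X⁻¹ = 1 := mul_inv_cancel₀ hcs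
  have h4 : (if D.κ = 0 then J * P * D.bγ 0 / (Y * (wt m - s) * Gamma s) else 0) =
      J * P * (if D.κ = 0 then D.bγ 0 else 0) / (Y * (wt m - s) * Gamma s) := by
    split_ifs <;> simp
  rw [h4]
  generalize (if D.κ = 0 then D.bγ 0 else 0) = c₂
  simp only [div_eq_mul_inv, mul_inv, one_mul]
  generalize (Gamma s)⁻¹ = G
  generalize (wt m - s)⁻¹ = U
  generalize s⁻¹ = V
  generalize X⁻¹ = X' at *
  generalize Y⁻¹ = Y' at *
  generalize K⁻¹ = K' at *
  generalize P⁻¹ = P' at *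
  linear_combination (-G * S₁ * P * P' + G * P * D.b 0 * V -
    G * P * Y' * J * X * Q * S₂ * (K * K' + 1) +
    G * P * Y' * J * c₂ * U * (K * K' + 1) * X * X') * f1 - G * S₁ * f2 +
    G * P * Y' * J * c₂ * U * f3

end LData

/-! ### Independence of the data, analyticity and the integral representation -/

lemma det_eq_one (γ : SL(2, ℤ)) : γ 0 0 * γ 1 1 - γ 0 1 * γ 1 0 = 1 := by
  rw [← Matrix.det_fin_two, γ.det_coe]

/-- Both fractions are reduced by the determinant relation, so each denominator divides the other.
-/
lemma MapsInftyTo.eq_or_eq_neg {γ γ' : SL(2, ℤ)} {r : ℚ} (h : MapsInftyTo γ r)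
    (h' : MapsInftyTo γ' r) : γ 1 0 = γ' 1 0 ∨ γ 1 0 = -γ' 1 0 := by
  have hdvd : ∀ {γ γ' : SL(2, ℤ)}, MapsInftyTo γ r → MapsInftyTo γ' r → γ 1 0 ∣ γ' 1 0 := by
    intro γ γ' h h'
    have hc : ((γ 1 0 : ℤ) : ℚ) ≠ 0 := by exact_mod_cast h.1
    have hc' : ((γ' 1 0 : ℤ) : ℚ) ≠ 0 := by exact_mod_cast h'.1
    have e := h.2.symm.trans h'.2
    rw [div_eq_div_iff hc hc'] at e
    have e' : γ 0 0 * γ' 1 0 = γ' 0 0 * γ 1 0 := by exact_mod_cast e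
    exact ⟨γ' 0 0 * γ 1 1 - γ 0 1 * γ' 1 0, by
      linear_combination (-γ' 1 0) * det_eq_one γ + γ 1 1 * e'⟩
  exact Int.natAbs_eq_natAbs_iff.1 (Nat.dvd_antisymm (Int.natAbs_dvd_natAbs.2 (hdvd h h'))
    (Int.natAbs_dvd_natAbs.2 (hdvd h' h)))

namespace LData

variable {m : ℤ} {g : ℍ → ℂ} {r : ℚ}

/-- At i∞ the two expansions represent the same function. At the cusp the functions are proportional
by the inverse ratio of the cusp factors, and the heights agree because c is determined up to sign.
-/
lemma integralValue_congr (D D' : LData m g r) (s : ℂ) :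
    D.integralValue s = D'.integralValue s := by
  have h1 : regValue 1 0 1 D.coeff₁ s = 1 * regValue 1 0 1 D'.coeff₁ s :=
    D'.qExp₁.regValue_scaling D.qExp₁ (fun τ _ => (one_mul _).symm) one_pos s
  have hcc := D.maps.eq_or_eq_neg D'.maps
  have hT : cuspHeight (D.γ 1 0) = cuspHeight (D'.γ 1 0) := by
    rcases hcc with h | h <;> simp [h, cuspHeight]
  have hsq : ((D.γ 1 0 : ℤ) : ℂ) ^ 2 = ((D'.γ 1 0 : ℤ) : ℂ) ^ 2 := by
    rcases hcc with h | h <;> simp [h]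
  have hinv : inversion (D.γ 1 0) = inversion (D'.γ 1 0) := by
    funext τ
    rw [inversion, inversion, hsq]
  have hne := cuspFactor_ne_zero m (D.γ 1 0) s 0
  have h2 := D'.qExp₂.regValue_scaling D.qExp₂
    (C := (cuspFactor m (D.γ 1 0) s 0)⁻¹ * cuspFactor m (D'.γ 1 0) s 0) (fun τ hτ => by
      rw [mul_assoc, slashFun_eq_mul m g D'.maps s hτ, ← hinv, ← hsq,
        ← slashFun_eq_mul m g D.maps s hτ, inv_mul_cancel_left₀ hne])
    (cuspHeight_pos D.maps.1) (wt m - s)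
  rw [integralValue, integralValue, h1, h2, one_mul, mul_assoc, mul_inv_cancel_left₀ hne, hT]

/-- The value does not depend on the choice of the data. -/
lemma value_congr (D D' : LData m g r) (s : ℂ) : D.value s = D'.value s := by
  rw [value_eq, value_eq, integralValue_congr D D']

lemma value_eq_regL (D : LData m g r) (s : ℂ) : D.value s = regL m g r s := by
  rw [regL, dif_pos ⟨D⟩]
  exact value_congr _ _ s

lemma regL_eq (D : LData m g r) :
    regL m g r = fun s => 1 / Gamma s * (2 * Real.pi / I : ℂ) ^ s *
      (regValue 1 0 1 D.coeff₁ s - cuspFactor m (D.γ 1 0) s 0 *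
        regValue (cuspHeight (D.γ 1 0)) D.κ D.w D.coeff₂ (wt m - s)) := by
  funext s
  rw [← D.value_eq_regL, value_eq, integralValue]

lemma differentiable_prefactor :
    Differentiable ℂ fun s : ℂ => 1 / Gamma s * (2 * Real.pi / I : ℂ) ^ s := by
  simp_rw [one_div]
  exact differentiable_one_div_Gamma.mul fun s => differentiableAt_id.const_cpow
    (Or.inl (div_ne_zero ofReal_two_pi_ne_zero I_ne_zero))

lemma differentiable_cuspFactor (m c : ℤ) : Differentiable ℂ fun s => cuspFactor m c s 0 := by
  unfold cuspFactor
  fun_prop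

lemma analyticAt_regL (D : LData m g r) {s : ℂ} (hs : s ≠ 0 ∨ constTerm 0 D.coeff₁ = 0)
    (hs' : wt m - s ≠ 0 ∨ constTerm D.κ D.coeff₂ = 0) : AnalyticAt ℂ (regL m g r) s := by
  have hsub : AnalyticAt ℂ (fun s => wt m - s) s := by fun_prop
  rw [D.regL_eq]
  exact (differentiable_prefactor.analyticAt s).mul
    ((analyticAt_regValue D.qExp₁ one_pos hs).sub (((differentiable_cuspFactor _ _).analyticAt s).mul
      (AnalyticAt.fun_comp (analyticAt_regValue D.qExp₂ (cuspHeight_pos D.maps.1) hs') hsub)))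

lemma meromorphicOn_regL (D : LData m g r) : MeromorphicOn (regL m g r) univ := by
  intro s _
  have hsub : AnalyticAt ℂ (fun s => wt m - s) s := by fun_prop
  rw [D.regL_eq]
  exact (differentiable_prefactor.analyticAt s).meromorphicAt.mul
    ((meromorphicAt_regValue D.qExp₁ one_pos s).sub
      (((differentiable_cuspFactor _ _).analyticAt s).meromorphicAt.mul
        ((meromorphicAt_regValue D.qExp₂ (cuspHeight_pos D.maps.1) (wt m - s)).comp_analyticAt hsub)))

lemma constTerm₁_eq_zero (D : LData m g r) (h : ConstantTermsVanish m g) :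
    constTerm 0 D.coeff₁ = 0 := by
  rw [constTerm₁, h 1 1 D.b D.expansion_infty]

lemma constTerm₂_eq_zero (D : LData m g r) (h : ConstantTermsVanish m g) :
    constTerm D.κ D.coeff₂ = 0 := by
  rw [constTerm₂]
  split_ifs with hκ
  · exact h D.γ D.w D.bγ (hκ ▸ D.expansion_cusp)
  · rfl

lemma differentiable_regL (D : LData m g r) (h : ConstantTermsVanish m g) :
    Differentiable ℂ (regL m g r) := fun _ =>
  (D.analyticAt_regL (Or.inr (D.constTerm₁_eq_zero h))
    (Or.inr (D.constTerm₂_eq_zero h))).differentiableAt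

lemma summable_term₁ (D : LData m g r) (s : ℂ) : Summable fun n : ℤ => ‖D.term₁ s n‖ := by
  simp_rw [term₁_eq]
  exact D.qExp₁.summable_gammaTerm one_pos s

lemma summable_term₂ (D : LData m g r) (s : ℂ) : Summable fun n : ℤ => ‖D.term₂ s n‖ := by
  simp_rw [term₂_eq]
  exact D.qExp₂.summable_gammaTerm (cuspHeight_pos D.maps.1) _

lemma integralRepresentation (D : LData m g r) {s : ℂ} (hs : s ≠ 0 ∨ constTerm 0 D.coeff₁ = 0)
    (hs' : (wt m - s).re < 0 ∨ constTerm D.κ D.coeff₂ = 0) :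
    IntegralRepresentation g D.γ r s (regL m g r s) := by
  have h := isRegIntegral D.maps D.qExp₁ D.qExp₂ hs hs'
  refine ⟨⟨_, h, fun v hv => hv.unique h⟩, fun v hv => ?_⟩
  rw [hv.unique h, D.regL_eq]

end LData

/-! ### Period one and existence of the data -/

lemma theta_I_ne_zero : theta UpperHalfPlane.I ≠ 0 := by
  have e : theta UpperHalfPlane.I = jacobiTheta (2 * I) := by
    rw [theta, jacobiTheta]
    congr 1
    funext n
    rw [UpperHalfPlane.coe_I]
    ring_nf
  have him : (2 * I : ℂ).im = 2 := by simp
  have h := norm_jacobiTheta_sub_one_le (τ := 2 * I) (by rw [him]; norm_num)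
  -- With x = e^{-2π}, the bound 2x/(1 - x) for |θ(i) - 1| is below 1 exactly when x < 1/3.
  have hx : Real.exp (-Real.pi * 2) < 1 / 3 := by
    have h1 : Real.exp (-Real.pi * 2) ≤ Real.exp (-2) :=
      Real.exp_le_exp.2 (by linarith [Real.pi_gt_three])
    have h2 : Real.exp (-2) * Real.exp 2 = 1 := by rw [← Real.exp_add]; simp
    have h3 := Real.add_one_lt_exp (x := 2) (by norm_num)
    nlinarith [Real.exp_pos (-2)]
  rw [him] at h
  rw [e]
  intro h0
  rw [h0, zero_sub, norm_neg, norm_one, div_mul_eq_mul_div, le_div_iff₀ (by linarith)] at h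
  linarith

lemma T_mem_Gamma0 (M : ℕ) : ModularGroup.T ∈ CongruenceSubgroup.Gamma0 M := by
  rw [CongruenceSubgroup.Gamma0_mem]
  simp [ModularGroup.T]

lemma coe_T_smul (z : ℍ) : ((ModularGroup.T • z : ℍ) : ℂ) = (z : ℂ) + 1 := by
  rw [modular_T_smul, UpperHalfPlane.coe_vadd]
  push_cast
  ring

lemma cd_T (z : ℍ) : cd ModularGroup.T z = 1 := by
  simp [cd, ModularGroup.T]

lemma theta_T_smul (z : ℍ) : theta (ModularGroup.T • z) = theta z := by
  rw [theta, theta, coe_T_smul]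
  congr 1
  funext n
  rw [mul_add, Complex.exp_add, mul_one]
  have := Complex.exp_int_mul_two_pi_mul_I (n ^ 2)
  push_cast at this
  rw [show 2 * Real.pi * I * (n : ℂ) ^ 2 = (n : ℂ) ^ 2 * (2 * Real.pi * I) by ring, this, mul_one]

lemma thetaMultiplier_T : thetaMultiplier ModularGroup.T = 1 := by
  rw [thetaMultiplier, theta_T_smul, cd_T, one_cpow, one_mul, div_self theta_I_ne_zero]

lemma IsWeaklyHolomorphic.T_smul {N : ℕ} {m : ℤ} {g : ℍ → ℂ} (hg : IsWeaklyHolomorphic N m g)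
    (z : ℍ) : g (ModularGroup.T • z) = g z := by
  rw [hg.modular _ (T_mem_Gamma0 _), thetaMultiplier_T, cd_T, one_zpow, one_cpow, one_mul, one_mul]

/-- The coefficients of a generalized Fourier expansion are determined by the function. -/
lemma QExp.eq_zero {κ : ℝ} {w : ℕ} {a : ℤ → ℂ} (h : QExp κ w a 0) (n : ℤ) : a n = 0 := by
  by_contra hn
  obtain ⟨n₀, hn₀⟩ := h.principal
  obtain ⟨l, hl, hmin⟩ := Int.exists_least_of_bdd (P := fun n => a n ≠ 0)
    ⟨n₀, fun k hk => not_lt.1 fun hlt => hk (hn₀ k hlt)⟩ ⟨n, hn⟩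
  have hw : (0 : ℝ) < w := by exact_mod_cast h.width_pos
  have hfreq : ∀ k, freq κ w k - freq κ w l = ((k : ℝ) - l) / w := by
    intro k
    rw [freq, freq]
    ring
  -- Divide the vanishing expansion at iy by its leading exponential: as y → ∞ only the least index
  -- l survives, forcing its coefficient to be zero.
  set f : ℝ → ℤ → ℂ := fun y k => a k * (Real.exp (-(2 * Real.pi * (freq κ w k - freq κ w l) * y)) : ℂ)
  have hsum : ∀ y : ℝ, 0 < y → HasSum (f y) 0 := by
    intro y hy
    have h1 := (h.expansion (I * y) (mul_I_mem_upper hy)).mul_right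
      (cexp (2 * Real.pi * freq κ w l * y))
    simp only [Pi.zero_apply, zero_mul] at h1
    have e : ∀ k, a k * cexp (2 * Real.pi * I * (freq κ w k : ℝ) * (I * y)) *
        cexp (2 * Real.pi * freq κ w l * y) = f y k := by
      intro k
      simp only [f]
      rw [mul_assoc, ← Complex.exp_add]
      push_cast
      congr 2
      linear_combination (2 * Real.pi * freq κ w k * y : ℂ) * I_mul_I
    simpa only [e] using h1
  have hlim : Tendsto (fun y : ℝ => ∑' k, f y k) atTop (𝓝 (∑' k, if k = l then a l else 0)) := by
    refine tendsto_tsum_of_dominated_convergence (bound := fun k => ‖f 1 k‖) ?_ ?_ ?_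
    · exact (hsum 1 one_pos).summable.norm
    · intro k
      split_ifs with hk
      · subst hk
        simp [f]
      · rcases lt_or_gt_of_ne hk with hk | hk
        · have : a k = 0 := by
            by_contra h0
            exact absurd (hmin k h0) (not_le.2 hk)
          simp [f, this]
        · have hpos : 0 < 2 * Real.pi * (freq κ w k - freq κ w l) := by
            rw [hfreq]
            have : (l : ℝ) < k := by exact_mod_cast hk
            have : 0 < (k : ℝ) - l := by linarith
            positivity
          have h2 : Tendsto (fun y : ℝ => Real.exp (-(2 * Real.pi * (freq κ w k - freq κ w l) * y)))
              atTop (𝓝 0) :=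
            Real.tendsto_exp_neg_atTop_nhds_zero.comp (tendsto_id.const_mul_atTop hpos)
          have h3 := (continuous_ofReal.tendsto 0).comp h2
          simpa [f] using h3.const_mul (a k)
    · filter_upwards [eventually_ge_atTop 1] with y hy k
      by_cases h0 : a k = 0
      · simp [f, h0]
      · have hk : (l : ℝ) ≤ k := by exact_mod_cast hmin k h0
        have hnn : 0 ≤ 2 * Real.pi * (freq κ w k - freq κ w l) := by
          rw [hfreq]
          have : 0 ≤ (k : ℝ) - l := by linarith
          positivity
        simp only [f, norm_mul, norm_real, Real.norm_eq_abs, Real.abs_exp]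
        gcongr
  rw [tsum_ite_eq] at hlim
  have h0 : Tendsto (fun y : ℝ => ∑' k, f y k) atTop (𝓝 0) := by
    refine tendsto_const_nhds.congr' ?_
    filter_upwards [eventually_gt_atTop 0] with y hy
    exact (hsum y hy).tsum_eq.symm
  exact hl (tendsto_nhds_unique hlim h0)

/-- A function with period `1` and an expansion at `i∞` has an expansion in integral powers of
`exp (2 π i z)`. -/
lemma HasFourierExpansion.exists_integral {m : ℤ} {g : ℍ → ℂ} {κ : ℝ} {w : ℕ} {b : ℤ → ℂ}
    (h : HasFourierExpansion m g 1 κ w b) (hT : ∀ z : ℍ, g (ModularGroup.T • z) = g z) :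
    ∃ b', HasFourierExpansion m g 1 0 1 b' := by
  have hw : (w : ℂ) ≠ 0 := by exact_mod_cast h.width_pos.ne'
  -- This is the expansion of g(z + 1) - g(z) = 0. By uniqueness, b(n) ≠ 0 forces (n + κ)/w to be an
  -- integer.
  have hz : QExp κ w (fun n => b n * (cexp (2 * Real.pi * I * (((n : ℂ) + κ) / w)) - 1)) 0 := by
    refine ⟨h.shift_nonneg, h.shift_lt_one, h.width_pos, ?_, fun τ hτ => ?_⟩
    · obtain ⟨n₀, hn₀⟩ := h.principal
      exact ⟨n₀, fun n hn => by simp [hn₀ n hn]⟩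
    · have h1 := h.expansion (ofComplex τ)
      have h2 := h.expansion (ModularGroup.T • ofComplex τ)
      rw [cd_one, one_cpow, one_smul, one_mul] at h1 h2
      rw [hT, coe_T_smul] at h2
      have h3 := h2.sub h1
      rw [sub_self, coe_ofComplex hτ] at h3
      refine h3.congr_fun ?_
      intro n
      rw [show 2 * Real.pi * I * ((n : ℂ) + κ) * (τ + 1) / w =
        2 * Real.pi * I * (((n : ℂ) + κ) / w) + 2 * Real.pi * I * (freq κ w n : ℝ) * τ by
          rw [freq]; push_cast; ring, show 2 * Real.pi * I * ((n : ℂ) + κ) * τ / w =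
        2 * Real.pi * I * (freq κ w n : ℝ) * τ by rw [freq]; push_cast; ring, Complex.exp_add]
      ring
  have hint : ∀ n : ℤ, b n ≠ 0 → ∃ j : ℤ, (n : ℝ) + κ = j * w := by
    intro n hn
    have h1 := (mul_eq_zero.1 (hz.eq_zero n)).resolve_left hn
    obtain ⟨j, hj⟩ := Complex.exp_eq_one_iff.1 (sub_eq_zero.1 h1)
    refine ⟨j, ?_⟩
    rw [mul_comm (j : ℂ), mul_right_inj' (by simp [Real.pi_ne_zero]), div_eq_iff hw] at hj
    exact_mod_cast hj
  by_cases hκ : κ = 0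
  · subst hκ
    have hw' : (w : ℤ) ≠ 0 := by exact_mod_cast h.width_pos.ne'
    have hinj : Function.Injective fun j : ℤ => j * (w : ℤ) := mul_left_injective₀ hw'
    refine ⟨fun j => b (j * w), le_rfl, one_pos, one_pos, ?_, fun z => ?_⟩
    · obtain ⟨n₀, hn₀⟩ := h.principal
      refine ⟨min n₀ 0, fun j hj => hn₀ _ ?_⟩
      have h1 : (1 : ℤ) ≤ w := by exact_mod_cast h.width_pos
      have h2 := min_le_left n₀ 0
      have h3 := min_le_right n₀ 0
      nlinarith
    · have h1 := (hinj.hasSum_iff (fun n hn => ?_)).2 (h.expansion z)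
      · refine h1.congr_fun fun j => ?_
        simp only [Function.comp_apply]
        congr 2
        push_cast
        field_simp
        ring
      · by_cases h0 : b n = 0
        · simp [h0]
        · obtain ⟨j, hj⟩ := hint n h0
          refine absurd ⟨j, ?_⟩ hn
          rw [add_zero] at hj
          exact_mod_cast hj.symm
  -- For 0 < κ < 1 no n + κ is an integer, so g vanishes and the zero coefficients serve.
  · have hb : ∀ n, b n = 0 := by
      intro n
      by_contra h0
      obtain ⟨j, hj⟩ := hint n h0
      have h1 : κ = ((j * w - n : ℤ) : ℝ) := by
        push_cast
        linarith
      have h2 := h.shift_nonneg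
      have h3 := h.shift_lt_one
      rw [h1] at h2 h3 hκ
      have h4 : 0 ≤ j * (w : ℤ) - n := by exact_mod_cast h2
      have h5 : j * (w : ℤ) - n < 1 := by exact_mod_cast h3
      exact hκ (by exact_mod_cast (show j * (w : ℤ) - n = 0 by omega))
    refine ⟨0, le_rfl, one_pos, one_pos, ⟨0, fun _ _ => rfl⟩, fun z => ?_⟩
    have := h.expansion z
    simpa [hb] using this

lemma exists_mapsInftyTo (r : ℚ) : ∃ γ : SL(2, ℤ), MapsInftyTo γ r := by
  obtain ⟨u, v, huv⟩ : IsCoprime r.num (r.den : ℤ) := by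
    rw [Int.isCoprime_iff_gcd_eq_one]
    exact r.reduced
  refine ⟨⟨!![r.num, -v; (r.den : ℤ), u], ?_⟩, ?_, ?_⟩
  · rw [Matrix.det_fin_two_of]
    linear_combination huv
  · simp
  · simp [Rat.num_div_den]

lemma IsWeaklyHolomorphic.exists_data {N : ℕ} {m : ℤ} {g : ℍ → ℂ} (hg : IsWeaklyHolomorphic N m g)
    {γ : SL(2, ℤ)} {r : ℚ} (hr : MapsInftyTo γ r) : ∃ D : LData m g r, D.γ = γ := by
  obtain ⟨κ₀, w₀, b₀, h₀⟩ := hg.cusps 1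
  obtain ⟨b, hb⟩ := h₀.exists_integral hg.T_smul
  obtain ⟨κ, w, bγ, hbγ⟩ := hg.cusps γ
  exact ⟨⟨γ, hr, b, hb, κ, w, bγ, hbγ⟩, rfl⟩

/-! ### The functional equation -/

lemma cd_ne_zero {γ : SL(2, ℤ)} (hc : γ 1 0 ≠ 0) (z : ℍ) : cd γ z ≠ 0 := by
  rw [cd_eq hc]
  exact mul_ne_zero (by exact_mod_cast hc) (ne_zero_of_upper (sub_pole_mem_upper γ z))

lemma seg_const_mul {f f' : ℂ → ℂ} {C : ℂ} (h : ∀ τ ∈ upper, f τ = C * f' τ) {z w : ℂ}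
    (hz : z ∈ upper) (hw : w ∈ upper) : seg f z w = C * seg f' z w := by
  rw [seg, seg, ← intervalIntegral.integral_const_mul]
  refine intervalIntegral.integral_congr fun t ht => ?_
  rw [uIcc_of_le zero_le_one] at ht
  have := h _ (segment_mem_upper hz hw ht)
  rw [this, mul_assoc]

lemma inv_one_zero (γ : SL(2, ℤ)) : γ⁻¹ 1 0 = -γ 1 0 := by
  rw [Matrix.SpecialLinearGroup.SL2_inv_expl]
  simp

lemma pole_inv {γ : SL(2, ℤ)} {r : ℚ} (hr : MapsInftyTo γ r) : pole γ⁻¹ = r := by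
  have h11 : γ⁻¹ 1 1 = γ 0 0 := by
    rw [Matrix.SpecialLinearGroup.SL2_inv_expl]
    simp
  rw [pole, inv_one_zero, h11, hr.2]
  push_cast
  rw [neg_div_neg_eq]

lemma pole_eq_of_inv {γ : SL(2, ℤ)} {r' : ℚ} (hr' : MapsInftyTo γ⁻¹ r') : pole γ = r' := by
  rw [← pole_inv hr', inv_inv]

lemma slashFun_eq_shiftFun {N : ℕ} {m : ℤ} {g : ℍ → ℂ} (hg : IsWeaklyHolomorphic N m g)
    {γ : SL(2, ℤ)} (hγ : γ ∈ CongruenceSubgroup.Gamma0 (4 * N)) (hc : γ 1 0 ≠ 0) {x : ℂ} (τ : ℂ) :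
    slashFun m g γ x τ = thetaMultiplier γ ^ m * shiftFun g x τ := by
  have h := cd_ne_zero hc (ofComplex (x + τ))
  have h' : cd γ (ofComplex (x + τ)) ^ wt m ≠ 0 := by simp [cpow_eq_zero_iff, h]
  rw [slashFun, shiftFun, hg.modular γ hγ, cpow_neg]
  field_simp

/-- The matrix γ⁻¹ carries the path from r to i∞ into the path from i∞ to r', which explains the
minus sign. In terms of the data, the contribution of each cusp of `D` is a multiple of that of the
other cusp of `D'`. -/
lemma LData.integralValue_inv {N : ℕ} {m : ℤ} {g : ℍ → ℂ} (hg : IsWeaklyHolomorphic N m g) {r r' : ℚ}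
    (D : LData m g r) (D' : LData m g r') (hD : D'.γ = D.γ⁻¹)
    (hγ : D.γ ∈ CongruenceSubgroup.Gamma0 (4 * N)) {s : ℂ} (hs : s ≠ 0) (hs' : wt m - s ≠ 0) :
    D.integralValue s = -(cuspFactor m (D.γ 1 0) s 0 * thetaMultiplier D.γ ^ m) *
      D'.integralValue (wt m - s) := by
  have hr := D.maps
  have hr' := D'.maps
  have hc := hr.1
  have hq := D.qExp₂
  have hq' := D'.qExp₂
  have hp : (pole D.γ : ℂ) = r' := by
    rw [pole_eq_of_inv (hD ▸ hr'), ofReal_ratCast]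
  have hc' : D'.γ 1 0 = -D.γ 1 0 := by rw [hD, inv_one_zero]
  have hT : cuspHeight (D'.γ 1 0) = cuspHeight (D.γ 1 0) := by simp [hc', cuspHeight]
  have hinv : inversion (D'.γ 1 0) = inversion (D.γ 1 0) := by
    funext τ
    rw [hc', inversion_neg]
  have hTpos := cuspHeight_pos hc
  set T := cuspHeight (D.γ 1 0)
  set c := D.γ 1 0
  set X := thetaMultiplier D.γ ^ m
  have hslash : ∀ τ : ℂ, slashFun m g D.γ (pole D.γ) τ = X * shiftFun g r' τ := by
    intro τ
    rw [hp]
    exact slashFun_eq_shiftFun hg hγ hc τ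
  have hbeta : ∀ τ p : ℂ, betaFun (slashFun m g D.γ (pole D.γ)) p 0 τ =
      X * betaFun (shiftFun g r') p 0 τ := by
    intro τ p
    rw [betaFun, hslash, betaFun]
    ring
  -- the expansion of `D` at its cusp is that of `D'` at infinity
  have e1 : regValue T D.κ D.w D.coeff₂ (wt m - s) = X * regValue T 0 1 D'.coeff₁ (wt m - s) :=
    D'.qExp₁.regValue_scaling hq (fun τ _ => hslash τ) hTpos _
  -- and conversely, up to a constant
  set K := cuspFactor m c s 0 * X * cuspFactor m (D'.γ 1 0) (wt m - s) 0
  have hK : ∀ τ ∈ upper, betaFun (shiftFun g r) s 0 τ =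
      K * betaFun (slashFun m g D'.γ (pole D'.γ)) s 0 τ := by
    intro τ hτ
    have hτ' := inversion_mem_upper hc hτ
    have h1 := shiftFun_inversion m g hr s hτ'
    have h2 := shiftFun_inversion m g hr' (wt m - s) hτ
    rw [inversion_inversion hc hτ, hbeta] at h1
    rw [hinv, sub_sub_cancel] at h2
    have hcC : ((D.γ 1 0 : ℤ) : ℂ) ≠ 0 := by exact_mod_cast hc
    have h0 := ne_zero_of_upper hτ
    have h3 : (((D.γ 1 0 : ℤ) : ℂ) ^ 2 * inversion c τ ^ 2)⁻¹ =
        ((D.γ 1 0 : ℤ) : ℂ) ^ 2 * τ ^ 2 := by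
      rw [inversion]
      field_simp
      rfl
    have h4 : ((D'.γ 1 0 : ℤ) : ℂ) ^ 2 = ((D.γ 1 0 : ℤ) : ℂ) ^ 2 := by simp [hc', c]
    rw [h3] at h1
    rw [h4, ← div_eq_mul_inv, div_eq_iff (by positivity)] at h2
    rw [h2] at h1
    refine mul_right_cancel₀ (b := ((D.γ 1 0 : ℤ) : ℂ) ^ 2 * τ ^ 2) (by positivity) ?_
    rw [h1]
    ring
  have e2 : regValue T 0 1 D.coeff₁ s = K * regValue T D'.κ D'.w D'.coeff₂ s := by
    refine hq'.regValue_scaling D.qExp₁ (fun τ hτ => ?_) hTpos s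
    have h0 : τ ^ (s - 1) ≠ 0 := by simp [cpow_eq_zero_iff, ne_zero_of_upper hτ]
    have := hK τ hτ
    simp only [betaFun, mul_zero, zero_mul, Complex.exp_zero, mul_one] at this
    refine mul_right_cancel₀ h0 ?_
    rw [this]
    ring
  -- The definition uses height 1 at infinity and T = 1/c² at the cusp, while `e1` and `e2` compare
  -- values at height T only. The two corrections are segment integrals between iT and i, which the
  -- inversion interchanges, so they match by `e5`. Nonzero s and k - s are needed for the shifts.
  have e3 := D.qExp₁.regValue_shift one_pos hTpos hs
  have e4 := D'.qExp₁.regValue_shift hTpos one_pos hs'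
  have e5 := seg_inversion hr s D.qExp₁ hq (mul_I_mem_upper hTpos) (mul_I_mem_upper one_pos)
  rw [inversion_I_mul_cuspHeight hc, inversion_I_mul_one, seg_const_mul (fun τ _ => hbeta τ _)
    (mul_I_mem_upper hTpos) (mul_I_mem_upper one_pos)] at e5
  rw [integralValue, integralValue, sub_sub_cancel, hT, e3, e5, e1, e2, e4]
  ring

lemma two_pi_div_I_mul_inv (s : ℂ) :
    (2 * Real.pi : ℂ) ^ (-s) * (2 * Real.pi / I : ℂ) ^ s = (I ^ s)⁻¹ := by
  have h : (2 * Real.pi : ℂ) ^ s ≠ 0 := by simp [cpow_eq_zero_iff, Real.pi_ne_zero]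
  rw [two_pi_div_I_cpow, cpow_neg, inv_mul_cancel_left₀ h]

lemma LData.Gamma_mul_value {m : ℤ} {g : ℍ → ℂ} {r : ℚ} (D : LData m g r) {s : ℂ}
    (hs : ∀ n : ℕ, s ≠ -(n : ℂ)) :
    Gamma s * (2 * Real.pi : ℂ) ^ (-s) * D.value s = (I ^ s)⁻¹ * D.integralValue s := by
  have h := Gamma_ne_zero hs
  rw [value_eq, ← two_pi_div_I_mul_inv]
  field_simp

lemma functional_equation {N : ℕ} {m : ℤ} {g : ℍ → ℂ} (hg : IsWeaklyHolomorphic N m g)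
    {γ : SL(2, ℤ)} (hγ : γ ∈ CongruenceSubgroup.Gamma0 (4 * N)) {r r' : ℚ} (hr : MapsInftyTo γ r)
    (hr' : MapsInftyTo γ⁻¹ r') {s : ℂ} (hs : ∀ n : ℕ, s ≠ -(n : ℂ))
    (hs' : ∀ n : ℕ, wt m - s ≠ -(n : ℂ)) :
    Gamma s * (2 * Real.pi : ℂ) ^ (-s) * regL m g r s =
      I ^ wt m * ((γ 1 0 : ℤ) : ℂ) ^ (-wt m) * (((γ 1 0 : ℤ) : ℂ) ^ 2) ^ (wt m - s) *
        thetaMultiplier γ ^ m * Gamma (wt m - s) * (2 * Real.pi : ℂ) ^ (-(wt m - s)) *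
        regL m g r' (wt m - s) := by
  obtain ⟨D, rfl⟩ := hg.exists_data hr
  obtain ⟨D', hD⟩ := hg.exists_data hr'
  have h1 := D.Gamma_mul_value hs
  have h2 := D'.Gamma_mul_value hs'
  rw [D.integralValue_inv hg D' hD hγ (by simpa using hs 0) (by simpa using hs' 0),
    cuspFactor_zero m hr.1, exp_pi_mul_I_mul] at h1
  rw [cpow_sub _ _ I_ne_zero] at h2
  have hI : I ^ s ≠ 0 := by simp [cpow_eq_zero_iff]
  have hIk : I ^ wt m ≠ 0 := by simp [cpow_eq_zero_iff]
  rw [← D.value_eq_regL, ← D'.value_eq_regL, h1, cpow_neg ((D.γ 1 0 : ℤ) : ℂ)]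
  have h3 : D'.integralValue (wt m - s) = I ^ wt m / I ^ s *
      (Gamma (wt m - s) * (2 * Real.pi : ℂ) ^ (-(wt m - s)) * D'.value (wt m - s)) := by
    rw [h2]
    field_simp
  rw [h3]
  field_simp

end RegL

end

theorem lemma4p1 (N : ℕ) (hN : 0 < N) (m : ℤ) (g : ℍ → ℂ)
    (hg : RegL.IsWeaklyHolomorphic N m g) :
    -- the data in the definition exist, and the series converge absolutely
    (∀ r : ℚ, Nonempty (RegL.LData m g r) ∧
      (∀ (D : RegL.LData m g r) (s : ℂ), s ≠ 0 → s ≠ RegL.wt m →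
        Summable (fun n : ℤ => ‖D.term₁ s n‖) ∧ Summable (fun n : ℤ => ‖D.term₂ s n‖)) ∧
      (∀ s : ℂ, s ≠ 0 → s ≠ RegL.wt m → AnalyticAt ℂ (RegL.regL m g r) s) ∧
      (RegL.ConstantTermsVanish m g → Differentiable ℂ (RegL.regL m g r))) ∧
    -- meromorphic continuation of the regularized integral, independence of the choices
    (∀ r : ℚ, MeromorphicOn (RegL.regL m g r) univ ∧
      (∀ γ : SL(2, ℤ), RegL.MapsInftyTo γ r → ∀ s : ℂ, (m : ℝ) / 2 < s.re → s ≠ 0 →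
        RegL.IntegralRepresentation g γ r s (RegL.regL m g r s)) ∧
      (RegL.ConstantTermsVanish m g → ∀ γ : SL(2, ℤ), RegL.MapsInftyTo γ r → ∀ s : ℂ,
        RegL.IntegralRepresentation g γ r s (RegL.regL m g r s)) ∧
      (∀ (D : RegL.LData m g r) (s : ℂ), D.value s = RegL.regL m g r s)) ∧
    -- functional equation
    (∀ γ ∈ CongruenceSubgroup.Gamma0 (4 * N), ∀ r r' : ℚ,
      RegL.MapsInftyTo γ r → RegL.MapsInftyTo γ⁻¹ r' →
      ∀ s : ℂ, (∀ n : ℕ, s ≠ -(n : ℂ)) → (∀ n : ℕ, RegL.wt m - s ≠ -(n : ℂ)) →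
        Gamma s * (2 * Real.pi : ℂ) ^ (-s) * RegL.regL m g r s =
          I ^ RegL.wt m * ((γ 1 0 : ℤ) : ℂ) ^ (-RegL.wt m) *
            (((γ 1 0 : ℤ) : ℂ) ^ 2) ^ (RegL.wt m - s) * RegL.thetaMultiplier γ ^ m *
            Gamma (RegL.wt m - s) * (2 * Real.pi : ℂ) ^ (-(RegL.wt m - s)) *
            RegL.regL m g r' (RegL.wt m - s)) := by
  refine ⟨fun r => ?_, fun r => ?_, fun γ hγ r r' hr hr' s hs hs' =>
    RegL.functional_equation hg hγ hr hr' hs hs'⟩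
  · obtain ⟨γ, hr⟩ := RegL.exists_mapsInftyTo r
    obtain ⟨D, -⟩ := hg.exists_data hr
    exact ⟨⟨D⟩, fun D s _ _ => ⟨D.summable_term₁ s, D.summable_term₂ s⟩,
      fun s hs hs' => D.analyticAt_regL (Or.inl hs) (Or.inl (sub_ne_zero.2 hs'.symm)),
      D.differentiable_regL⟩
  · obtain ⟨γ, hr⟩ := RegL.exists_mapsInftyTo r
    obtain ⟨D, -⟩ := hg.exists_data hr
    refine ⟨D.meromorphicOn_regL, fun γ hγ s hs hs' => ?_, fun hv γ hγ s => ?_,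
      RegL.LData.value_eq_regL⟩
    -- The condition s ≠ 0 takes care of i∞, and Re(k - s) < 0 of the cusp r.
    · obtain ⟨D, rfl⟩ := hg.exists_data hγ
      refine D.integralRepresentation (Or.inl hs') (Or.inl ?_)
      rw [Complex.sub_re, RegL.wt_re]
      linarith
    · obtain ⟨D, rfl⟩ := hg.exists_data hγ
      exact D.integralRepresentation (Or.inr (D.constTerm₁_eq_zero hv))
        (Or.inr (D.constTerm₂_eq_zero hv))
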